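/- **Setting.** Let $d\ge 2$ and $k\ge 1$. Let $\Omega\subset\mathbb R^d$ be an open set with $\Omega=\operatorname{int}\overline\Omega$, and let $\mathcal T_h$ be a finite partition of $\overline\Omega$ into full-dimensional convex polytopes $T$ (polygons if $d=2$, polyhedra if $d=3$) with pairwise disjoint interiors, such that every edge/face ($(d-1)$-dimensional face; "edge" below) of an element either lies on $\partial\Omega$ or is also an edge of another element. Let $\mathcal E_h$ be the set of all edges, and let $h_T$, $h_e$ denote the diameters of $T$ and $e$. The mesh is assumed shape regular with constants $\rho_v,\rho_e,\kappa,\alpha_0>0$: for every $T\in\mathcal T_h$ and every edge $e$ of $T$, $$\rho_v h_T^d\le |T|,\qquad \rho_e h_e^{d-1}\le |e|,\qquad \kappa h_T\le h_e,$$ and the interior angle of $T$ between any two of its edges that share a $(d-2)$-dimensional face lies in $[\alpha_0,\pi-\alpha_0]$. Let $P_m(T)$ be the polynomials of degree at most $m$ on $T$. Two methods are considered. * Case 1 (strong boundary condition): $V_h=\{v\in L^2(\Omega): v|_T\in P_k(T)\ \forall T\in\mathcal T_h,\ v|_{\partial\Omega}=0\}$, and $\{v\}=v$ on edges $e\subset\partial\Omega$.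 * Case 2 (weak boundary condition): $V_h=\{v\in L^2(\Omega): v|_T\in P_k(T)\ \forall T\in\mathcal T_h\}$, and $\{v\}=0$ on edges $e\subset\partial\Omega$. In both cases $\{v\}=\frac12(v|_{T_1}+v|_{T_2})$ on an interior edge shared by $T_1,T_2$; the jump is $[v]=v|_{T_1}-v|_{T_2}$ on such an edge and $[v]=v$ on $e\subset\partial\Omega$. On each $T$ put $j=n+k-1$, where $n$ is the number of edges of $T$. The weak gradient $\nabla_w v$ of $v\in V_h$ is defined on each $T$ by $\nabla_w v|_T\in[P_j(T)]^d$ and $$(\nabla_w v,\mathbf q)_T=-(v,\nabla\cdot\mathbf q)_T+\langle\{v\},\mathbf q\cdot\mathbf n\rangle_{\partial T}\qquad\forall\,\mathbf q\in[P_j(T)]^d,$$ with $\mathbf n$ the unit outward normal of $T$. Put $$|||v|||^2=\sum_{T\in\mathcal T_h}\|\nabla_w v\|_T^2,\qquad \|v\|_{1,h}^2=\sum_{T\in\mathcal T_h}\|\nabla v\|_T^2+\sum_{e\in\mathcal E_h}h_e^{-1}\|[v]\|_e^2 .$$ **Lemma.** There are constants $C_1,C_2>0$, depending only on $d,k,\rho_v,\rho_e,\kappa,\alpha_0$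 (in particular not on the mesh size $h$), such that for every such $\Omega$ and $\mathcal T_h$, in both cases and for every $v\in V_h$, the weak gradient $\nabla_w v$ exists and is unique, and $$C_1\|v\|_{1,h}\le |||v|||\le C_2\|v\|_{1,h}.$$ -/

import Mathlib

open MeasureTheory
open scoped RealInnerProductSpace

noncomputable section

namespace ConformingDG

/-- The Euclidean space `ℝ^d`. -/
abbrev E (d : ℕ) := EuclideanSpace ℝ (Fin d)

/-- A full-dimensional convex polytope (polygon if `d = 2`, polyhedron if `d = 3`), given as an
irredundant bounded intersection of finitely many half-spaces `⟪normal i, x⟫ ≤ offset i`.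
The index `i : Fin numFaces` runs through the edges/faces, `normal i` is the unit outward normal on
the `i`-th one. -/
structure ConvexPolytope (d : ℕ) where
  /-- the number of edges/faces -/
  numFaces : ℕ
  normal : Fin numFaces → E d
  offset : Fin numFaces → ℝ
  norm_normal : ∀ i, ‖normal i‖ = 1
  isBounded : Bornology.IsBounded {x : E d | ∀ i, ⟪normal i, x⟫ ≤ offset i}
  nonempty_interior : (interior {x : E d | ∀ i, ⟪normal i, x⟫ ≤ offset i}).Nonempty
  /-- Irredundancy: every constraint is active, alone, at some point. Hence the `i`-th face is
  really `(d-1)`-dimensional, and different indices have different faces, in different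
  hyperplanes. -/
  irredundant : ∀ i, ∃ x : E d, ⟪normal i, x⟫ = offset i ∧ ∀ j, j ≠ i → ⟪normal j, x⟫ < offset j

namespace ConvexPolytope

variable {d : ℕ}

/-- The closed polytope, as a set of points. -/
def carrier (T : ConvexPolytope d) : Set (E d) := {x | ∀ i, ⟪T.normal i, x⟫ ≤ T.offset i}

/-- The `i`-th (closed) edge/face. -/
def face (T : ConvexPolytope d) (i : Fin T.numFaces) : Set (E d) :=
  {x | x ∈ T.carrier ∧ ⟪T.normal i, x⟫ = T.offset i}

/-- Two different edges/faces are neighbours if they meet in a common vertex (`d = 2`), in a common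
edge (`d = 3`), in a common face of dimension `d - 2` (general `d`), i.e. if at some point of the
polytope precisely these two constraints are active. -/
def Neighbors (T : ConvexPolytope d) (i j : Fin T.numFaces) : Prop :=
  i ≠ j ∧ ∃ x : E d, ⟪T.normal i, x⟫ = T.offset i ∧ ⟪T.normal j, x⟫ = T.offset j ∧
    ∀ l, l ≠ i → l ≠ j → ⟪T.normal l, x⟫ < T.offset l

/-- Shape regularity of one element, `h_T` and `h_e` being diameters:
`ρv h_T ^ d ≤ |T|`, and for every edge/face `e` of `T`, `ρe h_e ^ (d-1) ≤ |e|` and `κ h_T ≤ h_e`;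
the interior angle between two neighbouring edges/faces (which is `π` minus the angle of their
outward normals) lies in `[α₀, π - α₀]`. -/
structure ShapeRegular (T : ConvexPolytope d) (ρv ρe κ α₀ : ℝ) : Prop where
  volume_ge : ρv * Metric.diam T.carrier ^ d ≤ (volume : Measure (E d)).real T.carrier
  area_ge : ∀ i, ρe * Metric.diam (T.face i) ^ (d - 1) ≤
    (Measure.euclideanHausdorffMeasure (d - 1) : Measure (E d)).real (T.face i)
  diam_face_ge : ∀ i, κ * Metric.diam T.carrier ≤ Metric.diam (T.face i)
  angle : ∀ i j, T.Neighbors i j →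
    Real.pi - InnerProductGeometry.angle (T.normal i) (T.normal j) ∈ Set.Icc α₀ (Real.pi - α₀)

/-- `∫_T f dx`. -/
def integral (T : ConvexPolytope d) (f : E d → ℝ) : ℝ := ∫ x in T.carrier, f x

/-- `∫_e f ds` over the `i`-th edge/face `e`, with respect to the `(d-1)`-dimensional surface
measure (Hausdorff measure, normalized so as to be Lebesgue measure on each hyperplane). -/
def faceIntegral (T : ConvexPolytope d) (i : Fin T.numFaces) (f : E d → ℝ) : ℝ :=
  ∫ x in T.face i, f x ∂(Measure.euclideanHausdorffMeasure (d - 1) : Measure (E d))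

end ConvexPolytope

/-- A partition of `Ω` into finitely many convex polytopes: they cover, have disjoint interiors, and
each edge/face of an element either lies on `∂Ω` or is also an edge/face of another element. -/
structure PolytopalMesh {d : ℕ} (Ω : Set (E d)) where
  numElems : ℕ
  elem : Fin numElems → ConvexPolytope d
  iUnion_carrier : ⋃ T, (elem T).carrier = closure Ω
  disjoint_interior : ∀ T T', T ≠ T' →
    Disjoint (interior (elem T).carrier) (interior (elem T').carrier)
  conforming : ∀ T i, (elem T).face i ⊆ frontier Ω ∨
    ∃ T', T' ≠ T ∧ ∃ i', (elem T').face i' = (elem T).face i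

/-- A polynomial in `d` variables as a function on `ℝ^d`. -/
def peval {d : ℕ} (p : MvPolynomial (Fin d) ℝ) (x : E d) : ℝ := MvPolynomial.eval (fun i => x i) p

/-- The two treatments of the boundary condition: it is enforced strongly (`v|_{∂Ω} = 0` is part of
the definition of the space) or weakly (`{v} = 0` on `∂Ω`). -/
inductive BoundaryTreatment
  | strong
  | weak

namespace PolytopalMesh

variable {d : ℕ} {Ω : Set (E d)} (M : PolytopalMesh Ω)

/-- A side: an element together with one of its edges/faces. -/
abbrev Side := Σ T : Fin M.numElems, Fin (M.elem T).numFaces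

/-- The edge/face of a side, as a point set. -/
def sideSet (s : M.Side) : Set (E d) := (M.elem s.1).face s.2

/-- The set `𝓔_h` of all edges/faces of the mesh (an edge/face common to two elements is one
member of it). -/
def Edge : Type := Set.range M.sideSet

instance : Finite M.Edge := inferInstanceAs (Finite (Set.range M.sideSet))

instance : Fintype M.Edge := Fintype.ofFinite _

/-- An element having the given edge/face `e` and the index of `e` in it. Which of the (at most two)
elements is taken is not essential. -/
def Edge.side {M : PolytopalMesh Ω} (e : M.Edge) : M.Side := Classical.choose e.2

/-- The edge/face lies on `∂Ω`. -/
def OnBoundary (s : M.Side) : Prop := M.sideSet s ⊆ frontier Ω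

open Classical in
/-- The element on the other side of an interior edge/face. (It exists by `conforming`; the value on
the boundary is irrelevant.) -/
def opposite (s : M.Side) : Fin M.numElems :=
  if h : ∃ T', T' ≠ s.1 ∧ ∃ i', (M.elem T').face i' = (M.elem s.1).face s.2 then h.choose else s.1

/-- Piecewise polynomial functions: one polynomial for each element. (The elements have nonempty
disjoint interiors and cover `Ω` up to a null set, so this is the same as an element of `L²(Ω)`
which is polynomial on each element.) -/
abbrev Broken := Fin M.numElems → MvPolynomial (Fin d) ℝ

/-- Membership in the discontinuous finite element space `V_h`: `v|_T ∈ P_k(T)` for all `T`, and in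
the strong case also `v = 0` on `∂Ω`. -/
def InVh (b : BoundaryTreatment) (k : ℕ) (v : M.Broken) : Prop :=
  (∀ T, (v T).totalDegree ≤ k) ∧
    match b with
    | .strong => ∀ s, M.OnBoundary s → ∀ x ∈ M.sideSet s, peval (v s.1) x = 0
    | .weak => True

open Classical in
/-- The jump `[v]` on an edge/face: `v` on `∂Ω`, and `v|_{T₁} - v|_{T₂}` in the interior. -/
def jump (v : M.Broken) (s : M.Side) : MvPolynomial (Fin d) ℝ :=
  if M.OnBoundary s then v s.1 else v s.1 - v (M.opposite s)

open Classical in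
/-- The average `{v}` on an edge/face: `(v|_{T₁} + v|_{T₂}) / 2` in the interior; on `∂Ω` it is `v`
in the strong case and `0` in the weak case. -/
def average (b : BoundaryTreatment) (v : M.Broken) (s : M.Side) : MvPolynomial (Fin d) ℝ :=
  if M.OnBoundary s then
    match b with
    | .strong => v s.1
    | .weak => 0
  else MvPolynomial.C (1 / 2) * (v s.1 + v (M.opposite s))

/-- Piecewise polynomial vector fields. -/
abbrev BrokenField := Fin M.numElems → Fin d → MvPolynomial (Fin d) ℝ

/-- The polynomial degree `j = n + k - 1` of the weak gradient on an element, `n` being the number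
of edges/faces of the element. -/
def weakDegree (k : ℕ) (T : Fin M.numElems) : ℕ := (M.elem T).numFaces + k - 1

/-- `g` is a weak gradient of `v`: on each element `T`, `g ∈ [P_j(T)]^d` and
`(g, q)_T = -(v, ∇·q)_T + ⟨{v}, q·n⟩_{∂T}` for all `q ∈ [P_j(T)]^d`. -/
def IsWeakGradient (b : BoundaryTreatment) (k : ℕ) (v : M.Broken) (g : M.BrokenField) : Prop :=
  ∀ T, (∀ l, (g T l).totalDegree ≤ M.weakDegree k T) ∧
    ∀ q : Fin d → MvPolynomial (Fin d) ℝ, (∀ l, (q l).totalDegree ≤ M.weakDegree k T) →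
      (M.elem T).integral (fun x => ∑ l, peval (g T l) x * peval (q l) x) =
        -(M.elem T).integral
            (fun x => peval (v T) x * ∑ l, peval (MvPolynomial.pderiv l (q l)) x)
          + ∑ i, (M.elem T).faceIntegral i
              (fun x => peval (M.average b v ⟨T, i⟩) x *
                ∑ l, peval (q l) x * (M.elem T).normal i l)

/-- The weak gradient `∇_w v`. -/
def weakGradient (b : BoundaryTreatment) (k : ℕ) (v : M.Broken) : M.BrokenField :=
  Classical.epsilon (M.IsWeakGradient b k v)

/-- `|||v||| = (∑_T (∇_w v, ∇_w v)_T)^{1/2}`. -/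
def tripleNorm (b : BoundaryTreatment) (k : ℕ) (v : M.Broken) : ℝ :=
  Real.sqrt (∑ T, (M.elem T).integral (fun x => ∑ l, peval (M.weakGradient b k v T l) x ^ 2))

/-- `‖v‖_{1,h} = (∑_T ‖∇v‖_T² + ∑_e h_e⁻¹ ‖[v]‖_e²)^{1/2}`, `h_e` being the diameter of `e`. -/
def norm1h (v : M.Broken) : ℝ :=
  Real.sqrt
    (∑ T, (M.elem T).integral (fun x => ∑ l, peval (MvPolynomial.pderiv l (v T)) x ^ 2)
      + ∑ e : M.Edge, (Metric.diam (M.sideSet e.side))⁻¹ *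
          (M.elem e.side.1).faceIntegral e.side.2 (fun x => peval (M.jump v e.side) x ^ 2))

end PolytopalMesh

end ConformingDG

end

namespace ConformingDG

/-! On every face of an element `T` one has `{v} - v = -c [v]`, where `[v]` is taken as seen from
`T` and `c` is `1/2` inside `Ω` and `1` on its boundary (`average_sub_eq`; in the strong case both
sides vanish on `∂Ω`). Integration by parts therefore turns the definition of `g = ∇_w v` into `(g,
q)_T = (∇v, q)_T - ∑_e c_e ⟨[v], q·n⟩_e` (`weak_equation_eq`). Everything is proved from this
identity, one element at a time (`exists_local_estimate`).

With `q = g`, Cauchy-Schwarz and the polynomial trace inequality bound `g` by `∇v` and the jumps.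
With `q = ∇v` they bound `∇v` by `g` and the jumps. It remains to bound a jump by `g` alone
(`exists_face_estimate`). Fix a face `e = e_i`, let `B` be the product of the scaled distances to
the other `n - 1` faces, and test with `q = B ψ n_i`, `deg ψ ≤ k`; the degree `n + k - 1` of the
weak gradient admits exactly these fields, and only the term of `e` survives in the sum. For `ψ =
λ_i ∂_{n_i} v`, with `λ_i` the scaled distance to `e`, the term of `e` vanishes as well, and the
normal derivative is controlled by `g`. For `ψ` an extension of the jump off `e`, the weighted norm
of the jump is then controlled too, and the weight is removed by equivalence of norms on polynomials
of bounded degree.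

Uniform constants need geometry (`IsFat`): boundedly many faces, and balls of radius comparable to
`h_T` in `T` and in each face, on which the weights are bounded below. The inner balls are centred
at centroids (`exists_ball_subset`), and the number of faces is bounded through `d |T| = ∑ dist(b,
e) |e|`. The delicate point is that the angle condition concerns neighbouring faces only, while `B`
involves all of them; `slack_ge_of_ball` derives a lower bound on the distance to every other face
by tracing a segment until it leaves the face through a neighbour.

The divergence theorem is obtained by integrating by parts against smooth cut-offs of `T` and
letting their width tend to zero (`integral_pderiv`). Summation over elements uses that an edge
belongs to one or two sides and that its jump is the same up to sign from both. -/

/-! ### Orthogonal coordinates and surface measure on hyperplanes -/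

theorem exists_orthonormalBasis_zero_eq {m : ℕ} (u : E (m + 1)) (hu : ‖u‖ = 1) :
    ∃ b : OrthonormalBasis (Fin (m + 1)) ℝ (E (m + 1)), b 0 = u := by
  have hv : Orthonormal ℝ (Set.domRestrict {(0 : Fin (m + 1))} fun _ : Fin (m + 1) => u) := by
    constructor
    · intro i; exact hu
    · intro i j hij
      exact absurd (Subtype.ext (i.2.trans j.2.symm)) hij
  obtain ⟨b, hb⟩ := hv.exists_orthonormalBasis_extension_of_card_eq (by simp)
  exact ⟨b, hb 0 rfl⟩

/-- Orthogonal coordinates adapted to a unit vector. -/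
theorem exists_adapted_coordinates {m : ℕ} (u : E (m + 1)) (hu : ‖u‖ = 1) :
    ∃ ι : E m →ₗᵢ[ℝ] E (m + 1), (∀ y, ⟪u, ι y⟫ = 0) ∧ (∀ z, ⟪u, z⟫ = 0 → ∃ y, ι y = z) ∧
      MeasurePreserving (fun p : ℝ × E m => p.1 • u + ι p.2) (volume.prod volume) volume := by
  obtain ⟨b, rfl⟩ := exists_orthonormalBasis_zero_eq u hu
  -- The map is a composition of volume-preserving maps: splitting off the coordinate `0`, passing
  -- to the `L²` norm, and changing to the basis `b`.
  let e : ℝ × E m → E (m + 1) := fun p =>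
    b.repr.symm (WithLp.toLp 2 ((MeasurableEquiv.piFinSuccAbove (fun _ => ℝ) 0).symm
      (p.1, WithLp.ofLp p.2)))
  have he : ∀ p, e p = p.1 • b 0 + ∑ i, p.2 i • b i.succ := by
    intro p
    simp only [e, ← b.sum_repr_symm, Fin.sum_univ_succ]
    simp [MeasurableEquiv.piFinSuccAbove]
  have hmp : MeasurePreserving e (volume.prod volume) volume := by
    refine (b.measurePreserving_repr_symm).comp ?_
    refine (PiLp.volume_preserving_toLp (Fin (m + 1))).comp ?_
    refine (volume_preserving_piFinSuccAbove (fun _ => ℝ) 0).symm.comp ?_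
    exact (MeasurePreserving.id volume).prod (PiLp.volume_preserving_ofLp (Fin m))
  have hlin : ∀ y : E m, ‖∑ i, y i • b i.succ‖ = ‖y‖ := by
    intro y
    have h1 : ‖e (0, y)‖ = ‖y‖ := by
      simp only [e, LinearIsometryEquiv.norm_map]
      rw [EuclideanSpace.norm_eq, EuclideanSpace.norm_eq, Fin.sum_univ_succ]
      simp [MeasurableEquiv.piFinSuccAbove]
    simpa [he] using h1
  let ι : E m →ₗᵢ[ℝ] E (m + 1) :=
    { toFun := fun y => ∑ i, y i • b i.succ
      map_add' := by intro x y; simp [add_smul, Finset.sum_add_distrib]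
      map_smul' := by intro c x; simp [mul_smul, Finset.smul_sum]
      norm_map' := hlin }
  have hι : ∀ y, ι y = ∑ i, y i • b i.succ := fun _ => rfl
  refine ⟨ι, fun y => ?_, fun z hz => ?_, ?_⟩
  · simp only [hι, inner_sum, inner_smul_right]
    exact Finset.sum_eq_zero fun i _ => by
      rw [b.inner_eq_zero (Fin.succ_ne_zero i).symm, mul_zero]
  · refine ⟨WithLp.toLp 2 fun i => ⟪b i.succ, z⟫, ?_⟩
    conv_rhs => rw [← b.sum_repr' z, Fin.sum_univ_succ, hz, zero_smul, zero_add]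
    rfl
  · convert hmp using 2 with p
    rw [he, hι]

theorem face_subset_range {m : ℕ} {u : E (m + 1)} {ι : E m →ₗᵢ[ℝ] E (m + 1)}
    (hι : ∀ z, ⟪u, z⟫ = 0 → ∃ y, ι y = z) {p z : E (m + 1)} (hz : ⟪u, z⟫ = ⟪u, p⟫) :
    ∃ y, p + ι y = z := by
  obtain ⟨y, hy⟩ := hι (z - p) (by rw [inner_sub_right, hz, sub_self])
  exact ⟨y, by rw [hy]; abel⟩

theorem isometry_add_linearIsometry {m : ℕ} (ι : E m →ₗᵢ[ℝ] E (m + 1)) (p : E (m + 1)) :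
    Isometry fun y => p + ι y :=
  (IsometryEquiv.addLeft p).isometry.comp ι.isometry

/-- An isometry carries Hausdorff measure to Hausdorff measure restricted to its range, and the
normalised `m`-dimensional one on `E m` is Lebesgue measure. Face integrals thereby become Lebesgue
integrals in the coordinates of the hyperplane. -/
theorem setIntegral_hausdorff_eq {m : ℕ} (ι : E m →ₗᵢ[ℝ] E (m + 1)) (p : E (m + 1))
    {S : Set (E (m + 1))} (hS : S ⊆ Set.range fun y => p + ι y) (hSm : MeasurableSet S)
    (f : E (m + 1) → ℝ) :
    ∫ x in S, f x ∂(Measure.euclideanHausdorffMeasure m : Measure (E (m + 1))) =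
      ∫ y in (fun y => p + ι y) ⁻¹' S, f (p + ι y) := by
  have hiso := isometry_add_linearIsometry ι p
  have hemb : MeasurableEmbedding fun y => p + ι y := hiso.isClosedEmbedding.measurableEmbedding
  rw [← EuclideanSpace.euclideanHausdorffMeasure_eq_volume m]
  rw [← hemb.setIntegral_map, hiso.map_euclideanHausdorffMeasure, Measure.restrict_restrict hSm,
    Set.inter_eq_left.2 hS]

theorem hausdorff_real_eq {m : ℕ} (ι : E m →ₗᵢ[ℝ] E (m + 1)) (p : E (m + 1))
    {S : Set (E (m + 1))} (hS : S ⊆ Set.range fun y => p + ι y) :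
    (Measure.euclideanHausdorffMeasure m : Measure (E (m + 1))).real S =
      (volume : Measure (E m)).real ((fun y => p + ι y) ⁻¹' S) := by
  have hiso := isometry_add_linearIsometry ι p
  rw [← EuclideanSpace.euclideanHausdorffMeasure_eq_volume m, Measure.real, Measure.real,
    hiso.euclideanHausdorffMeasure_preimage, Set.inter_eq_left.2 hS]

/-! ### Balls inside convex bodies of large volume -/

/-- The volume of the part of a bounded set that lies in a slab. -/
theorem volume_slab_le {m : ℕ} (u : E (m + 1)) (hu : ‖u‖ = 1) {K : Set (E (m + 1))}
    {x₀ : E (m + 1)} {h a b : ℝ} (h0 : 0 ≤ h) (hab : a ≤ b) (hK : K ⊆ Metric.closedBall x₀ h) :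
    (volume : Measure (E (m + 1))).real (K ∩ {x | a ≤ ⟪u, x⟫ ∧ ⟪u, x⟫ ≤ b}) ≤
      (b - a) * ((volume : Measure (E m)).real (Metric.ball 0 1) * h ^ m) := by
  obtain ⟨ι, hι0, hιs, hmp⟩ := exists_adapted_coordinates u hu
  obtain ⟨y₀, hy₀⟩ := hιs (x₀ - ⟪u, x₀⟫ • u) (by
    rw [inner_sub_right, inner_smul_right, real_inner_self_eq_norm_sq, hu]; ring)
  have hmeas : MeasurableSet (Metric.closedBall x₀ h ∩ {x | a ≤ ⟪u, x⟫ ∧ ⟪u, x⟫ ≤ b}) := by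
    refine Metric.isClosed_closedBall.measurableSet.inter ?_
    have h1 : IsClosed {x : E (m + 1) | a ≤ ⟪u, x⟫ ∧ ⟪u, x⟫ ≤ b} :=
      (isClosed_le (f := fun _ => a) (g := fun x : E (m + 1) => ⟪u, x⟫) (by fun_prop)
        (by fun_prop)).inter (isClosed_le (f := fun x : E (m + 1) => ⟪u, x⟫) (g := fun _ => b)
        (by fun_prop) (by fun_prop))
    exact h1.measurableSet
  have hsub : (fun p : ℝ × E m => p.1 • u + ι p.2) ⁻¹'
      (Metric.closedBall x₀ h ∩ {x | a ≤ ⟪u, x⟫ ∧ ⟪u, x⟫ ≤ b}) ⊆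
        Set.Icc a b ×ˢ Metric.closedBall y₀ h := by
    rintro ⟨s, y⟩ ⟨h1, h2⟩
    have hs : ⟪u, s • u + ι y⟫ = s := by
      rw [inner_add_right, hι0, inner_smul_right, real_inner_self_eq_norm_sq, hu]; ring
    simp only [Set.mem_ofPred_eq] at h2
    rw [hs] at h2
    refine ⟨h2, ?_⟩
    rw [Metric.mem_closedBall, dist_eq_norm] at h1 ⊢
    have hx : s • u + ι y - x₀ = (s - ⟪u, x₀⟫) • u + ι (y - y₀) := by
      rw [map_sub, hy₀, sub_smul]; abel
    have hn : ‖s • u + ι y - x₀‖ ^ 2 = (s - ⟪u, x₀⟫) ^ 2 + ‖y - y₀‖ ^ 2 := by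
      rw [hx, norm_add_sq_real, inner_smul_left, hι0, norm_smul, hu, ι.norm_map]
      simp
    have : ‖y - y₀‖ ^ 2 ≤ h ^ 2 := by
      nlinarith [sq_nonneg (s - ⟪u, x₀⟫), norm_nonneg (s • u + ι y - x₀)]
    exact le_of_sq_le_sq this h0
  have hvol : (volume.prod volume : Measure (ℝ × E m)) (Set.Icc a b ×ˢ Metric.closedBall y₀ h) =
      ENNReal.ofReal ((b - a) * ((volume : Measure (E m)).real (Metric.ball 0 1) * h ^ m)) := by
    rw [Measure.prod_prod, Real.volume_Icc, Measure.addHaar_closedBall _ _ h0,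
      ENNReal.ofReal_mul (sub_nonneg.2 hab), mul_comm ((volume : Measure (E m)).real _),
      ENNReal.ofReal_mul (by positivity), Measure.real,
      ENNReal.ofReal_toReal measure_ball_lt_top.ne]
    simp
  have h3 : (volume : Measure (E (m + 1))) (K ∩ {x | a ≤ ⟪u, x⟫ ∧ ⟪u, x⟫ ≤ b}) ≤
      ENNReal.ofReal ((b - a) * ((volume : Measure (E m)).real (Metric.ball 0 1) * h ^ m)) :=
    calc _ ≤ (volume : Measure (E (m + 1)))
          (Metric.closedBall x₀ h ∩ {x | a ≤ ⟪u, x⟫ ∧ ⟪u, x⟫ ≤ b}) :=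
            measure_mono (Set.inter_subset_inter_left _ hK)
      _ = _ := (hmp.measure_preimage hmeas.nullMeasurableSet).symm
      _ ≤ _ := measure_mono hsub
      _ = _ := hvol
  exact ENNReal.toReal_le_of_le_ofReal
    (mul_nonneg (sub_nonneg.2 hab) (by positivity)) h3

/-- A closed convex set all of whose support functions with respect to `c` are at least `r`
contains the ball of radius `r` about `c`. -/
theorem ball_subset_of_support {d : ℕ} {K : Set (E d)} (hc : Convex ℝ K) (hK : IsClosed K)
    (hne : K.Nonempty) {c : E d} {r : ℝ}
    (h : ∀ u : E d, ‖u‖ = 1 → ∀ s < r, ∃ x ∈ K, s < ⟪u, x - c⟫) :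
    Metric.ball c r ⊆ K := by
  -- A point of the ball outside `K` would be strictly separated from `K`; the normalised separating
  -- functional contradicts the lower bound on the support function in that direction.
  intro y hy
  by_contra hyK
  obtain ⟨f, t, hf, ht⟩ := geometric_hahn_banach_closed_point hc hK hyK
  set a := (InnerProductSpace.toDual ℝ (E d)).symm f with ha
  have hfa : ∀ x, f x = ⟪a, x⟫ := fun x => by
    rw [ha, InnerProductSpace.toDual_symm_apply]
  rw [mem_ball_iff_norm] at hy
  have ha0 : a ≠ 0 := by
    rintro h0
    obtain ⟨x, hx⟩ := hne
    have h1 := hf x hx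
    rw [hfa, h0, inner_zero_left] at h1 ht
    linarith
  have hna : 0 < ‖a‖ := norm_pos_iff.2 ha0
  obtain ⟨x, hx, hs⟩ := h ((‖a‖)⁻¹ • a) (norm_smul_inv_norm (𝕜 := ℝ) ha0) _ hy
  have h1 := (hf x hx).trans ht
  rw [hfa, hfa] at h1
  have h2 : ⟪(‖a‖)⁻¹ • a, x - c⟫ < ⟪(‖a‖)⁻¹ • a, y - c⟫ := by
    rw [real_inner_smul_left, real_inner_smul_left, inner_sub_right, inner_sub_right]
    gcongr
  have h3 : ⟪(‖a‖)⁻¹ • a, y - c⟫ ≤ ‖y - c‖ := by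
    refine (real_inner_le_norm _ _).trans ?_
    rw [norm_smul, norm_inv, norm_norm, inv_mul_cancel₀ hna.ne', one_mul]
  linarith

/-- A convex body with diameter at most `h` and volume at least `ρ h ^ d` contains a ball of radius
proportional to `h`. -/
theorem exists_ball_subset {m : ℕ} {K : Set (E (m + 1))} (hc : Convex ℝ K) (hK : IsCompact K)
    {ρ h : ℝ} (hρ : 0 < ρ) (hh : 0 < h) (hd : ∀ x ∈ K, ∀ y ∈ K, dist x y ≤ h)
    (hv : ρ * h ^ (m + 1) ≤ (volume : Measure (E (m + 1))).real K) :
    ∃ c, Metric.ball c (ρ / (6 * (volume : Measure (E m)).real (Metric.ball 0 1)) * h) ⊆ K := by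
  set ω := (volume : Measure (E m)).real (Metric.ball 0 1) with hω
  have hω0 : 0 < ω := ENNReal.toReal_pos (Metric.measure_ball_pos _ _ one_pos).ne'
    measure_ball_lt_top.ne
  have hV : 0 < (volume : Measure (E (m + 1))).real K := lt_of_lt_of_le (by positivity) hv
  set V := (volume : Measure (E (m + 1))).real K with hVd
  have hKfin : volume K ≠ ⊤ := hK.measure_lt_top.ne
  have hne : K.Nonempty := by
    by_contra hne
    rw [Set.not_nonempty_iff_eq_empty] at hne
    simp [hVd, hne] at hV
  obtain ⟨x₀, hx₀⟩ := hne
  have hKm : MeasurableSet K := hK.isClosed.measurableSet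
  have hint : ∀ u c : E (m + 1), IntegrableOn (fun x => ⟪u, x - c⟫) K volume := fun u c =>
    ContinuousOn.integrableOn_compact hK (by fun_prop)
  have hintid : IntegrableOn (fun x : E (m + 1) => x) K volume :=
    ContinuousOn.integrableOn_compact hK (by fun_prop)
  -- The ball is centred at the centroid, where every linear functional has mean zero.
  set c : E (m + 1) := V⁻¹ • ∫ x in K, x with hcdef
  have hcen : ∀ u : E (m + 1), ∫ x in K, ⟪u, x - c⟫ = 0 := by
    intro u
    have h1 : ∫ x in K, (x - c) = 0 := by
      rw [integral_sub hintid (integrableOn_const hKfin), setIntegral_const, hcdef, smul_smul,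
        mul_inv_cancel₀ hV.ne', one_smul, sub_self]
    have h2 := integral_inner (𝕜 := ℝ) (hintid.sub (integrableOn_const (C := c) hKfin)) u
    simp only [Pi.sub_apply] at h2
    rw [h2, h1, inner_zero_right]
  set r := ρ / (6 * ω) * h with hr
  have hr0 : 0 < r := by positivity
  refine ⟨c, ball_subset_of_support hc hK.isClosed ⟨x₀, hx₀⟩ fun u hu s hs => ?_⟩
  by_contra hno
  push Not at hno
  -- If `K` reached less than `r` beyond the centroid in direction `u`, then `⟪u, x - c⟫` would be
  -- at most `r` on this slab and below `-2r` on the rest of `K`. The slab has width `3r`, and `r`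
  -- is chosen so that it holds at most half of the volume; the mean would then be negative.
  set S : Set (E (m + 1)) := {x | ⟪u, c⟫ - 2 * r ≤ ⟪u, x⟫ ∧ ⟪u, x⟫ ≤ ⟪u, c⟫ + r} with hS
  have hSm : MeasurableSet S := by
    have h1 : IsClosed S :=
      (isClosed_le (f := fun _ => ⟪u, c⟫ - 2 * r) (g := fun x : E (m + 1) => ⟪u, x⟫) (by fun_prop)
        (by fun_prop)).inter (isClosed_le (f := fun x : E (m + 1) => ⟪u, x⟫)
        (g := fun _ => ⟪u, c⟫ + r) (by fun_prop) (by fun_prop))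
    exact h1.measurableSet
  have hslab : (volume : Measure (E (m + 1))).real (K ∩ S) ≤ V / 2 := by
    refine (volume_slab_le u hu hh.le (by linarith : ⟪u, c⟫ - 2 * r ≤ ⟪u, c⟫ + r)
      (x₀ := x₀) fun x hx => hd x hx x₀ hx₀).trans ?_
    have : (⟪u, c⟫ + r - (⟪u, c⟫ - 2 * r)) * (ω * h ^ m) = ρ * h ^ (m + 1) / 2 := by
      rw [hr]; field_simp; ring
    rw [this]; linarith
  have hpt : ∀ x ∈ K, ⟪u, x - c⟫ ≤ r * (3 * S.indicator (fun _ => (1 : ℝ)) x - 2) := by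
    intro x hx
    have h1 := hno x hx
    by_cases hxS : x ∈ S
    · rw [Set.indicator_of_mem hxS]; linarith
    · rw [Set.indicator_of_notMem hxS]
      rw [inner_sub_right] at h1 ⊢
      have : ⟪u, x⟫ < ⟪u, c⟫ - 2 * r := by
        by_contra h3
        exact hxS ⟨not_lt.1 h3, by linarith⟩
      linarith
  have hindint : IntegrableOn (S.indicator fun _ => (1 : ℝ)) K volume :=
    (integrableOn_const hKfin).indicator hSm
  have hle := setIntegral_mono_on (hint u c)
    (((hindint.const_mul 3).sub (integrableOn_const (C := (2 : ℝ)) hKfin)).const_mul r) hKm hpt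
  have heval : ∫ x in K, r * (3 * S.indicator (fun _ => (1 : ℝ)) x - 2) =
      r * (3 * (volume : Measure (E (m + 1))).real (K ∩ S) - 2 * V) := by
    rw [integral_const_mul, integral_sub (hindint.const_mul 3) (integrableOn_const hKfin),
      integral_const_mul, setIntegral_indicator hSm, setIntegral_const, setIntegral_const]
    simp only [smul_eq_mul, mul_one]
    ring
  have hle' : (0 : ℝ) ≤ r * (3 * (volume : Measure (E (m + 1))).real (K ∩ S) - 2 * V) := by
    rw [← heval, ← hcen u]; exact hle
  nlinarith

/-! ### Polynomial functions and norm equivalence for bounded degree -/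

section Polynomials

variable {d : ℕ}

@[simp] theorem peval_add (p q : MvPolynomial (Fin d) ℝ) (x : E d) :
    peval (p + q) x = peval p x + peval q x := by simp [peval]

@[simp] theorem peval_sub (p q : MvPolynomial (Fin d) ℝ) (x : E d) :
    peval (p - q) x = peval p x - peval q x := by simp [peval]

@[simp] theorem peval_mul (p q : MvPolynomial (Fin d) ℝ) (x : E d) :
    peval (p * q) x = peval p x * peval q x := by simp [peval]

@[simp] theorem peval_C (a : ℝ) (x : E d) : peval (MvPolynomial.C a) x = a := by simp [peval]

@[simp] theorem peval_X (i : Fin d) (x : E d) : peval (MvPolynomial.X i) x = x i := by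
  simp [peval]

@[simp] theorem peval_zero (x : E d) : peval (0 : MvPolynomial (Fin d) ℝ) x = 0 := by
  simp [peval]

@[simp] theorem peval_smul (a : ℝ) (p : MvPolynomial (Fin d) ℝ) (x : E d) :
    peval (a • p) x = a * peval p x := by simp [peval]

theorem peval_sum {ι : Type*} (s : Finset ι) (p : ι → MvPolynomial (Fin d) ℝ) (x : E d) :
    peval (∑ i ∈ s, p i) x = ∑ i ∈ s, peval (p i) x := by simp [peval]

theorem peval_prod {ι : Type*} (s : Finset ι) (p : ι → MvPolynomial (Fin d) ℝ) (x : E d) :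
    peval (∏ i ∈ s, p i) x = ∏ i ∈ s, peval (p i) x := by simp [peval]

/-- The derivative of a polynomial function. -/
theorem hasFDerivAt_peval (p : MvPolynomial (Fin d) ℝ) (x : E d) :
    HasFDerivAt (peval p) (∑ l, peval (MvPolynomial.pderiv l p) x •
      (EuclideanSpace.proj l : E d →L[ℝ] ℝ)) x := by
  induction p using MvPolynomial.induction_on with
  | C a =>
    have : peval (MvPolynomial.C a : MvPolynomial (Fin d) ℝ) = fun _ => a := by ext; simp
    rw [this]
    simpa using hasFDerivAt_const a x
  | add p q hp hq =>
    have : peval (p + q) = fun x => peval p x + peval q x := by ext; simp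
    rw [this]
    refine (hp.add hq).congr_fderiv ?_
    simp only [map_add, peval_add, add_smul, Finset.sum_add_distrib]
  | mul_X p i hp =>
    have : peval (p * MvPolynomial.X i) = fun x => peval p x * x i := by ext; simp
    rw [this]
    have hX : HasFDerivAt (fun x : E d => x i) (EuclideanSpace.proj i : E d →L[ℝ] ℝ) x :=
      (EuclideanSpace.proj i : E d →L[ℝ] ℝ).hasFDerivAt
    refine (hp.mul hX).congr_fderiv ?_
    ext v
    have h1 : ∀ l, peval (MvPolynomial.pderiv l (p * MvPolynomial.X i)) x * v l =
        peval (MvPolynomial.pderiv l p) x * x i * v l + peval p x * (if l = i then v l else 0) := by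
      intro l
      rw [MvPolynomial.pderiv_mul, MvPolynomial.pderiv_X]
      by_cases h : l = i
      · subst h; simp [add_mul, peval]
      · simp [h, Ne.symm h]
    have h2 : ∀ q : Fin d → ℝ, (∑ l, q l • (EuclideanSpace.proj l : E d →L[ℝ] ℝ)) v =
        ∑ l, q l * v l := fun q => by simp
    rw [h2, Finset.sum_congr rfl fun l _ => h1 l, Finset.sum_add_distrib, add_apply,
      smul_apply, smul_apply, h2, ← Finset.mul_sum]
    simp only [Finset.sum_ite_eq', Finset.mem_univ, if_true, smul_eq_mul, Finset.mul_sum]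
    rw [add_comm]
    congr 1
    exact Finset.sum_congr rfl fun j _ => by ring

theorem contDiff_peval (p : MvPolynomial (Fin d) ℝ) {n : WithTop ℕ∞} : ContDiff ℝ n (peval p) := by
  induction p using MvPolynomial.induction_on with
  | C a =>
    have : peval (MvPolynomial.C a : MvPolynomial (Fin d) ℝ) = fun _ => a := by ext; simp
    rw [this]; exact contDiff_const
  | add p q hp hq =>
    have : peval (p + q) = fun x => peval p x + peval q x := by ext; simp
    rw [this]; exact hp.add hq
  | mul_X p i hp =>
    have : peval (p * MvPolynomial.X i) = fun x => peval p x * x i := by ext; simp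
    rw [this]
    exact hp.mul (EuclideanSpace.proj i : E d →L[ℝ] ℝ).contDiff

@[fun_prop]
theorem continuous_peval (p : MvPolynomial (Fin d) ℝ) : Continuous (peval p) :=
  (contDiff_peval p (n := 0)).continuous

/-- The drop by one matters: it leaves room for an additional affine factor next to the normal
derivative in the test fields. -/
theorem totalDegree_pderiv_le (i : Fin d) (p : MvPolynomial (Fin d) ℝ) :
    (MvPolynomial.pderiv i p).totalDegree ≤ p.totalDegree - 1 := by
  conv_lhs => rw [p.as_sum, map_sum]
  refine MvPolynomial.totalDegree_finsetSum_le fun s hs => ?_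
  rw [MvPolynomial.pderiv_monomial]
  by_cases hsi : s i = 0
  · simp [hsi]
  refine (MvPolynomial.totalDegree_monomial_le _ _).trans ?_
  have h1 := MvPolynomial.le_totalDegree hs
  have h2 : s = (s - Finsupp.single i 1) + Finsupp.single i 1 := by
    ext j
    by_cases h : i = j
    · subst h; simp; omega
    · simp [h]
  have h3 : (s.sum fun _ e => e) = ((s - Finsupp.single i 1).sum fun _ e => e) + 1 := by
    conv_lhs => rw [h2]
    rw [Finsupp.sum_add_index' (by simp) (by simp)]
    simp
  simp only [id, Finsupp.sum] at *
  omega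

theorem totalDegree_finsetProd_le_card {ι : Type*} (s : Finset ι)
    (p : ι → MvPolynomial (Fin d) ℝ) (h : ∀ i ∈ s, (p i).totalDegree ≤ 1) :
    (∏ i ∈ s, p i).totalDegree ≤ s.card := by
  refine (MvPolynomial.totalDegree_finsetProd s p).trans ?_
  simpa using Finset.sum_le_card_nsmul s _ 1 h

/-- The affine function `a - ⟪n, x⟫` as a polynomial. -/
noncomputable def affinePoly (a : ℝ) (n : E d) : MvPolynomial (Fin d) ℝ :=
  MvPolynomial.C a - ∑ i, MvPolynomial.C (n i) * MvPolynomial.X i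

@[simp] theorem peval_affinePoly (a : ℝ) (n x : E d) : peval (affinePoly a n) x = a - ⟪n, x⟫ := by
  simp [affinePoly, peval_sum, PiLp.inner_apply, mul_comm]

theorem totalDegree_affinePoly (a : ℝ) (n : E d) : (affinePoly a n).totalDegree ≤ 1 := by
  refine (MvPolynomial.totalDegree_sub _ _).trans (max_le (by simp) ?_)
  refine MvPolynomial.totalDegree_finsetSum_le fun i _ => ?_
  refine (MvPolynomial.totalDegree_mul _ _).trans ?_
  simp

/-- The restriction of a polynomial along an affine map is a polynomial of no larger degree. -/
theorem exists_peval_comp_affine {e : ℕ} (c : E e) (L : E d →ₗ[ℝ] E e)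
    (p : MvPolynomial (Fin e) ℝ) :
    ∃ q : MvPolynomial (Fin d) ℝ, q.totalDegree ≤ p.totalDegree ∧
      ∀ y, peval q y = peval p (c + L y) := by
  let f : Fin e → MvPolynomial (Fin d) ℝ := fun i =>
    affinePoly (c i) (-(WithLp.toLp 2 fun j => L (EuclideanSpace.single j 1) i))
  have hf : ∀ i y, peval (f i) y = (c + L y) i := by
    intro i y
    have hy : y = ∑ j, y j • EuclideanSpace.single j (1 : ℝ) := by
      ext k; simp [Finset.sum_apply, Pi.single_apply]
    simp only [f, peval_affinePoly, inner_neg_left, sub_neg_eq_add, PiLp.add_apply]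
    congr 1
    conv_rhs => rw [hy, map_sum]
    simp [PiLp.inner_apply]
  -- The variables are replaced by the affine coordinate polynomials `f i`, each of degree at most
  -- one.
  refine ⟨MvPolynomial.bind₁ f p, ?_, fun y => ?_⟩
  · rw [MvPolynomial.bind₁, MvPolynomial.aeval_def, MvPolynomial.eval₂_eq']
    refine MvPolynomial.totalDegree_finsetSum_le fun s hs => ?_
    refine (MvPolynomial.totalDegree_mul _ _).trans ?_
    have h1 : (algebraMap ℝ (MvPolynomial (Fin d) ℝ) (MvPolynomial.coeff s p)).totalDegree = 0 :=
      MvPolynomial.totalDegree_C _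
    rw [h1, zero_add]
    refine (MvPolynomial.totalDegree_finsetProd _ _).trans ?_
    refine le_trans ?_ (MvPolynomial.le_totalDegree hs)
    rw [Finsupp.sum_fintype _ _ (by simp)]
    refine Finset.sum_le_sum fun i _ => ?_
    refine (MvPolynomial.totalDegree_pow _ _).trans ?_
    simpa using Nat.mul_le_mul_left (s i) (totalDegree_affinePoly _ _)
  · have h : (fun i => MvPolynomial.eval (fun j => y j) (f i)) = fun i => (c + L y) i :=
      funext fun i => hf i y
    simp only [peval]
    rw [← h, MvPolynomial.eval, MvPolynomial.eval₂Hom_bind₁]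
    rfl

/-- A ball contains a product of intervals, and a polynomial vanishing on a product of infinite sets
is zero. -/
theorem eq_zero_of_peval_eq_zero_on_ball (p : MvPolynomial (Fin d) ℝ) (c : E d) {r : ℝ}
    (hr : 0 < r) (h : ∀ x ∈ Metric.ball c r, peval p x = 0) : p = 0 := by
  have hopen : IsOpen ((MeasurableEquiv.toLp 2 (Fin d → ℝ)) ⁻¹' Metric.ball c r) :=
    Metric.isOpen_ball.preimage (PiLp.continuous_toLp 2 _)
  obtain ⟨δ, hδ, hsub⟩ := Metric.isOpen_iff.1 hopen (WithLp.ofLp c) (by simpa using hr)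
  refine MvPolynomial.funext_set (fun i => Metric.ball (c i) δ) (fun i => ?_) fun x hx => ?_
  · rw [Real.ball_eq_Ioo]; exact Set.Ioo_infinite (by linarith)
  · have hx' : x ∈ Metric.ball (WithLp.ofLp c) δ := by
      rw [Metric.mem_ball, dist_pi_lt_iff hδ]
      exact fun i => hx i (Set.mem_univ i)
    simpa [peval] using h _ (hsub hx')

/-- The `L²` inner product over `S` on polynomials of degree at most `N`. -/
noncomputable def l2Form (S : Set (E d)) (hS : IsCompact S) (N : ℕ) :
    LinearMap.BilinForm ℝ (MvPolynomial.restrictTotalDegree (Fin d) ℝ N) :=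
  LinearMap.mk₂ ℝ (fun p q => ∫ x in S, peval p.1 x * peval q.1 x)
    (fun p p' q => by
      rw [← integral_add]
      · simp [add_mul]
      all_goals exact ContinuousOn.integrableOn_compact hS (by fun_prop))
    (fun a p q => by simp [mul_assoc, integral_const_mul])
    (fun p q q' => by
      rw [← integral_add]
      · simp [mul_add]
      all_goals exact ContinuousOn.integrableOn_compact hS (by fun_prop))
    (fun a p q => by simp [mul_left_comm, integral_const_mul])

theorem l2Form_apply (S : Set (E d)) (hS : IsCompact S) (N : ℕ)
    (p q : MvPolynomial.restrictTotalDegree (Fin d) ℝ N) :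
    l2Form S hS N p q = ∫ x in S, peval p.1 x * peval q.1 x := rfl

theorem eq_zero_of_integral_sq_le_zero {S : Set (E d)} (hS : IsCompact S) {c : E d} {r : ℝ}
    (hr : 0 < r) (hc : Metric.ball c r ⊆ S) (p : MvPolynomial (Fin d) ℝ)
    (h : ∫ x in S, peval p x * peval p x ≤ 0) : p = 0 := by
  have hint : IntegrableOn (fun x => peval p x * peval p x) S volume :=
    ContinuousOn.integrableOn_compact hS (by fun_prop)
  have h0 : ∫ x in S, peval p x * peval p x = 0 :=
    le_antisymm h (integral_nonneg fun x => mul_self_nonneg _)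
  rw [setIntegral_eq_zero_iff_of_nonneg_ae (Filter.Eventually.of_forall fun x =>
    mul_self_nonneg _) hint] at h0
  have h1 : (fun x => peval p x * peval p x) =ᵐ[volume.restrict (Metric.ball c r)] 0 :=
    ae_restrict_of_ae_restrict_of_subset hc h0
  have h2 := Measure.eqOn_open_of_ae_eq h1 Metric.isOpen_ball (by fun_prop) (by fun_prop)
  exact eq_zero_of_peval_eq_zero_on_ball p c hr fun x hx => mul_self_eq_zero.1 (h2 hx)

theorem l2Form_self_nonneg {S : Set (E d)} (hS : IsCompact S) (N : ℕ)
    (p : MvPolynomial.restrictTotalDegree (Fin d) ℝ N) : 0 ≤ l2Form S hS N p p :=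
  integral_nonneg fun _ => mul_self_nonneg _

theorem l2Form_injective {S : Set (E d)} (hS : IsCompact S) {c : E d} {r : ℝ} (hr : 0 < r)
    (hc : Metric.ball c r ⊆ S) (N : ℕ) : Function.Injective (l2Form S hS N) := by
  rw [injective_iff_map_eq_zero]
  intro p hp
  refine Subtype.ext (eq_zero_of_integral_sq_le_zero hS hr hc p.1 ?_)
  rw [← l2Form_apply S hS N, hp]; simp

/-- Riesz representation in the space of polynomials of degree at most `N`. -/
theorem exists_l2Form_eq {S : Set (E d)} (hS : IsCompact S) {c : E d} {r : ℝ} (hr : 0 < r)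
    (hc : Metric.ball c r ⊆ S) (N : ℕ)
    (f : MvPolynomial.restrictTotalDegree (Fin d) ℝ N →ₗ[ℝ] ℝ) :
    ∃ a, ∀ q, l2Form S hS N a q = f q := by
  have hsurj : Function.Surjective (l2Form S hS N) :=
    (LinearMap.injective_iff_surjective_of_finrank_eq_finrank
      (Subspace.dual_finrank_eq (K := ℝ)).symm).1 (l2Form_injective hS hr hc N)
  obtain ⟨a, ha⟩ := hsurj f
  exact ⟨a, fun q => by rw [ha]⟩

/-- Riesz representation of `f` by some `a`, then Cauchy-Schwarz; the constant is the squared norm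
of `a`. -/
theorem exists_sq_le_l2Form {S : Set (E d)} (hS : IsCompact S) {c : E d} {r : ℝ} (hr : 0 < r)
    (hc : Metric.ball c r ⊆ S) (N : ℕ)
    (f : MvPolynomial.restrictTotalDegree (Fin d) ℝ N →ₗ[ℝ] ℝ) :
    ∃ C, 0 ≤ C ∧ ∀ q, f q ^ 2 ≤ C * l2Form S hS N q q := by
  obtain ⟨a, ha⟩ := exists_l2Form_eq hS hr hc N f
  refine ⟨l2Form S hS N a a, l2Form_self_nonneg hS N a, fun q => ?_⟩
  rw [← ha q]
  refine LinearMap.BilinForm.apply_sq_le_of_symm _ (l2Form_self_nonneg hS N) ⟨fun x y => ?_⟩ a q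
  simp only [l2Form_apply, mul_comm, RingHom.id_apply]

/-- In a fixed finite basis of the polynomials of degree at most `N`, the coordinates are bounded by
the `L²` norm on the small ball and the basis elements are bounded on the unit ball. -/
theorem exists_sup_le_integral_unit (d N : ℕ) {r : ℝ} (hr : 0 < r) :
    ∃ C, 0 < C ∧ ∀ p : MvPolynomial (Fin d) ℝ, p.totalDegree ≤ N →
      ∀ x ∈ Metric.closedBall (0 : E d) 1,
        peval p x ^ 2 ≤ C * ∫ y in Metric.closedBall (0 : E d) r, peval p y ^ 2 := by
  have hS : IsCompact (Metric.closedBall (0 : E d) r) := isCompact_closedBall _ _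
  let V := MvPolynomial.restrictTotalDegree (Fin d) ℝ N
  let b := Module.finBasis ℝ V
  have h1 : ∀ i, ∃ C, 0 ≤ C ∧ ∀ q : V, (b.coord i q) ^ 2 ≤ C * l2Form _ hS N q q := fun i =>
    exists_sq_le_l2Form hS hr Metric.ball_subset_closedBall N (b.coord i)
  choose C hC0 hC using h1
  have h2 : ∀ i, ∃ M, ∀ x ∈ Metric.closedBall (0 : E d) 1, ‖peval (b i).1 x‖ ≤ M := fun i =>
    (isCompact_closedBall (0 : E d) 1).exists_bound_of_continuousOn
      (continuous_peval _).continuousOn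
  choose M hM using h2
  have hCM : 0 ≤ (∑ i, C i) * (∑ i, M i ^ 2) :=
    mul_nonneg (Finset.sum_nonneg fun i _ => hC0 i) (Finset.sum_nonneg fun i _ => sq_nonneg _)
  -- The summand `1` only makes the constant strictly positive.
  refine ⟨(∑ i, C i) * (∑ i, M i ^ 2) + 1, by linarith, fun p hp x hx => ?_⟩
  let q : V := ⟨p, (MvPolynomial.mem_restrictTotalDegree _ _ _).2 hp⟩
  have hI : l2Form _ hS N q q = ∫ y in Metric.closedBall (0 : E d) r, peval p y ^ 2 := by
    simp only [l2Form_apply, q, sq]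
  have hI0 := l2Form_self_nonneg hS N q
  have hexp : peval p x = ∑ i, b.coord i q * peval (b i).1 x := by
    have h3 : p = ∑ i, b.coord i q • (b i).1 := by
      have h4 := congrArg Subtype.val (b.sum_repr q)
      rw [AddSubmonoidClass.coe_finsetSum] at h4
      exact h4.symm
    conv_lhs => rw [h3]
    rw [peval_sum]
    exact Finset.sum_congr rfl fun i _ => peval_smul _ _ _
  calc peval p x ^ 2 ≤ (∑ i, b.coord i q ^ 2) * ∑ i, peval (b i).1 x ^ 2 := by
        rw [hexp]; exact Finset.sum_mul_sq_le_sq_mul_sq _ _ _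
    _ ≤ (∑ i, C i * l2Form _ hS N q q) * ∑ i, M i ^ 2 := by
        refine mul_le_mul (Finset.sum_le_sum fun i _ => hC i q) (Finset.sum_le_sum fun i _ => ?_)
          (Finset.sum_nonneg fun i _ => sq_nonneg _)
          (Finset.sum_nonneg fun i _ => mul_nonneg (hC0 i) hI0)
        have := hM i x hx
        rw [Real.norm_eq_abs] at this
        exact sq_le_sq' (by linarith [neg_abs_le (peval (b i).1 x)]) ((le_abs_self _).trans this)
    _ ≤ _ := by
        rw [← hI, ← Finset.sum_mul]
        nlinarith

/-- Scaled norm equivalence on polynomials of bounded degree. -/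
theorem exists_sup_le_integral (d N : ℕ) {r : ℝ} (hr : 0 < r) :
    ∃ C, 0 < C ∧ ∀ p : MvPolynomial (Fin d) ℝ, p.totalDegree ≤ N → ∀ (c : E d) (h : ℝ), 0 < h →
      ∀ x ∈ Metric.closedBall c h,
        h ^ d * peval p x ^ 2 ≤ C * ∫ y in Metric.closedBall c (r * h), peval p y ^ 2 := by
  obtain ⟨C, hC, H⟩ := exists_sup_le_integral_unit d N hr
  refine ⟨C, hC, fun p hp c h hh x hx => ?_⟩
  -- Pull back to the unit ball by `y ↦ c + h y`; the Jacobian of this map is the factor `h ^ d`.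
  obtain ⟨q, hq, hqe⟩ := exists_peval_comp_affine c (h • (LinearMap.id : E d →ₗ[ℝ] E d)) p
  simp only [LinearMap.smul_apply, LinearMap.id_apply] at hqe
  have h1 := H q (hq.trans hp) (h⁻¹ • (x - c)) (by
    rw [mem_closedBall_zero_iff, norm_smul, norm_inv, Real.norm_of_nonneg hh.le]
    rw [mem_closedBall_iff_norm] at hx
    rw [inv_mul_le_iff₀ hh]; linarith)
  rw [hqe, smul_smul, mul_inv_cancel₀ hh.ne', one_smul, add_sub_cancel] at h1
  have h2 : ∫ y in Metric.closedBall (0 : E d) r, peval q y ^ 2 =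
      (h ^ d)⁻¹ * ∫ y in Metric.closedBall c (r * h), peval p y ^ 2 := by
    have h3 := Measure.setIntegral_comp_smul_of_pos (μ := (volume : Measure (E d)))
      (fun y => peval p (c + y) ^ 2) (Metric.closedBall (0 : E d) r) hh
    simp only [hqe]
    rw [h3, smul_closedBall _ _ hr.le, smul_zero, Real.norm_of_nonneg hh.le, finrank_euclideanSpace,
      Fintype.card_fin, smul_eq_mul, mul_comm h r]
    congr 1
    have h4 := (measurePreserving_add_left (volume : Measure (E d)) c).setIntegral_preimage_emb
      (MeasurableEquiv.addLeft c).measurableEmbedding (fun y => peval p y ^ 2)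
      (Metric.closedBall c (r * h))
    rw [← h4]
    congr 2
    ext y; simp
  rw [h2] at h1
  have := mul_le_mul_of_nonneg_left h1 (pow_pos hh d).le
  refine this.trans (le_of_eq ?_)
  field_simp

end Polynomials

open Filter Topology

/-! ### One-dimensional smooth transitions and null hyperplanes -/

section Cutoff

/-- The argument `t / ε + c` tends to `±∞` with the sign of `t`, so the transition function is
eventually constant. The shift `ε c` is needed later for points that move with `ε`. -/
theorem smoothTransition_div_eventually_eq {t c : ℝ} (ht : t ≠ 0) :
    ∀ᶠ ε in 𝓝[>] (0 : ℝ), Real.smoothTransition ((t + ε * c) / ε) = if 0 < t then 1 else 0 := by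
  have hlim : Tendsto (fun ε : ℝ => t + ε * c - ε) (𝓝[>] 0) (𝓝 t) := by
    have : Tendsto (fun ε : ℝ => t + ε * c - ε) (𝓝 0) (𝓝 (t + 0 * c - 0)) := by
      apply Continuous.tendsto; fun_prop
    simpa using this.mono_left nhdsWithin_le_nhds
  have hlim' : Tendsto (fun ε : ℝ => t + ε * c) (𝓝[>] 0) (𝓝 t) := by
    have : Tendsto (fun ε : ℝ => t + ε * c) (𝓝 0) (𝓝 (t + 0 * c)) := by
      apply Continuous.tendsto; fun_prop
    simpa using this.mono_left nhdsWithin_le_nhds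
  rcases lt_or_gt_of_ne ht with h | h
  · rw [if_neg h.not_gt]
    filter_upwards [hlim'.eventually (gt_mem_nhds h), self_mem_nhdsWithin] with ε h1 h2
    exact Real.smoothTransition.zero_of_nonpos (div_nonpos_of_nonpos_of_nonneg h1.le (le_of_lt h2))
  · rw [if_pos h]
    filter_upwards [hlim.eventually (lt_mem_nhds h), self_mem_nhdsWithin] with ε h1 h2
    have h2' : 0 < ε := h2
    exact Real.smoothTransition.one_of_one_le ((one_le_div h2').2 (by linarith))

theorem deriv_smoothTransition_eq_zero {x : ℝ} (hx : x ∉ Set.Icc (0 : ℝ) 1) :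
    deriv Real.smoothTransition x = 0 := by
  rw [Set.mem_Icc, not_and_or, not_le, not_le] at hx
  rcases hx with hx | hx
  · have : Real.smoothTransition =ᶠ[𝓝 x] fun _ => 0 := by
      filter_upwards [gt_mem_nhds hx] with y hy
      exact Real.smoothTransition.zero_of_nonpos (le_of_lt hy)
    rw [this.deriv_eq, deriv_const]
  · have : Real.smoothTransition =ᶠ[𝓝 x] fun _ => 1 := by
      filter_upwards [lt_mem_nhds hx] with y hy
      exact Real.smoothTransition.one_of_one_le (le_of_lt hy)
    rw [this.deriv_eq, deriv_const]

theorem continuous_deriv_smoothTransition : Continuous (deriv Real.smoothTransition) :=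
  (Real.smoothTransition.contDiff (n := 1)).continuous_deriv (by simp)

theorem hasDerivAt_smoothTransition (x : ℝ) :
    HasDerivAt Real.smoothTransition (deriv Real.smoothTransition x) x :=
  ((Real.smoothTransition.contDiff (n := 1)).differentiable (by simp) x).hasDerivAt

theorem hasCompactSupport_deriv_smoothTransition :
    HasCompactSupport (deriv Real.smoothTransition) :=
  HasCompactSupport.intro isCompact_Icc fun _ => deriv_smoothTransition_eq_zero

theorem integral_deriv_smoothTransition : ∫ x, deriv Real.smoothTransition x = 1 := by
  have h := integral_of_hasDerivAt_of_tendsto (m := 0) (n := 1) hasDerivAt_smoothTransition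
    (continuous_deriv_smoothTransition.integrable_of_hasCompactSupport
      hasCompactSupport_deriv_smoothTransition)
    (tendsto_const_nhds.congr' (by
      filter_upwards [eventually_le_atBot 0] with x hx
      exact (Real.smoothTransition.zero_of_nonpos hx).symm))
    (tendsto_const_nhds.congr' (by
      filter_upwards [eventually_ge_atTop 1] with x hx
      exact (Real.smoothTransition.one_of_one_le hx).symm))
  simpa using h

/-- Either the level set is empty, or it is a translate of the kernel, which is a proper subspace
because `f` is not constantly `a`. -/
theorem volume_levelSet_eq_zero {d : ℕ} (f : E d →ₗ[ℝ] ℝ) (a : ℝ) (h : ∃ y, f y ≠ a) :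
    (volume : Measure (E d)) {y | f y = a} = 0 := by
  by_cases hne : ∃ z, f z = a
  · obtain ⟨z, hz⟩ := hne
    have hker : LinearMap.ker f ≠ ⊤ := by
      intro htop
      rw [LinearMap.ker_eq_top] at htop
      obtain ⟨y, hy⟩ := h
      simp [htop] at hz hy
      exact hy hz
    have hset : {y | f y = a} = (fun y => -z + y) ⁻¹' (LinearMap.ker f : Set (E d)) := by
      ext y
      simp only [Set.mem_ofPred_eq, Set.mem_preimage, SetLike.mem_coe, LinearMap.mem_ker, map_add,
        map_neg, hz]
      constructor <;> intro h <;> linarith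
    rw [hset, measure_preimage_add]
    exact Measure.addHaar_submodule _ _ hker
  · push Not at hne
    have : {y | f y = a} = ∅ := Set.eq_empty_of_forall_notMem fun y hy => hne y hy
    rw [this, measure_empty]

end Cutoff

/-! ### The divergence theorem on a polytope -/

namespace ConvexPolytope

variable {d : ℕ} (T : ConvexPolytope d)

/-- The (signed) distance to the hyperplane of the `i`-th edge/face. -/
noncomputable def slack (i : Fin T.numFaces) (x : E d) : ℝ := T.offset i - ⟪T.normal i, x⟫

@[fun_prop]
theorem continuous_slack (i : Fin T.numFaces) : Continuous (T.slack i) := by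
  unfold slack; fun_prop

theorem mem_carrier_iff {x : E d} : x ∈ T.carrier ↔ ∀ i, 0 ≤ T.slack i x := by
  simp [carrier, slack]

theorem mem_face_iff {x : E d} {i : Fin T.numFaces} :
    x ∈ T.face i ↔ x ∈ T.carrier ∧ T.slack i x = 0 := by
  rw [slack, sub_eq_zero, eq_comm]; rfl

theorem slack_add (i : Fin T.numFaces) (x v : E d) :
    T.slack i (x + v) = T.slack i x - ⟪T.normal i, v⟫ := by
  simp only [slack, inner_add_right]; ring

theorem isClosed_carrier : IsClosed T.carrier := by
  have : T.carrier = ⋂ i, {x | 0 ≤ T.slack i x} := by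
    ext x; simp [mem_carrier_iff]
  rw [this]
  exact isClosed_iInter fun i => isClosed_le continuous_const (T.continuous_slack i)

theorem isCompact_carrier : IsCompact T.carrier :=
  Metric.isCompact_of_isClosed_isBounded T.isClosed_carrier T.isBounded

theorem face_subset_carrier (i : Fin T.numFaces) : T.face i ⊆ T.carrier := fun _ hx => hx.1

theorem isClosed_face (i : Fin T.numFaces) : IsClosed (T.face i) := by
  have : T.face i = T.carrier ∩ {x | T.slack i x = 0} := by
    ext x; exact T.mem_face_iff
  rw [this]
  exact T.isClosed_carrier.inter (isClosed_eq (T.continuous_slack i) continuous_const)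

theorem isCompact_face (i : Fin T.numFaces) : IsCompact (T.face i) :=
  T.isCompact_carrier.of_isClosed_subset (T.isClosed_face i) (T.face_subset_carrier i)

theorem convex_carrier : Convex ℝ T.carrier := by
  intro x hx y hy a b ha hb hab
  rw [mem_carrier_iff] at *
  intro i
  have : T.slack i (a • x + b • y) = a * T.slack i x + b * T.slack i y := by
    simp only [slack, inner_add_right, inner_smul_right]
    linear_combination (-T.offset i) * hab
  rw [this]
  have := hx i; have := hy i
  positivity

theorem volume_slack_eq_zero (i : Fin T.numFaces) :
    (volume : Measure (E d)) {x | T.slack i x = 0} = 0 := by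
  have h : {x | T.slack i x = 0} = {x | innerₗ (E d) (T.normal i) x = T.offset i} := by
    ext x
    rw [Set.mem_ofPred_eq, Set.mem_ofPred_eq, slack, sub_eq_zero, eq_comm]; rfl
  rw [h]
  refine volume_levelSet_eq_zero _ _ ⟨(T.offset i + 1) • T.normal i, ?_⟩
  rw [innerₗ_apply_apply, inner_smul_right, real_inner_self_eq_norm_sq, T.norm_normal]
  norm_num

/-- A smooth cut-off function which converges to the indicator function of the polytope. -/
noncomputable def cutoff (s : Finset (Fin T.numFaces)) (ε : ℝ) (x : E d) : ℝ :=
  ∏ i ∈ s, Real.smoothTransition (T.slack i x / ε)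

theorem cutoff_nonneg (s : Finset (Fin T.numFaces)) (ε : ℝ) (x : E d) : 0 ≤ T.cutoff s ε x :=
  Finset.prod_nonneg fun _ _ => Real.smoothTransition.nonneg _

theorem cutoff_le_one (s : Finset (Fin T.numFaces)) (ε : ℝ) (x : E d) : T.cutoff s ε x ≤ 1 :=
  Finset.prod_le_one (fun _ _ => Real.smoothTransition.nonneg _)
    fun _ _ => Real.smoothTransition.le_one _

theorem slack_pos_of_cutoff_ne_zero {s : Finset (Fin T.numFaces)} {ε : ℝ} (hε : 0 < ε) {x : E d}
    (h : T.cutoff s ε x ≠ 0) : ∀ i ∈ s, 0 < T.slack i x := by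
  intro i hi
  have h1 := Finset.prod_ne_zero_iff.1 h i hi
  by_contra h2
  exact h1 (Real.smoothTransition.zero_of_nonpos
    (div_nonpos_of_nonpos_of_nonneg (not_lt.1 h2) hε.le))

@[fun_prop]
theorem continuous_cutoff (s : Finset (Fin T.numFaces)) (ε : ℝ) : Continuous (T.cutoff s ε) := by
  unfold cutoff
  refine continuous_finsetProd _ fun i _ => Real.smoothTransition.continuous.comp ?_
  exact (T.continuous_slack i).div_const ε

theorem cutoff_eventually_eq (s : Finset (Fin T.numFaces)) {x v : E d}
    (h : ∀ i ∈ s, T.slack i x ≠ 0) :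
    ∀ᶠ ε in 𝓝[>] (0 : ℝ), T.cutoff s ε (x + ε • v) =
      {x | ∀ i ∈ s, 0 < T.slack i x}.indicator (fun _ => (1 : ℝ)) x := by
  have h1 : ∀ᶠ ε in 𝓝[>] (0 : ℝ), ∀ i ∈ s, Real.smoothTransition (T.slack i (x + ε • v) / ε) =
      if 0 < T.slack i x then 1 else 0 := by
    rw [Filter.eventually_all_finset]
    intro i hi
    filter_upwards [smoothTransition_div_eventually_eq (c := -⟪T.normal i, v⟫) (h i hi)] with ε hε
    rw [← hε, slack_add, inner_smul_right]
    ring_nf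
  filter_upwards [h1] with ε hε
  rw [cutoff, Finset.prod_congr rfl hε, Finset.prod_ite_zero, Set.indicator_apply]
  simp

theorem hasFDerivAt_cutoff (ε : ℝ) (x : E d) :
    HasFDerivAt (T.cutoff Finset.univ ε) (∑ i, T.cutoff (Finset.univ.erase i) ε x •
      (-(deriv Real.smoothTransition (T.slack i x / ε) / ε) • innerSL ℝ (T.normal i))) x := by
  unfold cutoff
  refine HasFDerivAt.finsetProd fun i _ => ?_
  have h1 : HasFDerivAt (fun x => T.slack i x / ε) (ε⁻¹ • -(innerSL ℝ (T.normal i))) x := by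
    have h2 : HasFDerivAt (T.slack i) (-(innerSL ℝ (T.normal i))) x := by
      have := (innerSL ℝ (T.normal i)).hasFDerivAt (x := x)
      exact this.const_sub (T.offset i)
    have h3 : (fun x => T.slack i x / ε) = ε⁻¹ • T.slack i := by
      ext y; simp [div_eq_mul_inv, mul_comm]
    rw [h3]
    exact h2.const_smul ε⁻¹
  refine ((hasDerivAt_smoothTransition _).comp_hasFDerivAt x h1).congr_fderiv ?_
  rw [smul_neg, smul_neg, smul_smul, neg_smul, ← div_eq_mul_inv]

theorem hasCompactSupport_cutoff {ε : ℝ} (hε : 0 < ε) :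
    HasCompactSupport (T.cutoff Finset.univ ε) :=
  HasCompactSupport.intro T.isCompact_carrier fun x hx => by
    by_contra h
    exact hx (T.mem_carrier_iff.2 fun i =>
      (T.slack_pos_of_cutoff_ne_zero hε h i (Finset.mem_univ i)).le)

/-- The layer term of the `i`-th edge/face in the derivative of the cut-off function. -/
noncomputable def layer (i : Fin T.numFaces) (ε : ℝ) (x : E d) : ℝ :=
  deriv Real.smoothTransition (T.slack i x / ε) / ε * T.cutoff (Finset.univ.erase i) ε x

theorem mem_carrier_of_layer_ne_zero {i : Fin T.numFaces} {ε : ℝ} (hε : 0 < ε) {x : E d}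
    (h : T.layer i ε x ≠ 0) : x ∈ T.carrier ∧ T.slack i x / ε ∈ Set.Icc (0 : ℝ) 1 := by
  rw [layer, mul_ne_zero_iff, div_ne_zero_iff] at h
  have h1 : T.slack i x / ε ∈ Set.Icc (0 : ℝ) 1 := by
    by_contra h2
    exact h.1.1 (deriv_smoothTransition_eq_zero h2)
  refine ⟨T.mem_carrier_iff.2 fun j => ?_, h1⟩
  by_cases hj : j = i
  · subst hj
    by_contra h3
    exact absurd h1.1 (not_le.2 (div_neg_of_neg_of_pos (not_le.1 h3) hε))
  · exact (T.slack_pos_of_cutoff_ne_zero hε h.2 j (by simp [hj])).le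

theorem continuous_layer (i : Fin T.numFaces) (ε : ℝ) : Continuous (T.layer i ε) := by
  unfold layer
  refine Continuous.mul (Continuous.div_const ?_ _) (T.continuous_cutoff _ _)
  exact continuous_deriv_smoothTransition.comp ((T.continuous_slack i).div_const ε)

theorem hasCompactSupport_layer (i : Fin T.numFaces) {ε : ℝ} (hε : 0 < ε) :
    HasCompactSupport (T.layer i ε) :=
  HasCompactSupport.intro T.isCompact_carrier fun x hx => by
    by_contra h
    exact hx (T.mem_carrier_of_layer_ne_zero hε h).1

theorem integral_cutoff_mul_pderiv (p : MvPolynomial (Fin d) ℝ) (l : Fin d) {ε : ℝ} (hε : 0 < ε) :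
    ∫ x, peval (MvPolynomial.pderiv l p) x * T.cutoff Finset.univ ε x =
      ∑ i, T.normal i l * ∫ x, peval p x * T.layer i ε x := by
  set v : E d := EuclideanSpace.single l 1 with hv
  have hp : ∀ x, fderiv ℝ (peval p) x v = peval (MvPolynomial.pderiv l p) x := by
    intro x
    rw [(hasFDerivAt_peval p x).fderiv]
    simp [hv]
  have hg : ∀ x, fderiv ℝ (T.cutoff Finset.univ ε) x v = -∑ i, T.normal i l * T.layer i ε x := by
    intro x
    rw [(T.hasFDerivAt_cutoff ε x).fderiv, ← Finset.sum_neg_distrib]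
    simp only [sum_apply, smul_apply, innerSL_apply_apply, hv, layer, smul_eq_mul,
      EuclideanSpace.inner_single_right]
    refine Finset.sum_congr rfl fun i _ => ?_
    simp
    ring
  have hint : ∀ i, Integrable (fun x => peval p x * T.layer i ε x) volume := fun i =>
    ((continuous_peval p).mul (T.continuous_layer i ε)).integrable_of_hasCompactSupport
      (T.hasCompactSupport_layer i hε).mul_left
  have hfg' : Integrable (fun x => peval p x * fderiv ℝ (T.cutoff Finset.univ ε) x v) volume := by
    simp_rw [hg, mul_neg, Finset.mul_sum]
    refine (integrable_finsetSum _ fun i _ => ?_).neg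
    simpa only [mul_left_comm] using (hint i).const_mul (T.normal i l)
  -- Integration by parts on the whole space; there is no boundary term because the cut-off has
  -- compact support. Its derivative is a sum of layers concentrated near the individual faces.
  have h := integral_mul_fderiv_eq_neg_fderiv_mul_of_integrable (μ := (volume : Measure (E d)))
    (f := peval p) (g := T.cutoff Finset.univ ε) (v := v)
    (by
      simp_rw [hp]
      exact ((continuous_peval _).mul (T.continuous_cutoff _ ε)).integrable_of_hasCompactSupport
        (T.hasCompactSupport_cutoff hε).mul_left)
    hfg'
    (((continuous_peval _).mul (T.continuous_cutoff _ ε)).integrable_of_hasCompactSupport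
        (T.hasCompactSupport_cutoff hε).mul_left)
    (fun x _ => (hasFDerivAt_peval p x).differentiableAt)
    (fun x _ => (T.hasFDerivAt_cutoff ε x).differentiableAt)
  simp_rw [hp, hg] at h
  have h1 : ∀ x, peval p x * -∑ i, T.normal i l * T.layer i ε x =
      -∑ i, T.normal i l * (peval p x * T.layer i ε x) := by
    intro x
    rw [mul_neg, Finset.mul_sum]
    simp only [mul_left_comm]
  simp_rw [h1] at h
  rw [integral_neg, neg_inj] at h
  rw [← h, integral_finsetSum _ fun i _ => (hint i).const_mul _]
  exact Finset.sum_congr rfl fun i _ => integral_const_mul _ _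

theorem tendsto_integral_cutoff (f : E d → ℝ) (hf : Continuous f) :
    Tendsto (fun ε => ∫ x, f x * T.cutoff Finset.univ ε x) (𝓝[>] 0) (𝓝 (T.integral f)) := by
  rw [ConvexPolytope.integral, ← integral_indicator T.isClosed_carrier.measurableSet]
  refine tendsto_integral_filter_of_dominated_convergence
    (T.carrier.indicator fun x => |f x|) ?_ ?_ ?_ ?_
  · exact Eventually.of_forall fun ε =>
      (hf.mul (T.continuous_cutoff _ ε)).aestronglyMeasurable
  · filter_upwards [self_mem_nhdsWithin] with ε hε
    refine Eventually.of_forall fun x => ?_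
    by_cases hx : x ∈ T.carrier
    · rw [Set.indicator_of_mem hx, norm_mul, Real.norm_eq_abs, Real.norm_of_nonneg
        (T.cutoff_nonneg _ _ _)]
      exact mul_le_of_le_one_right (abs_nonneg _) (T.cutoff_le_one _ _ _)
    · rw [Set.indicator_of_notMem hx]
      have : T.cutoff Finset.univ ε x = 0 := by
        by_contra h
        exact hx (T.mem_carrier_iff.2 fun i =>
          (T.slack_pos_of_cutoff_ne_zero hε h i (Finset.mem_univ i)).le)
      simp [this]
  · rw [integrable_indicator_iff T.isClosed_carrier.measurableSet]
    exact ContinuousOn.integrableOn_compact T.isCompact_carrier (by fun_prop)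
  · have hnull : ∀ᵐ x : E d, ∀ i, T.slack i x ≠ 0 := by
      rw [ae_all_iff]
      intro i
      rw [ae_iff]
      simpa using T.volume_slack_eq_zero i
    filter_upwards [hnull] with x hx
    have h1 := T.cutoff_eventually_eq Finset.univ (x := x) (v := 0) fun i _ => hx i
    refine tendsto_const_nhds.congr' ?_
    filter_upwards [h1] with ε hε
    rw [smul_zero, add_zero] at hε
    rw [hε]
    by_cases hxc : x ∈ T.carrier
    · rw [Set.indicator_of_mem hxc, Set.indicator_of_mem, mul_one]
      exact fun i _ => lt_of_le_of_ne (T.mem_carrier_iff.1 hxc i) (hx i).symm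
    · rw [Set.indicator_of_notMem hxc, Set.indicator_of_notMem, mul_zero]
      exact fun h => hxc (T.mem_carrier_iff.2 fun i => (h i (Finset.mem_univ i)).le)

/-- Coordinates on the hyperplane of the `i`-th edge/face. -/
theorem exists_face_coordinates {m : ℕ} (T : ConvexPolytope (m + 1)) (i : Fin T.numFaces) :
    ∃ (c : E (m + 1)) (ι : E m →ₗᵢ[ℝ] E (m + 1)), T.slack i c = 0 ∧ (∀ j ≠ i, 0 < T.slack j c) ∧
      (∀ y, ⟪T.normal i, ι y⟫ = 0) ∧ (∀ x, T.slack i x = 0 → ∃ y, c + ι y = x) ∧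
      MeasurePreserving (fun p : ℝ × E m => p.1 • T.normal i + ι p.2)
        (volume.prod volume) volume := by
  obtain ⟨c, hc, hcj⟩ := T.irredundant i
  obtain ⟨ι, h0, hs, hmp⟩ := exists_adapted_coordinates (T.normal i) (T.norm_normal i)
  refine ⟨c, ι, by simp [slack, hc], fun j hj => by simpa [slack] using hcj j hj, h0,
    fun x hx => face_subset_range hs ?_, hmp⟩
  rw [hc]
  simp only [slack] at hx
  linarith

theorem face_subset_range_of_coordinates {m : ℕ} {T : ConvexPolytope (m + 1)}
    {i : Fin T.numFaces} {c : E (m + 1)} {ι : E m →ₗᵢ[ℝ] E (m + 1)}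
    (h : ∀ x, T.slack i x = 0 → ∃ y, c + ι y = x) : T.face i ⊆ Set.range fun y => c + ι y :=
  fun x hx => h x (T.mem_face_iff.1 hx).2

/-- Change of variables to hyperplane coordinates and a normal coordinate `-ε σ`, so that `σ` is the
rescaled distance to the face. The Jacobian `ε` cancels the factor `1 / ε` in the layer. -/
theorem integral_layer_eq {m : ℕ} (T : ConvexPolytope (m + 1)) (i : Fin T.numFaces)
    {c : E (m + 1)} {ι : E m →ₗᵢ[ℝ] E (m + 1)} (hc : T.slack i c = 0)
    (h0 : ∀ y, ⟪T.normal i, ι y⟫ = 0)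
    (hmp : MeasurePreserving (fun p : ℝ × E m => p.1 • T.normal i + ι p.2)
        (volume.prod volume) volume)
    {f : E (m + 1) → ℝ} (hf : Continuous f) {ε : ℝ} (hε : 0 < ε)
    (hG : Integrable (fun z : ℝ × E m => deriv Real.smoothTransition z.1 *
      (f (c + ι z.2 + ε • (-z.1 • T.normal i)) *
        T.cutoff (Finset.univ.erase i) ε (c + ι z.2 + ε • (-z.1 • T.normal i))))
      (volume.prod volume)) :
    ∫ x, f x * T.layer i ε x = ∫ z : ℝ × E m, deriv Real.smoothTransition z.1 *
      (f (c + ι z.2 + ε • (-z.1 • T.normal i)) *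
        T.cutoff (Finset.univ.erase i) ε (c + ι z.2 + ε • (-z.1 • T.normal i)))
          ∂(volume.prod volume) := by
  have hmp' : MeasurePreserving (fun p : ℝ × E m => c + (p.1 • T.normal i + ι p.2))
      (volume.prod volume) volume :=
    (measurePreserving_add_left (volume : Measure (E (m + 1))) c).comp hmp
  have hemb : MeasurableEmbedding fun p : ℝ × E m => c + (p.1 • T.normal i + ι p.2) := by
    refine Continuous.measurableEmbedding (by fun_prop) fun p q hpq => ?_
    have h1 := add_left_cancel hpq
    have h2 := congrArg (fun x => ⟪T.normal i, x⟫) h1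
    simp only [inner_add_right, h0, inner_smul_right, real_inner_self_eq_norm_sq, T.norm_normal]
      at h2
    have h3 : p.1 = q.1 := by linarith
    rw [h3] at h1
    exact Prod.ext h3 (ι.injective (add_left_cancel h1))
  have hint : Integrable (fun x => f x * T.layer i ε x) volume :=
    (hf.mul (T.continuous_layer i ε)).integrable_of_hasCompactSupport
      (T.hasCompactSupport_layer i hε).mul_left
  have hint' := (hmp'.integrable_comp_emb hemb).2 hint
  simp only [Function.comp_def] at hint'
  rw [← hmp'.integral_comp hemb, integral_prod _ hint', integral_prod _ hG]
  have hsub := Measure.integral_comp_mul_left (fun s => ∫ y : E m,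
    f (c + (s • T.normal i + ι y)) * T.layer i ε (c + (s • T.normal i + ι y))) (-ε)
  rw [abs_inv, abs_neg, abs_of_pos hε, smul_eq_mul, eq_inv_mul_iff_mul_eq₀ hε.ne'] at hsub
  rw [← hsub, ← integral_const_mul]
  refine integral_congr_ae (Eventually.of_forall fun σ => ?_)
  simp only
  rw [← integral_const_mul]
  refine integral_congr_ae (Eventually.of_forall fun y => ?_)
  have hx : c + ((-ε * σ) • T.normal i + ι y) = c + ι y + ε • (-σ • T.normal i) := by
    rw [smul_smul, mul_neg, neg_mul]; abel
  have hs : T.slack i (c + ι y + ε • (-σ • T.normal i)) / ε = σ := by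
    rw [slack_add, slack_add, hc, h0, inner_smul_right, inner_smul_right,
      real_inner_self_eq_norm_sq, T.norm_normal]
    field_simp; ring
  simp only [hx, layer, hs]
  field_simp

/-- In the rescaled coordinates the integrand converges to a product. The normal profile integrates
to `1`, and the cut-offs of the other constraints become the indicator of the face, up to a null set
of the hyperplane. -/
theorem tendsto_integral_layer {m : ℕ} (T : ConvexPolytope (m + 1)) (i : Fin T.numFaces)
    {f : E (m + 1) → ℝ} (hf : Continuous f) :
    Tendsto (fun ε => ∫ x, f x * T.layer i ε x) (𝓝[>] 0) (𝓝 (T.faceIntegral i f)) := by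
  obtain ⟨c, ι, hc, hcj, h0, hs, hmp⟩ := T.exists_face_coordinates i
  set G : ℝ → ℝ × E m → ℝ := fun ε z => deriv Real.smoothTransition z.1 *
      (f (c + ι z.2 + ε • (-z.1 • T.normal i)) *
        T.cutoff (Finset.univ.erase i) ε (c + ι z.2 + ε • (-z.1 • T.normal i))) with hGdef
  obtain ⟨M, hM⟩ := T.isCompact_carrier.exists_bound_of_continuousOn hf.continuousOn
  obtain ⟨R, hR⟩ := T.isBounded.subset_closedBall (0 : E (m + 1))
  have hR' : ∀ x ∈ T.carrier, ‖x‖ ≤ R := fun x hx => by simpa using hR hx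
  obtain ⟨D, hD⟩ := hasCompactSupport_deriv_smoothTransition.exists_bound_of_continuous
    continuous_deriv_smoothTransition
  -- The integrand vanishes unless the moving point lies in `T` with `σ ∈ [0, 1]`; for `ε ≤ 1` this
  -- confines both coordinates to a fixed compact box.
  set bound : ℝ × E m → ℝ := (Set.Icc (0 : ℝ) 1 ×ˢ Metric.closedBall (0 : E m)
    (R + 1 + ‖c‖)).indicator fun _ => D * M with hbound
  have hboundint : Integrable bound (volume.prod volume) := by
    rw [hbound, integrable_indicator_iff (measurableSet_Icc.prod measurableSet_closedBall)]
    refine integrableOn_const ?_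
    exact (isCompact_Icc.prod (isCompact_closedBall _ _)).measure_lt_top.ne
  have hGmeas : ∀ ε, Continuous (G ε) := fun ε => by
    refine (continuous_deriv_smoothTransition.comp continuous_fst).mul
      ((hf.comp ?_).mul ((T.continuous_cutoff _ _).comp ?_)) <;> fun_prop
  have hGb : ∀ ε, 0 < ε → ε ≤ 1 → ∀ z, ‖G ε z‖ ≤ bound z := by
    intro ε hε hε1 z
    by_cases hz : G ε z = 0
    · rw [hz, norm_zero, hbound]
      refine Set.indicator_nonneg (fun _ _ => ?_) _
      exact mul_nonneg ((norm_nonneg _).trans (hD 0)) ((norm_nonneg _).trans (hM c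
        (T.mem_carrier_iff.2 fun j => by
          by_cases hj : j = i
          · rw [hj, hc]
          · exact (hcj j hj).le)))
    · have hz' := hz
      simp only [hGdef, mul_ne_zero_iff] at hz
      obtain ⟨hz1, -, hz3⟩ := hz
      have hσ : z.1 ∈ Set.Icc (0 : ℝ) 1 := by
        by_contra h; exact hz1 (deriv_smoothTransition_eq_zero h)
      set x := c + ι z.2 + ε • (-z.1 • T.normal i) with hx
      have hsl : T.slack i x = ε * z.1 := by
        rw [hx, slack_add, slack_add, hc, h0, inner_smul_right, inner_smul_right,
          real_inner_self_eq_norm_sq, T.norm_normal]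
        ring
      have hxT : x ∈ T.carrier := by
        rw [mem_carrier_iff]
        intro j
        by_cases hj : j = i
        · rw [hj, hsl]; exact mul_nonneg hε.le hσ.1
        · exact (T.slack_pos_of_cutoff_ne_zero hε hz3 j (by simp [hj])).le
      have hy : ‖z.2‖ ≤ R + 1 + ‖c‖ := by
        have h1 : ι z.2 = x - c + (ε * z.1) • T.normal i := by
          rw [hx, smul_smul, mul_neg, neg_smul]; abel
        rw [← ι.norm_map, h1]
        refine (norm_add_le _ _).trans ?_
        have h2 := norm_sub_le x c
        have h3 := hR' x hxT
        have h4 : ‖(ε * z.1) • T.normal i‖ ≤ 1 := by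
          rw [norm_smul, T.norm_normal, mul_one, Real.norm_of_nonneg (mul_nonneg hε.le hσ.1)]
          exact mul_le_one₀ hε1 hσ.1 hσ.2
        linarith
      have hzmem : z ∈ Set.Icc (0 : ℝ) 1 ×ˢ Metric.closedBall (0 : E m) (R + 1 + ‖c‖) :=
        ⟨hσ, by simpa using hy⟩
      rw [hbound, Set.indicator_of_mem hzmem]
      simp only [hGdef, norm_mul]
      refine mul_le_mul (hD _) ?_ (by positivity) ((norm_nonneg _).trans (hD 0))
      refine (mul_le_of_le_one_right (norm_nonneg _) ?_).trans (hM x hxT)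
      rw [Real.norm_of_nonneg (T.cutoff_nonneg _ _ _)]
      exact T.cutoff_le_one _ _ _
  have hev : ∀ᶠ ε in 𝓝[>] (0 : ℝ), 0 < ε ∧ ε ≤ 1 := by
    filter_upwards [Ioc_mem_nhdsGT (zero_lt_one' ℝ)] with ε hε using hε
  have heq : ∀ᶠ ε in 𝓝[>] (0 : ℝ), ∫ z, G ε z ∂(volume.prod volume) =
      ∫ x, f x * T.layer i ε x := by
    filter_upwards [hev] with ε hε
    refine (T.integral_layer_eq i hc h0 hmp hf hε.1 ?_).symm
    exact hboundint.mono' (hGmeas ε).aestronglyMeasurable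
      (Eventually.of_forall (hGb ε hε.1 hε.2))
  set P : Set (E m) := {y | ∀ j ∈ Finset.univ.erase i, 0 < T.slack j (c + ι y)} with hP
  have hnull : ∀ᵐ y : E m, ∀ j ∈ Finset.univ.erase i, T.slack j (c + ι y) ≠ 0 := by
    rw [eventually_all_finset]
    intro j hj
    rw [ae_iff]
    have hpos := hcj j (by simpa using hj)
    have hset : {y : E m | ¬T.slack j (c + ι y) ≠ 0} =
        {y | ((innerₗ (E (m + 1)) (T.normal j)).comp ι.toLinearMap) y = T.slack j c} := by
      ext y
      rw [Set.mem_ofPred_eq, Set.mem_ofPred_eq, not_not, slack_add, sub_eq_zero, eq_comm]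
      rfl
    rw [hset]
    -- Irredundancy enters here: at the base point the constraint `j` is inactive, so it does not
    -- vanish identically on the hyperplane.
    exact volume_levelSet_eq_zero _ _ ⟨0, by rw [map_zero]; exact hpos.ne⟩
  have hlim : ∫ z : ℝ × E m, deriv Real.smoothTransition z.1 *
      (f (c + ι z.2) * P.indicator (fun _ => (1 : ℝ)) z.2) ∂(volume.prod volume) =
        T.faceIntegral i f := by
    rw [integral_prod_mul (f := deriv Real.smoothTransition)
      (g := fun y : E m => f (c + ι y) * P.indicator (fun _ => (1 : ℝ)) y),
      integral_deriv_smoothTransition, one_mul]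
    have h1 := setIntegral_hausdorff_eq ι c (face_subset_range_of_coordinates hs)
      (T.isClosed_face i).measurableSet f
    refine Eq.trans ?_ h1.symm
    rw [← integral_indicator (((T.isClosed_face i).preimage (by fun_prop)).measurableSet)]
    refine integral_congr_ae ?_
    filter_upwards [hnull] with y hy
    have hsi : T.slack i (c + ι y) = 0 := by rw [slack_add, hc, h0, sub_zero]
    by_cases hyP : y ∈ P
    · rw [Set.indicator_of_mem hyP, mul_one, Set.indicator_of_mem]
      refine T.mem_face_iff.2 ⟨T.mem_carrier_iff.2 fun j => ?_, hsi⟩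
      by_cases hj : j = i
      · rw [hj, hsi]
      · exact (hyP j (by simp [hj])).le
    · rw [Set.indicator_of_notMem hyP, mul_zero, Set.indicator_of_notMem]
      intro hyf
      exact hyP fun j hj => lt_of_le_of_ne
        (T.mem_carrier_iff.1 (T.mem_face_iff.1 hyf).1 j) (hy j hj).symm
  rw [← hlim]
  refine Tendsto.congr' heq ?_
  refine tendsto_integral_filter_of_dominated_convergence bound
    (Eventually.of_forall fun ε => (hGmeas ε).aestronglyMeasurable) ?_ hboundint ?_
  · filter_upwards [hev] with ε hε using Eventually.of_forall (hGb ε hε.1 hε.2)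
  · filter_upwards [Measure.quasiMeasurePreserving_snd.ae hnull] with z hz
    have h1 := T.cutoff_eventually_eq (Finset.univ.erase i) (x := c + ι z.2)
      (v := -z.1 • T.normal i) hz
    refine Tendsto.mul tendsto_const_nhds (Tendsto.mul ?_ ?_)
    · have : Tendsto (fun ε : ℝ => f (c + ι z.2 + ε • (-z.1 • T.normal i))) (𝓝 0)
          (𝓝 (f (c + ι z.2 + (0 : ℝ) • (-z.1 • T.normal i)))) := by
        apply Continuous.tendsto; fun_prop
      rw [zero_smul, add_zero] at this
      exact this.mono_left nhdsWithin_le_nhds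
    · refine tendsto_const_nhds.congr' ?_
      filter_upwards [h1] with ε hε
      rw [hε]
      rfl

/-- The divergence theorem on a polytope, one coordinate at a time. -/
theorem integral_pderiv {m : ℕ} (T : ConvexPolytope (m + 1)) (p : MvPolynomial (Fin (m + 1)) ℝ)
    (l : Fin (m + 1)) :
    T.integral (peval (MvPolynomial.pderiv l p)) =
      ∑ i, T.normal i l * T.faceIntegral i (peval p) := by
  refine tendsto_nhds_unique (T.tendsto_integral_cutoff _ (continuous_peval _)) ?_
  have h := tendsto_finsetSum Finset.univ fun i _ =>
    (T.tendsto_integral_layer i (continuous_peval p)).const_mul (T.normal i l)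
  refine h.congr' ?_
  filter_upwards [self_mem_nhdsWithin] with ε hε
  exact (T.integral_cutoff_mul_pderiv p l hε).symm

end ConvexPolytope

/-! ### Distances within a face to the hyperplanes of the other faces -/

namespace ConvexPolytope

/-- A parametrisation `y ↦ c + ι y` of the hyperplane of the `i`-th edge/face by `ℝ^m`, where `c` is
a point at which only the `i`-th constraint is active. -/
structure FaceChart {m : ℕ} (T : ConvexPolytope (m + 1)) (i : Fin T.numFaces) where
  base : E (m + 1)
  incl : E m →ₗᵢ[ℝ] E (m + 1)
  slack_base : T.slack i base = 0
  slack_base_pos : ∀ j ≠ i, 0 < T.slack j base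
  inner_incl : ∀ y, ⟪T.normal i, incl y⟫ = 0
  surj : ∀ x, T.slack i x = 0 → ∃ y, base + incl y = x

theorem nonempty_faceChart {m : ℕ} (T : ConvexPolytope (m + 1)) (i : Fin T.numFaces) :
    Nonempty (T.FaceChart i) := by
  obtain ⟨c, ι, h1, h2, h3, h4, -⟩ := T.exists_face_coordinates i
  exact ⟨⟨c, ι, h1, h2, h3, h4⟩⟩

namespace FaceChart

variable {m : ℕ} {T : ConvexPolytope (m + 1)} {i : Fin T.numFaces} (χ : T.FaceChart i)

/-- The parametrisation. -/
noncomputable def toFun (y : E m) : E (m + 1) := χ.base + χ.incl y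

noncomputable instance : CoeFun (T.FaceChart i) fun _ => E m → E (m + 1) := ⟨toFun⟩

theorem apply_eq (y : E m) : χ y = χ.base + χ.incl y := rfl

theorem isometry : Isometry χ := isometry_add_linearIsometry χ.incl χ.base

@[fun_prop]
theorem continuous : Continuous χ := χ.isometry.continuous

theorem slack_self (y : E m) : T.slack i (χ y) = 0 := by
  rw [apply_eq, slack_add, χ.slack_base, χ.inner_incl, sub_zero]

theorem face_subset_range : T.face i ⊆ Set.range χ :=
  face_subset_range_of_coordinates χ.surj

theorem apply_add (y v : E m) : χ (y + v) = χ y + χ.incl v := by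
  rw [apply_eq, apply_eq, map_add, add_assoc]

theorem exists_tangent (n : E (m + 1)) :
    ∃ τ : E m, n = ⟪T.normal i, n⟫ • T.normal i + χ.incl τ := by
  obtain ⟨τ, hτ⟩ := χ.surj (χ.base + (n - ⟪T.normal i, n⟫ • T.normal i)) (by
    rw [slack_add, χ.slack_base, inner_sub_right, inner_smul_right, real_inner_self_eq_norm_sq,
      T.norm_normal]
    ring)
  exact ⟨τ, by rw [add_left_cancel hτ]; abel⟩

/-- The tangential part of a vector. -/
noncomputable def tangent (n : E (m + 1)) : E m := (χ.exists_tangent n).choose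

theorem eq_add_tangent (n : E (m + 1)) :
    n = ⟪T.normal i, n⟫ • T.normal i + χ.incl (χ.tangent n) := (χ.exists_tangent n).choose_spec

theorem inner_incl_eq (n : E (m + 1)) (y : E m) : ⟪n, χ.incl y⟫ = ⟪χ.tangent n, y⟫ := by
  conv_lhs => rw [χ.eq_add_tangent n]
  rw [inner_add_left, inner_smul_left, χ.inner_incl, mul_zero, zero_add, χ.incl.inner_map_map]

theorem norm_sq_tangent (n : E (m + 1)) :
    ‖χ.tangent n‖ ^ 2 = ‖n‖ ^ 2 - ⟪T.normal i, n⟫ ^ 2 := by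
  have h : ‖n‖ ^ 2 = ⟪T.normal i, n⟫ ^ 2 + ‖χ.tangent n‖ ^ 2 := by
    conv_lhs => rw [χ.eq_add_tangent n]
    rw [norm_add_sq_real, inner_smul_left, χ.inner_incl, norm_smul, T.norm_normal,
      χ.incl.norm_map]
    simp
  linarith

theorem slack_apply_add (l : Fin T.numFaces) (y v : E m) :
    T.slack l (χ (y + v)) = T.slack l (χ y) - ⟪χ.tangent (T.normal l), v⟫ := by
  rw [apply_add, slack_add, inner_incl_eq]

/-- Moving in the direction of the tangential part `τ` of the normal decreases the slack at rate
`‖τ‖`, and it must stay nonnegative up to any distance below `R`. -/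
theorem norm_tangent_mul_le {l : Fin T.numFaces} {y : E m} {R : ℝ}
    (h : ∀ z ∈ Metric.ball y R, 0 ≤ T.slack l (χ z)) (hR : 0 < R) :
    ‖χ.tangent (T.normal l)‖ * R ≤ T.slack l (χ y) := by
  set τ := χ.tangent (T.normal l) with hτ
  have h0 := h y (Metric.mem_ball_self hR)
  by_cases hz : τ = 0
  · rw [hz, norm_zero, zero_mul]; exact h0
  have hn : 0 < ‖τ‖ := norm_pos_iff.2 hz
  rw [← le_div_iff₀' hn]
  refine le_of_forall_lt fun t ht => ?_
  by_cases ht0 : t < 0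
  · exact ht0.trans_le (by positivity)
  push Not at ht0
  set t' := (t + R) / 2 with ht'
  have h1 := h (y + (t' / ‖τ‖) • τ) (by
    rw [mem_ball_iff_norm, add_sub_cancel_left, norm_smul, Real.norm_of_nonneg (by positivity),
      div_mul_cancel₀ _ hn.ne']
    linarith)
  rw [slack_apply_add, ← hτ, inner_smul_right, real_inner_self_eq_norm_sq] at h1
  have h2 : t' / ‖τ‖ * ‖τ‖ ^ 2 = t' * ‖τ‖ := by field_simp
  rw [h2] at h1
  rw [lt_div_iff₀ hn]
  have : t * ‖τ‖ < t' * ‖τ‖ := by gcongr; linarith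
  linarith

/-- If the slack vanished at the centre, its tangential gradient would vanish too, so it would be
zero on the whole hyperplane, contrary to its sign at the base point. -/
theorem slack_pos_of_ball {y : E m} {R : ℝ} (hR : 0 < R)
    (h : ∀ z ∈ Metric.ball y R, χ z ∈ T.face i) {l : Fin T.numFaces} (hl : l ≠ i) :
    0 < T.slack l (χ y) := by
  have h0 : 0 ≤ T.slack l (χ y) :=
    T.mem_carrier_iff.1 (h y (Metric.mem_ball_self hR)).1 l
  by_contra hno
  have hz : T.slack l (χ y) = 0 := le_antisymm (not_lt.1 hno) h0
  have h1 := χ.norm_tangent_mul_le (l := l) (fun z hz => T.mem_carrier_iff.1 (h z hz).1 l) hR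
  rw [hz] at h1
  have h2 : ‖χ.tangent (T.normal l)‖ = 0 := by
    by_contra hne
    have : 0 < ‖χ.tangent (T.normal l)‖ := lt_of_le_of_ne (norm_nonneg _) (Ne.symm hne)
    nlinarith
  have h3 := χ.slack_apply_add l y (0 - y)
  rw [norm_eq_zero.1 h2, inner_zero_left, hz, sub_zero, add_sub_cancel, apply_eq, map_zero,
    add_zero] at h3
  exact (χ.slack_base_pos l hl).ne' h3

end FaceChart

variable {m : ℕ} {T : ConvexPolytope (m + 1)} {i : Fin T.numFaces}

theorem exists_active (T : ConvexPolytope (m + 1)) (i : Fin T.numFaces) :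
    ∃ x, T.slack i x = 0 ∧ ∀ j ≠ i, 0 < T.slack j x := by
  obtain ⟨χ⟩ := T.nonempty_faceChart i
  exact ⟨χ.base, χ.slack_base, χ.slack_base_pos⟩

/-- On the hyperplane of a face, two other constraints are never positively proportional. -/
theorem exists_slack_not_proportional (χ : T.FaceChart i) {l l' : Fin T.numFaces} (hl : l ≠ i)
    (hl' : l' ≠ i) (hne : l ≠ l') {a a' : ℝ} (ha : 0 < a) (ha' : 0 < a') :
    ∃ y, a' * T.slack l (χ y) ≠ a * T.slack l' (χ y) := by
  by_contra hno
  push Not at hno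
  -- Proportionality on the hyperplane `{slack i = 0}` makes the difference a constant multiple `β`
  -- of `slack i` everywhere. At a point where only `l` is active it forces `β < 0`, and at one
  -- where only `l'` is active it forces `β > 0`.
  have hA : ∀ x, a' * T.slack l x - a * T.slack l' x =
      T.slack i x * (a' * ⟪T.normal l, T.normal i⟫ - a * ⟪T.normal l', T.normal i⟫) := by
    intro x
    obtain ⟨y, hy⟩ := χ.surj (x + T.slack i x • T.normal i) (by
      rw [slack_add, inner_smul_right, real_inner_self_eq_norm_sq, T.norm_normal]; ring)
    have h1 := hno y
    rw [FaceChart.apply_eq, hy, slack_add, slack_add, inner_smul_right, inner_smul_right] at h1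
    linear_combination h1
  set β := a' * ⟪T.normal l, T.normal i⟫ - a * ⟪T.normal l', T.normal i⟫
  obtain ⟨x, hx0, hx⟩ := T.exists_active l
  obtain ⟨x', hx0', hx'⟩ := T.exists_active l'
  have h1 := hA x
  have h2 := hA x'
  rw [hx0] at h1
  rw [hx0'] at h2
  have p1 := mul_pos ha (hx l' hne.symm)
  have p2 := mul_pos ha' (hx' l hne)
  have p3 := hx i hl.symm
  have p4 := hx' i hl'.symm
  rcases le_total 0 β with hβ | hβ
  · nlinarith
  · nlinarith

/-- Each excluded equality holds only on a null set, and there are finitely many. This later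
guarantees that a segment does not meet two hyperplanes at the same instant on leaving the face. -/
theorem exists_generic_point (χ : T.FaceChart i) (α : Fin T.numFaces → ℝ) (y₀ : E m) {R : ℝ}
    (hR : 0 < R) : ∃ y ∈ Metric.ball y₀ R, ∀ l l', l ≠ i → l' ≠ i → l ≠ l' → 0 < α l → 0 < α l' →
      α l' * T.slack l (χ y) ≠ α l * T.slack l' (χ y) := by
  have hae : ∀ᵐ y : E m, ∀ l l', l ≠ i → l' ≠ i → l ≠ l' → 0 < α l → 0 < α l' →
      α l' * T.slack l (χ y) ≠ α l * T.slack l' (χ y) := by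
    simp only [ae_all_iff, Filter.eventually_imp_distrib_left]
    intro l l' hl hl' hne ha ha'
    obtain ⟨z, hz⟩ := exists_slack_not_proportional χ hl hl' hne ha ha'
    have key : ∀ y, innerₗ (E m) (α l' • χ.tangent (T.normal l) - α l • χ.tangent (T.normal l')) y =
        (α l' * T.slack l (χ 0) - α l * T.slack l' (χ 0)) -
          (α l' * T.slack l (χ y) - α l * T.slack l' (χ y)) := by
      intro y
      have h1 := χ.slack_apply_add l 0 y
      have h2 := χ.slack_apply_add l' 0 y
      rw [zero_add] at h1 h2
      rw [h1, h2, innerₗ_apply_apply, inner_sub_left, real_inner_smul_left, real_inner_smul_left]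
      ring
    rw [ae_iff]
    have hset : {y | ¬(α l' * T.slack l (χ y) ≠ α l * T.slack l' (χ y))} = {y | innerₗ (E m)
        (α l' • χ.tangent (T.normal l) - α l • χ.tangent (T.normal l')) y =
        α l' * T.slack l (χ 0) - α l * T.slack l' (χ 0)} := by
      ext y
      rw [Set.mem_ofPred_eq, Set.mem_ofPred_eq, key, not_not]
      constructor <;> intro h <;> linarith
    rw [hset]
    refine volume_levelSet_eq_zero _ _ ⟨z, fun h => hz ?_⟩
    rw [key] at h
    linarith
  by_contra hno
  push Not at hno
  have hpos := Metric.measure_ball_pos (volume : Measure (E m)) y₀ hR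
  refine hpos.ne' (measure_mono_null (fun y hy => ?_) (ae_iff.1 hae))
  rw [Set.mem_ofPred_eq]
  intro hy'
  obtain ⟨l, l', h1, h2, h3, h4, h5, h6⟩ := hno y hy
  exact hy' l l' h1 h2 h3 h4 h5 h6

/-- Leaving a face along a segment in its hyperplane, one passes through a neighbouring face. -/
theorem exists_neighbor (χ : T.FaceChart i) {y : E m} (hy : ∀ l ≠ i, 0 < T.slack l (χ y))
    {y' : E m} {j : Fin T.numFaces} (hji : j ≠ i) (hj : T.slack j (χ y') < 0)
    (hgen : ∀ l l', l ≠ i → l' ≠ i → l ≠ l' → 0 < -T.slack l (χ y') → 0 < -T.slack l' (χ y') →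
      -T.slack l' (χ y') * T.slack l (χ y) ≠ -T.slack l (χ y') * T.slack l' (χ y)) :
    ∃ l, T.Neighbors i l ∧ T.slack l (χ y') < 0 ∧
      T.slack l (χ y) * -T.slack j (χ y') ≤ T.slack j (χ y) * -T.slack l (χ y') := by
  classical
  set J := Finset.univ.filter fun l => l ≠ i ∧ T.slack l (χ y') < 0 with hJ
  -- Among the constraints violated at `y'`, the smallest ratio singles out the one hit first along
  -- the segment.
  obtain ⟨l, hlJ, hmin⟩ := J.exists_min_image
    (fun l => T.slack l (χ y) / (-T.slack l (χ y'))) ⟨j, by simp [hJ, hji, hj]⟩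
  obtain ⟨hli, hl⟩ : l ≠ i ∧ T.slack l (χ y') < 0 := by simpa [hJ] using hlJ
  have hmin' : ∀ l' ∈ J, T.slack l (χ y) * -T.slack l' (χ y') ≤
      T.slack l' (χ y) * -T.slack l (χ y') := by
    intro l' hl'
    have h2 : l' ≠ i ∧ T.slack l' (χ y') < 0 := by simpa [hJ] using hl'
    have h1 := hmin l' hl'
    rwa [div_le_div_iff₀ (by linarith) (by linarith)] at h1
  refine ⟨l, ⟨hli.symm, ?_⟩, hl, hmin' j (by simp [hJ, hji, hj])⟩
  have hly := hy l hli
  have hden : 0 < T.slack l (χ y) - T.slack l (χ y') := by linarith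
  -- The parameter at which constraint `l` becomes active; by genericity every constraint other than
  -- `i` and `l` is still strict there, so `i` and `l` are neighbours.
  set s := T.slack l (χ y) / (T.slack l (χ y) - T.slack l (χ y')) with hs
  have hs0 : 0 < s := by positivity
  have hs1 : s < 1 := by rw [hs, div_lt_one hden]; linarith
  have hz : ∀ k, T.slack k (χ (y + s • (y' - y))) =
      (1 - s) * T.slack k (χ y) + s * T.slack k (χ y') := by
    intro k
    have h1 := χ.slack_apply_add k y (y' - y)
    rw [add_sub_cancel] at h1
    rw [χ.slack_apply_add, h1, inner_smul_right]
    ring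
  have hzl : T.slack l (χ (y + s • (y' - y))) = 0 := by
    rw [hz, hs]; field_simp; ring
  refine ⟨χ (y + s • (y' - y)), ?_, ?_, fun k hki hkl => ?_⟩
  · have := χ.slack_self (y + s • (y' - y)); simp only [slack] at this; linarith
  · simp only [slack] at hzl; linarith
  · suffices 0 < T.slack k (χ (y + s • (y' - y))) by simp only [slack] at this; linarith
    rw [hz]
    have hky := hy k hki
    by_cases hk : T.slack k (χ y') < 0
    · have h1 := hmin' k (by simp [hJ, hki, hk])
      have h2 := hgen l k hli hki (Ne.symm hkl) (by linarith) (by linarith)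
      have h3 : T.slack l (χ y) * -T.slack k (χ y') < T.slack k (χ y) * -T.slack l (χ y') :=
        lt_of_le_of_ne h1 fun h => h2 (by linarith)
      have h4 : (1 - s) * T.slack k (χ y) + s * T.slack k (χ y') =
          (T.slack k (χ y) * -T.slack l (χ y') - T.slack l (χ y) * -T.slack k (χ y')) /
            (T.slack l (χ y) - T.slack l (χ y')) := by
        rw [hs]; field_simp; ring
      rw [h4]
      exact div_pos (by linarith) hden
    · have : 0 ≤ s * T.slack k (χ y') := mul_nonneg hs0.le (not_lt.1 hk)
      have : 0 < (1 - s) * T.slack k (χ y) := mul_pos (by linarith) hky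
      linarith

/-- Inside a face, away from its relative boundary, the distance to the hyperplanes of the other
faces is bounded below. -/
theorem slack_ge_of_ball (χ : T.FaceChart i) {y₀ : E m} {R s₀ r h : ℝ} (hR : 0 < R)
    (hball : ∀ y ∈ Metric.ball y₀ R, χ y ∈ T.face i)
    (hang : ∀ l, T.Neighbors i l → s₀ ^ 2 ≤ 1 - ⟪T.normal i, T.normal l⟫ ^ 2)
    {b : E (m + 1)} (hb : b ∈ T.carrier) (hbr : ∀ l, r ≤ T.slack l b) (hr : 0 < r)
    (hh : ∀ x ∈ T.carrier, ∀ y ∈ T.carrier, dist x y ≤ h) {j : Fin T.numFaces} (hj : j ≠ i) :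
    min (R / 2) (min (r / (2 * (1 + h / R))) (s₀ * R / 6)) ≤ T.slack j (χ y₀) := by
  by_contra hno
  rw [not_le, lt_min_iff, lt_min_iff] at hno
  obtain ⟨h1, h2, h3⟩ := hno
  set a := T.slack j (χ y₀) with ha
  have ha0 : 0 < a := χ.slack_pos_of_ball hR hball hj
  have hx₀ : χ y₀ ∈ T.carrier := (hball y₀ (Metric.mem_ball_self hR)).1
  have hslack : ∀ l, ∀ z ∈ Metric.ball y₀ R, 0 ≤ T.slack l (χ z) := fun l z hz =>
    T.mem_carrier_iff.1 (hball z hz).1 l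
  have hτ := χ.norm_tangent_mul_le (hslack j) hR
  set q := ⟪T.normal i, T.normal j⟫ with hq
  have hτ2 := χ.norm_sq_tangent (T.normal j)
  rw [T.norm_normal, ← hq] at hτ2
  -- A small slack at the centre of a large ball forces the normals of `i` and `j` to be nearly
  -- parallel; the two signs of `q` are treated separately.
  have hτ1 : ‖χ.tangent (T.normal j)‖ ≤ 1 / 2 := by
    have : ‖χ.tangent (T.normal j)‖ * R ≤ 1 / 2 * R := by linarith
    exact le_of_mul_le_mul_right this hR
  have hqq : 1 / 4 ≤ q ^ 2 := by nlinarith [norm_nonneg (χ.tangent (T.normal j))]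
  have hhpos : 0 ≤ h := dist_nonneg.trans (hh _ hx₀ _ hx₀)
  rcases le_or_gt q 0 with hq0 | hq0
  -- Nearly opposite normals: the polytope is squeezed between two close hyperplanes, which leaves
  -- no room for the deep point `b`.
  · have hq1 : q ≤ -(1 / 2) := by nlinarith
    have e1 : T.slack i b = -⟪T.normal i, b - χ y₀⟫ := by
      have := T.slack_add i (χ y₀) (b - χ y₀)
      rw [add_sub_cancel, χ.slack_self] at this
      linarith
    have e2 : T.slack j b = a - ⟪T.normal j, b - χ y₀⟫ := by
      have := T.slack_add j (χ y₀) (b - χ y₀)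
      rwa [add_sub_cancel] at this
    have e3 : ⟪T.normal j, b - χ y₀⟫ = q * ⟪T.normal i, b - χ y₀⟫ +
        ⟪χ.incl (χ.tangent (T.normal j)), b - χ y₀⟫ := by
      conv_lhs => rw [χ.eq_add_tangent (T.normal j)]
      rw [inner_add_left, real_inner_smul_left]
    have e4 : -⟪χ.incl (χ.tangent (T.normal j)), b - χ y₀⟫ ≤ a / R * h := by
      refine (neg_le_abs _).trans ((abs_real_inner_le_norm _ _).trans ?_)
      rw [χ.incl.norm_map]
      refine mul_le_mul ((le_div_iff₀ hR).2 hτ) ?_ (norm_nonneg _) (by positivity)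
      rw [← dist_eq_norm]; exact hh _ hb _ hx₀
    have e5 := hbr i
    have e6 := hbr j
    rw [lt_div_iff₀ (by positivity)] at h2
    have e7 : a * (2 * (1 + h / R)) = 2 * (a + a / R * h) := by ring
    nlinarith
  · have hq1 : 1 / 2 ≤ q := by nlinarith
    -- Nearly equal normals: the foot `y'` on the hyperplane of `i` of a point `w` of face `j`
    -- violates constraint `j`. The segment from near `y₀` to `y'` leaves face `i` through a
    -- neighbour `l`, whose slack at the start is at most `slack j / q ≤ 3 a`. The angle condition
    -- for `l` bounds the same slack below by `s₀ R / 2`.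
    obtain ⟨w, hw0, hw⟩ := T.exists_active j
    have hD := hw i hj.symm
    set D := T.slack i w with hDdef
    obtain ⟨y', hy'⟩ := χ.surj (w + D • T.normal i) (by
      rw [slack_add, inner_smul_right, real_inner_self_eq_norm_sq, T.norm_normal]; ring)
    have hy'' : ∀ l, T.slack l (χ y') = T.slack l w - D * ⟪T.normal l, T.normal i⟫ := by
      intro l
      rw [FaceChart.apply_eq, hy', slack_add, inner_smul_right]
    have hjy' : T.slack j (χ y') = -(D * q) := by
      rw [hy'', hw0, real_inner_comm, ← hq]; ring
    obtain ⟨y, hyb, hgen⟩ := exists_generic_point χ (fun l => -T.slack l (χ y')) y₀ (half_pos hR)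
    have hyball : ∀ z ∈ Metric.ball y (R / 2), χ z ∈ T.face i := fun z hz => hball z (by
      rw [Metric.mem_ball] at hz hyb ⊢
      linarith [dist_triangle z y y₀])
    obtain ⟨l, hnb, hl, hle⟩ := exists_neighbor χ
      (fun l hl => χ.slack_pos_of_ball (half_pos hR) hyball hl) hj
      (by rw [hjy']; nlinarith) hgen
    have hlτ := χ.norm_tangent_mul_le (l := l)
      (fun z hz => T.mem_carrier_iff.1 (hyball z hz).1 l) (half_pos hR)
    have hs := hang l hnb
    have hlτ2 := χ.norm_sq_tangent (T.normal l)
    rw [T.norm_normal] at hlτ2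
    have hs' : s₀ ≤ ‖χ.tangent (T.normal l)‖ :=
      le_of_sq_le_sq (by linarith) (norm_nonneg _)
    have hwl : 0 ≤ T.slack l w := by
      by_cases hlj : l = j
      · rw [hlj, hw0]
      · exact (hw l hlj).le
    have hlD : -T.slack l (χ y') ≤ D := by
      rw [hy'']
      have : ⟪T.normal l, T.normal i⟫ ≤ 1 := by
        refine (real_inner_le_norm _ _).trans ?_
        rw [T.norm_normal, T.norm_normal, one_mul]
      nlinarith
    have hjy : T.slack j (χ y) ≤ 3 / 2 * a := by
      have e1 := χ.slack_apply_add j y₀ (y - y₀)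
      rw [add_sub_cancel] at e1
      have e2 : -⟪χ.tangent (T.normal j), y - y₀⟫ ≤ ‖χ.tangent (T.normal j)‖ * (R / 2) := by
        refine (neg_le_abs _).trans ((abs_real_inner_le_norm _ _).trans ?_)
        refine mul_le_mul_of_nonneg_left ?_ (norm_nonneg _)
        rw [← dist_eq_norm]; exact (Metric.mem_ball.1 hyb).le
      linarith
    have hjy0 : 0 < T.slack j (χ y) := χ.slack_pos_of_ball (half_pos hR) hyball hj
    rw [hjy', neg_neg] at hle
    have e3 : T.slack l (χ y) * (D * q) ≤ T.slack j (χ y) * D :=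
      hle.trans (mul_le_mul_of_nonneg_left hlD hjy0.le)
    have e4 : T.slack l (χ y) * q ≤ T.slack j (χ y) := by
      refine le_of_mul_le_mul_right ?_ hD
      linarith
    have e5 : 0 < T.slack l (χ y) := χ.slack_pos_of_ball (half_pos hR) hyball hnb.1.symm
    have e6 : s₀ * (R / 2) ≤ T.slack l (χ y) :=
      (mul_le_mul_of_nonneg_right hs' (half_pos hR).le).trans hlτ
    nlinarith

end ConvexPolytope

/-! ### Shape regularity implies uniform fatness -/

namespace ConvexPolytope

theorem dist_le_diam {d : ℕ} (T : ConvexPolytope d) {x y : E d} (hx : x ∈ T.carrier)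
    (hy : y ∈ T.carrier) : dist x y ≤ Metric.diam T.carrier :=
  Metric.dist_le_diam_of_mem T.isCompact_carrier.isBounded hx hy

variable {m : ℕ}

theorem diam_pos (T : ConvexPolytope (m + 1)) : 0 < Metric.diam T.carrier := by
  obtain ⟨x, hx⟩ := T.nonempty_interior
  obtain ⟨ε, hε, hb⟩ := Metric.isOpen_iff.1 isOpen_interior x hx
  have h1 : ‖(ε / 2) • EuclideanSpace.single (0 : Fin (m + 1)) (1 : ℝ)‖ = ε / 2 := by
    rw [norm_smul, Real.norm_of_nonneg (by positivity)]; simp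
  have h2 : x + (ε / 2) • EuclideanSpace.single (0 : Fin (m + 1)) (1 : ℝ) ∈ T.carrier := by
    refine interior_subset (hb ?_)
    rw [mem_ball_iff_norm, add_sub_cancel_left, h1]; linarith
  have h3 := T.dist_le_diam h2 (interior_subset hx)
  rw [dist_eq_norm, add_sub_cancel_left, h1] at h3
  linarith

theorem slack_le_diam (T : ConvexPolytope (m + 1)) (i : Fin T.numFaces) {x : E (m + 1)}
    (hx : x ∈ T.carrier) : T.slack i x ≤ Metric.diam T.carrier := by
  obtain ⟨c, hc, hcj⟩ := T.exists_active i
  have hcT : c ∈ T.carrier := T.mem_carrier_iff.2 fun j => by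
    by_cases hj : j = i
    · rw [hj, hc]
    · exact (hcj j hj).le
  have h1 := T.slack_add i c (x - c)
  rw [add_sub_cancel, hc] at h1
  have h2 := (neg_le_abs _).trans (abs_real_inner_le_norm (T.normal i) (x - c))
  rw [T.norm_normal, one_mul, ← dist_eq_norm] at h2
  have := T.dist_le_diam hx hcT
  linarith

theorem slack_ge_of_ball_subset {d : ℕ} (T : ConvexPolytope d) {x : E d} {R : ℝ} (hR : 0 < R)
    (h : Metric.ball x R ⊆ T.carrier) (i : Fin T.numFaces) : R ≤ T.slack i x := by
  refine le_of_forall_lt_imp_le_of_dense fun t ht => ?_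
  have h0 := T.mem_carrier_iff.1 (h (Metric.mem_ball_self hR)) i
  by_cases ht0 : t < 0
  · exact ht0.le.trans h0
  have h1 := T.mem_carrier_iff.1 (h (show x + t • T.normal i ∈ Metric.ball x R by
    rw [mem_ball_iff_norm, add_sub_cancel_left, norm_smul, T.norm_normal, mul_one,
      Real.norm_of_nonneg (not_lt.1 ht0)]
    exact ht)) i
  rw [slack_add, inner_smul_right, real_inner_self_eq_norm_sq, T.norm_normal] at h1
  linarith

theorem continuousOn_integrableOn_face {d : ℕ} (T : ConvexPolytope (d + 1)) (i : Fin T.numFaces)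
    {f : E (d + 1) → ℝ} (hf : Continuous f) : IntegrableOn f (T.face i)
      (Measure.euclideanHausdorffMeasure d : Measure (E (d + 1))) := by
  obtain ⟨χ⟩ := T.nonempty_faceChart i
  have hemb : MeasurableEmbedding χ := χ.isometry.isClosedEmbedding.measurableEmbedding
  have h1 : IntegrableOn (f ∘ χ) (χ ⁻¹' T.face i) volume :=
    ContinuousOn.integrableOn_compact
      (χ.isometry.isClosedEmbedding.isCompact_preimage (T.isCompact_face i)) (by fun_prop)
  rw [← EuclideanSpace.euclideanHausdorffMeasure_eq_volume d, ← hemb.integrableOn_map_iff,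
    χ.isometry.map_euclideanHausdorffMeasure, IntegrableOn, Measure.restrict_restrict
    (T.isClosed_face i).measurableSet, Set.inter_eq_left.2 χ.face_subset_range] at h1
  exact h1

theorem faceIntegral_eq {T : ConvexPolytope (m + 1)} {i : Fin T.numFaces} (χ : T.FaceChart i)
    (f : E (m + 1) → ℝ) : T.faceIntegral i f = ∫ y in χ ⁻¹' T.face i, f (χ y) :=
  setIntegral_hausdorff_eq χ.incl χ.base χ.face_subset_range (T.isClosed_face i).measurableSet f

/-- `d |T| = ∑ dist(b, e) |e|`. -/
theorem sum_slack_mul_area (T : ConvexPolytope (m + 1)) (b : E (m + 1)) :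
    ∑ i, T.slack i b *
      (Measure.euclideanHausdorffMeasure m : Measure (E (m + 1))).real (T.face i) =
        (m + 1) * (volume : Measure (E (m + 1))).real T.carrier := by
  -- The divergence theorem for the field `x - b`, whose normal component on face `i` is the
  -- constant `slack i b`.
  have h : ∀ l, (volume : Measure (E (m + 1))).real T.carrier = ∑ i, T.normal i l *
      T.faceIntegral i (peval (MvPolynomial.X l - MvPolynomial.C (b l))) := by
    intro l
    rw [← T.integral_pderiv]
    have h1 : peval (MvPolynomial.pderiv l (MvPolynomial.X l - MvPolynomial.C (b l))) =
        fun _ : E (m + 1) => (1 : ℝ) := by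
      ext x; simp [peval]
    rw [h1, ConvexPolytope.integral, setIntegral_const, smul_eq_mul, mul_one]
  have h2 : ((m + 1 : ℕ) : ℝ) * (volume : Measure (E (m + 1))).real T.carrier = ∑ l, ∑ i,
      T.normal i l * T.faceIntegral i (peval (MvPolynomial.X l - MvPolynomial.C (b l))) := by
    rw [← Finset.sum_congr rfl fun l _ => h l]
    simp
  rw [Finset.sum_comm] at h2
  push_cast at h2
  rw [h2]
  refine Finset.sum_congr rfl fun i _ => ?_
  have h3 : ∀ l, T.normal i l *
      T.faceIntegral i (peval (MvPolynomial.X l - MvPolynomial.C (b l))) = ∫ x in T.face i,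
        T.normal i l * (x l - b l) ∂(Measure.euclideanHausdorffMeasure m) := by
    intro l
    rw [integral_const_mul]
    congr 1
    refine setIntegral_congr_fun (T.isClosed_face i).measurableSet fun x _ => ?_
    simp
  rw [Finset.sum_congr rfl fun l _ => h3 l, ← integral_finsetSum]
  · have h4 : ∫ x in T.face i, (∑ l, T.normal i l * (x l - b l))
        ∂(Measure.euclideanHausdorffMeasure m) = ∫ x in T.face i, T.slack i b
        ∂(Measure.euclideanHausdorffMeasure m) := by
      refine setIntegral_congr_fun (T.isClosed_face i).measurableSet fun x hx => ?_
      have h5 := (T.mem_face_iff.1 hx).2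
      have h6 := T.slack_add i b (x - b)
      rw [add_sub_cancel, h5] at h6
      have h7 : ⟪T.normal i, x - b⟫ = ∑ l, T.normal i l * (x l - b l) := by
        simp [PiLp.inner_apply, mul_comm]
      simp only
      rw [← h7]; linarith
    rw [h4, setIntegral_const, smul_eq_mul, mul_comm]
  · intro l _
    exact T.continuousOn_integrableOn_face i (by fun_prop)

theorem volume_le (T : ConvexPolytope (m + 1)) {b : E (m + 1)} (hb : b ∈ T.carrier) :
    (volume : Measure (E (m + 1))).real T.carrier ≤
      (volume : Measure (E (m + 1))).real (Metric.ball 0 1) * Metric.diam T.carrier ^ (m + 1) := by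
  have h1 : T.carrier ⊆ Metric.closedBall b (Metric.diam T.carrier) := fun x hx =>
    T.dist_le_diam hx hb
  refine (measureReal_mono h1 measure_closedBall_lt_top.ne).trans (le_of_eq ?_)
  rw [Measure.real, Measure.addHaar_closedBall _ _ Metric.diam_nonneg, ENNReal.toReal_mul,
    ENNReal.toReal_ofReal (by positivity), mul_comm]
  simp [Measure.real]

theorem mem_face_of_mem_carrier {T : ConvexPolytope (m + 1)} {i : Fin T.numFaces}
    (χ : T.FaceChart i) {y : E m} : χ y ∈ T.face i ↔ ∀ l, 0 ≤ T.slack l (χ y) := by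
  rw [mem_face_iff, mem_carrier_iff, and_iff_left (χ.slack_self y)]

theorem convex_preimage_face {T : ConvexPolytope (m + 1)} {i : Fin T.numFaces}
    (χ : T.FaceChart i) : Convex ℝ (χ ⁻¹' T.face i) := by
  intro x hx y hy a b ha hb hab
  rw [Set.mem_preimage, mem_face_of_mem_carrier] at *
  intro l
  have : T.slack l (χ (a • x + b • y)) = a * T.slack l (χ x) + b * T.slack l (χ y) := by
    have h1 := χ.slack_apply_add l 0
    simp only [zero_add] at h1
    rw [h1 x, h1 y, h1 (a • x + b • y), inner_add_right, inner_smul_right, inner_smul_right]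
    linear_combination (-T.slack l (χ 0)) * hab
  rw [this]
  have := hx l; have := hy l
  positivity

/-- The quantitative form of shape regularity used in the estimates: at most `N` faces, a ball in
the interior and a ball in each face, both of radius comparable to the diameter and away from the
hyperplanes of the (other) faces. -/
structure IsFat (T : ConvexPolytope (m + 1)) (N : ℕ) (r : ℝ) : Prop where
  numFaces_le : T.numFaces ≤ N
  inner : ∃ b ∈ T.carrier, ∀ x ∈ Metric.closedBall b (r * Metric.diam T.carrier),
    x ∈ T.carrier ∧ ∀ i, r * Metric.diam T.carrier ≤ T.slack i x
  face : ∀ i (χ : T.FaceChart i), ∃ y₀, ∀ y ∈ Metric.closedBall y₀ (r * Metric.diam T.carrier),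
    χ y ∈ T.face i ∧ ∀ j ≠ i, r * Metric.diam T.carrier ≤ T.slack j (χ y)

theorem volume_ball_pos (m : ℕ) : 0 < (volume : Measure (E m)).real (Metric.ball 0 1) :=
  ENNReal.toReal_pos (Metric.measure_ball_pos _ _ one_pos).ne' measure_ball_lt_top.ne

theorem sin_sq_le_of_neighbors {T : ConvexPolytope (m + 1)} {ρv ρe κ α₀ : ℝ}
    (hα₀ : 0 < α₀) (hT : T.ShapeRegular ρv ρe κ α₀) {i l : Fin T.numFaces} (h : T.Neighbors i l) :
    Real.sin (min α₀ (Real.pi / 2)) ^ 2 ≤ 1 - ⟪T.normal i, T.normal l⟫ ^ 2 := by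
  obtain ⟨h1, h2⟩ := hT.angle i l h
  set θ := InnerProductGeometry.angle (T.normal i) (T.normal l) with hθ
  have hcos : Real.cos θ = ⟪T.normal i, T.normal l⟫ := by
    rw [hθ, InnerProductGeometry.cos_angle, T.norm_normal, T.norm_normal]; simp
  rw [← hcos, ← Real.sin_sq]
  -- The existence of a neighbouring pair makes the interval of admissible angles nonempty. The
  -- minimum in the statement keeps the constant positive when there is no such pair.
  have hα : α₀ ≤ Real.pi / 2 := by linarith
  rw [min_eq_left hα]
  have hpos : 0 ≤ Real.sin α₀ := Real.sin_nonneg_of_nonneg_of_le_pi hα₀.le (by linarith)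
  refine pow_le_pow_left₀ hpos ?_ 2
  rcases le_total θ (Real.pi / 2) with h3 | h3
  · exact Real.sin_le_sin_of_le_of_le_pi_div_two (by linarith) h3 (by linarith)
  · rw [← Real.sin_pi_sub θ]
    exact Real.sin_le_sin_of_le_of_le_pi_div_two (by linarith) (by linarith) (by linarith)

theorem exists_inner_ball {ρv ρe κ α₀ : ℝ} (hρv : 0 < ρv) {T : ConvexPolytope (m + 1)}
    (hT : T.ShapeRegular ρv ρe κ α₀) {r : ℝ}
    (hr : r = ρv / (12 * (volume : Measure (E m)).real (Metric.ball 0 1))) :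
    ∃ b ∈ T.carrier, ∀ x ∈ Metric.closedBall b (r * Metric.diam T.carrier),
      x ∈ T.carrier ∧ ∀ i, r * Metric.diam T.carrier ≤ T.slack i x := by
  have hω := volume_ball_pos m
  have hh := T.diam_pos
  have hr0 : 0 < r := by rw [hr]; positivity
  obtain ⟨b, hb⟩ := exists_ball_subset T.convex_carrier T.isCompact_carrier hρv hh
    (fun x hx y hy => T.dist_le_diam hx hy) hT.volume_ge
  -- Half of the available radius is given up, so that points of the smaller ball keep that distance
  -- from all faces.
  have hr2 : ρv / (6 * (volume : Measure (E m)).real (Metric.ball 0 1)) = 2 * r := by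
    rw [hr]; field_simp; norm_num
  rw [hr2] at hb
  have hrh : 0 < r * Metric.diam T.carrier := by positivity
  refine ⟨b, hb (Metric.mem_ball_self (by positivity)), fun x hx => ?_⟩
  have hsub : Metric.ball x (r * Metric.diam T.carrier) ⊆ T.carrier := fun z hz => hb (by
    rw [Metric.mem_ball] at *
    rw [Metric.mem_closedBall] at hx
    have := dist_triangle z x b
    linarith)
  exact ⟨hsub (Metric.mem_ball_self hrh), T.slack_ge_of_ball_subset hrh hsub⟩

/-- In `d |T| = ∑ dist(b, e) |e|` every summand is at least a fixed multiple of `h_T ^ d`, while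
`|T|` is at most the volume of a ball of radius `h_T`. -/
theorem numFaces_le_of_inner_ball {ρv ρe κ α₀ : ℝ} (hρe : 0 < ρe) (hκ : 0 < κ)
    {T : ConvexPolytope (m + 1)} (hT : T.ShapeRegular ρv ρe κ α₀) {r : ℝ} (hr : 0 < r)
    {b : E (m + 1)} (hb : b ∈ T.carrier) (hbr : ∀ i, r * Metric.diam T.carrier ≤ T.slack i b) :
    (T.numFaces : ℝ) ≤ (m + 1) * (volume : Measure (E (m + 1))).real (Metric.ball 0 1) /
      (r * (ρe * κ ^ m)) := by
  have hh := T.diam_pos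
  set h := Metric.diam T.carrier
  have h1 := T.sum_slack_mul_area b
  have harea : ∀ i, ρe * (κ * h) ^ m ≤
      (Measure.euclideanHausdorffMeasure m : Measure (E (m + 1))).real (T.face i) := fun i => by
    have hA := hT.area_ge i
    simp only [Nat.add_sub_cancel] at hA
    refine le_trans ?_ hA
    gcongr
    exact hT.diam_face_ge i
  have h2 : (T.numFaces : ℝ) * (r * h * (ρe * (κ * h) ^ m)) ≤ ∑ i, T.slack i b *
      (Measure.euclideanHausdorffMeasure m : Measure (E (m + 1))).real (T.face i) := by
    have : (T.numFaces : ℝ) * (r * h * (ρe * (κ * h) ^ m)) =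
        ∑ _i : Fin T.numFaces, (r * h * (ρe * (κ * h) ^ m)) := by simp
    rw [this]
    exact Finset.sum_le_sum fun i _ => mul_le_mul (hbr i) (harea i) (by positivity)
      (T.mem_carrier_iff.1 hb i)
  rw [h1] at h2
  have h3 := T.volume_le hb
  rw [le_div_iff₀ (by positivity)]
  have h4 : (T.numFaces : ℝ) * (r * (ρe * κ ^ m)) * h ^ (m + 1) ≤
      (m + 1) * (volume : Measure (E (m + 1))).real (Metric.ball 0 1) * h ^ (m + 1) := by
    calc _ = (T.numFaces : ℝ) * (r * h * (ρe * (κ * h) ^ m)) := by ring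
      _ ≤ (m + 1) * (volume : Measure (E (m + 1))).real T.carrier := h2
      _ ≤ (m + 1) * ((volume : Measure (E (m + 1))).real (Metric.ball 0 1) * h ^ (m + 1)) := by
        gcongr
      _ = _ := by ring
  exact le_of_mul_le_mul_right h4 (by positivity)

theorem exists_isFat (m : ℕ) {ρv ρe κ α₀ : ℝ} (hρv : 0 < ρv) (hρe : 0 < ρe) (hκ : 0 < κ)
    (hα₀ : 0 < α₀) : ∃ (N : ℕ) (r : ℝ), 0 < r ∧ ∀ T : ConvexPolytope (m + 1 + 1),
      T.ShapeRegular ρv ρe κ α₀ → T.IsFat N r := by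
  set r₀ := ρv / (12 * (volume : Measure (E (m + 1))).real (Metric.ball 0 1)) with hr₀
  have hω := volume_ball_pos (m + 1)
  have hω' := volume_ball_pos m
  have hr₀0 : 0 < r₀ := by positivity
  set r₁ := ρe / (6 * (volume : Measure (E m)).real (Metric.ball 0 1)) * κ with hr₁
  have hr₁0 : 0 < r₁ := by positivity
  set s₀ := Real.sin (min α₀ (Real.pi / 2)) with hs₀
  have hs₀0 : 0 < s₀ := Real.sin_pos_of_pos_of_lt_pi
    (lt_min hα₀ (by positivity)) ((min_le_right _ _).trans_lt (by linarith [Real.pi_pos]))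
  -- The lower bound of `slack_ge_of_ball` divided by the diameter, for `R = r₁ h` and `r = r₀ h`.
  set δ := min (r₁ / 2) (min (r₀ / (2 * (1 + 1 / r₁))) (s₀ * r₁ / 6)) with hδ
  have hδ0 : 0 < δ := by positivity
  obtain ⟨N, hN⟩ := exists_nat_ge ((m + 1 + 1) *
    (volume : Measure (E (m + 1 + 1))).real (Metric.ball 0 1) / (r₀ * (ρe * κ ^ (m + 1))))
  refine ⟨N, min r₀ (min (r₁ / 4) (δ / 2)), by positivity, fun T hT => ?_⟩
  have hh := T.diam_pos
  set h := Metric.diam T.carrier with hhd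
  obtain ⟨b, hb, hbr⟩ := exists_inner_ball hρv hT hr₀
  have hbb := (hbr b (Metric.mem_closedBall_self (by positivity))).2
  have hle1 : min r₀ (min (r₁ / 4) (δ / 2)) * h ≤ r₀ * h := by gcongr; exact min_le_left _ _
  have hle2 : min r₀ (min (r₁ / 4) (δ / 2)) * h ≤ r₁ / 4 * h := by
    gcongr; exact (min_le_right _ _).trans (min_le_left _ _)
  have hle3 : min r₀ (min (r₁ / 4) (δ / 2)) * h ≤ δ / 2 * h := by
    gcongr; exact (min_le_right _ _).trans (min_le_right _ _)
  refine ⟨?_, ⟨b, hb, fun x hx => ?_⟩, fun i χ => ?_⟩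
  · have h1 := numFaces_le_of_inner_ball hρe hκ hT hr₀0 hb hbb
    push_cast at h1
    exact_mod_cast h1.trans hN
  · obtain ⟨h1, h2⟩ := hbr x (Metric.closedBall_subset_closedBall hle1 hx)
    exact ⟨h1, fun i => hle1.trans (h2 i)⟩
  · have hhe : 0 < Metric.diam (T.face i) := lt_of_lt_of_le (by positivity) (hT.diam_face_ge i)
    have harea := hT.area_ge i
    obtain ⟨y₀, hy₀⟩ := exists_ball_subset (convex_preimage_face χ)
      (χ.isometry.isClosedEmbedding.isCompact_preimage (T.isCompact_face i)) hρe hhe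
      (fun x hx y hy => by
        rw [← χ.isometry.dist_eq]
        exact Metric.dist_le_diam_of_mem (T.isCompact_face i).isBounded hx hy)
      (harea.trans (le_of_eq (hausdorff_real_eq χ.incl χ.base χ.face_subset_range)))
    have hball : ∀ y ∈ Metric.ball y₀ (r₁ * h), χ y ∈ T.face i := fun y hy => hy₀ (by
      refine Metric.ball_subset_ball ?_ hy
      rw [hr₁, mul_assoc]
      gcongr
      exact hT.diam_face_ge i)
    refine ⟨y₀, fun y hy => ?_⟩
    have hy' : ‖y - y₀‖ ≤ r₁ / 4 * h := by
      rw [mem_closedBall_iff_norm] at hy; exact hy.trans hle2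
    have hrh : 0 < r₁ * h := by positivity
    refine ⟨hball y (by rw [mem_ball_iff_norm]; linarith), fun j hj => ?_⟩
    have h1 := slack_ge_of_ball χ hrh hball
      (fun l hl => sin_sq_le_of_neighbors hα₀ hT hl) hb hbb (by positivity)
      (fun x hx y hy => T.dist_le_diam hx hy) hj
    have h2 : δ * h ≤ T.slack j (χ y₀) := by
      refine le_trans (le_of_eq ?_) h1
      rw [hδ, min_mul_of_nonneg _ _ hh.le, min_mul_of_nonneg _ _ hh.le]
      congr 1
      · ring
      · congr 1
        · rw [← hhd]; field_simp
        · ring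
    have h3 := χ.slack_apply_add j y₀ (y - y₀)
    rw [add_sub_cancel] at h3
    -- The slack is affine and nonnegative at `y₀ + 2 (y - y₀)`, so at the midpoint `y` it is at
    -- least half its value at `y₀`.
    have h4 := χ.slack_apply_add j y₀ ((2 : ℝ) • (y - y₀))
    have h5 := T.mem_carrier_iff.1 (hball (y₀ + (2 : ℝ) • (y - y₀)) (by
      rw [mem_ball_iff_norm, add_sub_cancel_left, norm_smul, Real.norm_of_nonneg (by norm_num)]
      linarith)).1 j
    rw [h4, inner_smul_right] at h5
    refine hle3.trans ?_
    linarith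

end ConvexPolytope

/-! ### Bubble weights, trace inequality and extension from faces -/

namespace ConvexPolytope

theorem IsFat.mono {m : ℕ} {T : ConvexPolytope (m + 1)} {N : ℕ} {r r' : ℝ} (h : T.IsFat N r)
    (hr : r' ≤ r) : T.IsFat N r' := by
  have hle : r' * Metric.diam T.carrier ≤ r * Metric.diam T.carrier :=
    mul_le_mul_of_nonneg_right hr Metric.diam_nonneg
  refine ⟨h.numFaces_le, ?_, fun i χ => ?_⟩
  · obtain ⟨b, hb, hb'⟩ := h.inner
    refine ⟨b, hb, fun x hx => ?_⟩
    obtain ⟨h1, h2⟩ := hb' x (Metric.closedBall_subset_closedBall hle hx)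
    exact ⟨h1, fun i => hle.trans (h2 i)⟩
  · obtain ⟨y, hy⟩ := h.face i χ
    refine ⟨y, fun z hz => ?_⟩
    obtain ⟨h1, h2⟩ := hy z (Metric.closedBall_subset_closedBall hle hz)
    exact ⟨h1, fun i hi => hle.trans (h2 i hi)⟩

section Bubble

variable {d : ℕ} (T : ConvexPolytope d)

/-- The product of the scaled distances to the hyperplanes of some of the faces. -/
noncomputable def bubble (s : Finset (Fin T.numFaces)) : MvPolynomial (Fin d) ℝ :=
  ∏ i ∈ s, affinePoly ((Metric.diam T.carrier)⁻¹ * T.offset i)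
    ((Metric.diam T.carrier)⁻¹ • T.normal i)

theorem peval_bubble (s : Finset (Fin T.numFaces)) (x : E d) :
    peval (T.bubble s) x = ∏ i ∈ s, T.slack i x / Metric.diam T.carrier := by
  rw [bubble, peval_prod]
  refine Finset.prod_congr rfl fun i _ => ?_
  rw [peval_affinePoly, real_inner_smul_left, slack]
  ring

theorem totalDegree_bubble (s : Finset (Fin T.numFaces)) : (T.bubble s).totalDegree ≤ s.card :=
  totalDegree_finsetProd_le_card s _ fun _ _ => totalDegree_affinePoly _ _

theorem bubble_insert {i : Fin T.numFaces} {s : Finset (Fin T.numFaces)} (hi : i ∉ s) (x : E d) :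
    peval (T.bubble (insert i s)) x =
      T.slack i x / Metric.diam T.carrier * peval (T.bubble s) x := by
  rw [peval_bubble, peval_bubble, Finset.prod_insert hi]

theorem bubble_nonneg (s : Finset (Fin T.numFaces)) {x : E d} (hx : x ∈ T.carrier) :
    0 ≤ peval (T.bubble s) x := by
  rw [peval_bubble]
  exact Finset.prod_nonneg fun i _ => div_nonneg (T.mem_carrier_iff.1 hx i) Metric.diam_nonneg

theorem bubble_eq_zero {s : Finset (Fin T.numFaces)} {i : Fin T.numFaces} (hi : i ∈ s) {x : E d}
    (hx : x ∈ T.face i) : peval (T.bubble s) x = 0 := by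
  rw [peval_bubble]
  exact Finset.prod_eq_zero hi (by rw [(T.mem_face_iff.1 hx).2, zero_div])

end Bubble

variable {m : ℕ} (T : ConvexPolytope (m + 1))

theorem bubble_le_one (s : Finset (Fin T.numFaces)) {x : E (m + 1)} (hx : x ∈ T.carrier) :
    peval (T.bubble s) x ≤ 1 := by
  rw [peval_bubble]
  exact Finset.prod_le_one
    (fun i _ => div_nonneg (T.mem_carrier_iff.1 hx i) Metric.diam_nonneg)
    fun i _ => (div_le_one T.diam_pos).2 (T.slack_le_diam i hx)

theorem pow_le_bubble {N : ℕ} (hN : T.numFaces ≤ N) {s : Finset (Fin T.numFaces)} {r : ℝ}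
    (hr : 0 < r) (hr1 : r ≤ 1) {x : E (m + 1)}
    (h : ∀ i ∈ s, r * Metric.diam T.carrier ≤ T.slack i x) : r ^ N ≤ peval (T.bubble s) x := by
  rw [peval_bubble]
  have hcard : s.card ≤ N := (Finset.card_le_univ s).trans (by simpa using hN)
  calc r ^ N ≤ r ^ s.card := pow_le_pow_of_le_one hr.le hr1 hcard
    _ = ∏ _i ∈ s, r := by simp
    _ ≤ _ := Finset.prod_le_prod (fun _ _ => hr.le)
        fun i hi => (le_div_iff₀ T.diam_pos).2 (h i hi)

theorem integrableOn_carrier {f : E (m + 1) → ℝ} (hf : Continuous f) :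
    IntegrableOn f T.carrier volume :=
  ContinuousOn.integrableOn_compact T.isCompact_carrier hf.continuousOn

theorem integral_mono {f g : E (m + 1) → ℝ} (hf : Continuous f) (hg : Continuous g)
    (h : ∀ x ∈ T.carrier, f x ≤ g x) : T.integral f ≤ T.integral g :=
  setIntegral_mono_on (T.integrableOn_carrier hf) (T.integrableOn_carrier hg)
    T.isClosed_carrier.measurableSet h

theorem faceIntegral_mono (i : Fin T.numFaces) {f g : E (m + 1) → ℝ} (hf : Continuous f)
    (hg : Continuous g) (h : ∀ x ∈ T.face i, f x ≤ g x) :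
    T.faceIntegral i f ≤ T.faceIntegral i g :=
  setIntegral_mono_on (T.continuousOn_integrableOn_face i hf)
    (T.continuousOn_integrableOn_face i hg) (T.isClosed_face i).measurableSet h

theorem faceIntegral_congr (i : Fin T.numFaces) {f g : E (m + 1) → ℝ}
    (h : ∀ x ∈ T.face i, f x = g x) : T.faceIntegral i f = T.faceIntegral i g :=
  setIntegral_congr_fun (T.isClosed_face i).measurableSet h

theorem setIntegral_le_mul_of_subset_closedBall {n : ℕ} {S : Set (E n)} (hS : IsCompact S)
    {c : E n} {h A : ℝ} (hh : 0 ≤ h) (hA : 0 ≤ A) (hsub : S ⊆ Metric.closedBall c h)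
    {f : E n → ℝ} (hf : Continuous f) (hfA : ∀ x ∈ S, f x ≤ A) :
    ∫ x in S, f x ≤ (volume : Measure (E n)).real (Metric.ball 0 1) * h ^ n * A := by
  have h1 : ∫ x in S, f x ≤ ∫ _x in S, A :=
    setIntegral_mono_on (ContinuousOn.integrableOn_compact hS hf.continuousOn)
      (integrableOn_const hS.measure_lt_top.ne) hS.isClosed.measurableSet hfA
  rw [setIntegral_const, smul_eq_mul] at h1
  refine h1.trans (mul_le_mul_of_nonneg_right ?_ hA)
  refine (measureReal_mono hsub measure_closedBall_lt_top.ne).trans (le_of_eq ?_)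
  rw [Measure.real, Measure.addHaar_closedBall _ _ hh, ENNReal.toReal_mul,
    ENNReal.toReal_ofReal (by positivity), mul_comm]
  simp [Measure.real]

/-- The element lies in a ball of radius `h_T` about the inner centre, and on the concentric ball of
radius `r h_T` the weight is at least `r ^ N`; the scaled norm equivalence connects the two balls.
-/
theorem exists_sup_le_integral_bubble (m N K : ℕ) {r : ℝ} (hr : 0 < r) (hr1 : r ≤ 1) :
    ∃ C, 0 < C ∧ ∀ T : ConvexPolytope (m + 1), T.IsFat N r → ∀ p : MvPolynomial (Fin (m + 1)) ℝ,
      p.totalDegree ≤ K → ∀ x ∈ T.carrier, Metric.diam T.carrier ^ (m + 1) * peval p x ^ 2 ≤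
        C * T.integral (fun x => peval p x ^ 2 * peval (T.bubble Finset.univ) x) := by
  obtain ⟨C, hC, H⟩ := exists_sup_le_integral (m + 1) K hr
  refine ⟨C * (r ^ N)⁻¹, by positivity, fun T hT p hp x hx => ?_⟩
  obtain ⟨b, hb, hb'⟩ := hT.inner
  refine (H p hp b _ T.diam_pos x (T.dist_le_diam hx hb)).trans ?_
  rw [mul_assoc]
  refine mul_le_mul_of_nonneg_left ?_ hC.le
  have hint : IntegrableOn (fun x => peval p x ^ 2 * peval (T.bubble Finset.univ) x)
      T.carrier volume := T.integrableOn_carrier (by fun_prop)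
  have hsub : Metric.closedBall b (r * Metric.diam T.carrier) ⊆ T.carrier := fun z hz =>
    (hb' z hz).1
  rw [le_inv_mul_iff₀ (by positivity), ← integral_const_mul]
  calc _ ≤ ∫ x in Metric.closedBall b (r * Metric.diam T.carrier),
        peval p x ^ 2 * peval (T.bubble Finset.univ) x := by
        refine setIntegral_mono_on (ContinuousOn.integrableOn_compact (isCompact_closedBall _ _)
          (by fun_prop)) (hint.mono_set hsub) measurableSet_closedBall fun z hz => ?_
        rw [mul_comm]
        exact mul_le_mul_of_nonneg_left
          (T.pow_le_bubble hT.numFaces_le hr hr1 fun i _ => (hb' z hz).2 i) (sq_nonneg _)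
    _ ≤ _ := by
        refine setIntegral_mono_set hint ?_ hsub.eventuallyLE
        filter_upwards [ae_restrict_mem T.isClosed_carrier.measurableSet] with z hz
        exact mul_nonneg (sq_nonneg _) (T.bubble_nonneg _ hz)

theorem integral_mul_bubble_le (p : MvPolynomial (Fin (m + 1)) ℝ) (s : Finset (Fin T.numFaces)) :
    T.integral (fun x => peval p x ^ 2 * peval (T.bubble s) x) ≤
      T.integral (fun x => peval p x ^ 2) :=
  T.integral_mono (by fun_prop) (by fun_prop) fun _ hx =>
    mul_le_of_le_one_right (sq_nonneg _) (T.bubble_le_one _ hx)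

/-- Norm equivalence with a weight that vanishes on the boundary. -/
theorem exists_integral_le_integral_bubble (m N K : ℕ) {r : ℝ} (hr : 0 < r) (hr1 : r ≤ 1) :
    ∃ C, 0 < C ∧ ∀ T : ConvexPolytope (m + 1), T.IsFat N r → ∀ p : MvPolynomial (Fin (m + 1)) ℝ,
      p.totalDegree ≤ K → T.integral (fun x => peval p x ^ 2) ≤
        C * T.integral (fun x => peval p x ^ 2 * peval (T.bubble Finset.univ) x) := by
  obtain ⟨C, hC, H⟩ := exists_sup_le_integral_bubble m N K hr hr1
  have hω := volume_ball_pos (m + 1)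
  refine ⟨(volume : Measure (E (m + 1))).real (Metric.ball 0 1) * C, by positivity,
    fun T hT p hp => ?_⟩
  obtain ⟨b, hb, -⟩ := hT.inner
  have hh := T.diam_pos
  have hI : 0 ≤ T.integral (fun x => peval p x ^ 2 * peval (T.bubble Finset.univ) x) :=
    setIntegral_nonneg T.isClosed_carrier.measurableSet fun x hx =>
      mul_nonneg (sq_nonneg _) (T.bubble_nonneg _ hx)
  refine (setIntegral_le_mul_of_subset_closedBall T.isCompact_carrier hh.le
    (A := (Metric.diam T.carrier ^ (m + 1))⁻¹ * (C * T.integral (fun x => peval p x ^ 2 *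
      peval (T.bubble Finset.univ) x))) (by positivity) (fun x hx => T.dist_le_diam hx hb)
    (by fun_prop) fun x hx => ?_).trans (le_of_eq ?_)
  · rw [le_inv_mul_iff₀ (by positivity)]; exact H T hT p hp x hx
  · field_simp

theorem isCompact_preimage_face {T : ConvexPolytope (m + 1)} {i : Fin T.numFaces}
    (χ : T.FaceChart i) : IsCompact (χ ⁻¹' T.face i) :=
  χ.isometry.isClosedEmbedding.isCompact_preimage (T.isCompact_face i)

theorem preimage_face_subset_closedBall {T : ConvexPolytope (m + 1)} {i : Fin T.numFaces}
    (χ : T.FaceChart i) {y₀ : E m} (h : χ y₀ ∈ T.face i) :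
    χ ⁻¹' T.face i ⊆ Metric.closedBall y₀ (Metric.diam T.carrier) := fun y hy => by
  rw [Metric.mem_closedBall, ← χ.isometry.dist_eq]
  exact T.dist_le_diam (T.face_subset_carrier i hy) (T.face_subset_carrier i h)

/-- The trace inequality for polynomials. -/
theorem exists_trace_inequality (m N K : ℕ) {r : ℝ} (hr : 0 < r) (hr1 : r ≤ 1) :
    ∃ C, 0 < C ∧ ∀ T : ConvexPolytope (m + 1), T.IsFat N r → ∀ p : MvPolynomial (Fin (m + 1)) ℝ,
      p.totalDegree ≤ K → ∀ i, Metric.diam T.carrier * T.faceIntegral i (fun x => peval p x ^ 2) ≤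
        C * T.integral (fun x => peval p x ^ 2) := by
  obtain ⟨C, hC, H⟩ := exists_sup_le_integral_bubble m N K hr hr1
  have hω := volume_ball_pos m
  refine ⟨(volume : Measure (E m)).real (Metric.ball 0 1) * C, by positivity,
    fun T hT p hp i => ?_⟩
  obtain ⟨χ⟩ := T.nonempty_faceChart i
  obtain ⟨y₀, hy₀⟩ := hT.face i χ
  have hh := T.diam_pos
  have hy₀f := (hy₀ y₀ (Metric.mem_closedBall_self (by positivity))).1
  have hI : 0 ≤ T.integral (fun x => peval p x ^ 2) :=
    setIntegral_nonneg T.isClosed_carrier.measurableSet fun x _ => sq_nonneg _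
  rw [faceIntegral_eq χ, ← le_div_iff₀' hh]
  refine (setIntegral_le_mul_of_subset_closedBall (isCompact_preimage_face χ) hh.le
    (A := (Metric.diam T.carrier ^ (m + 1))⁻¹ * (C * T.integral (fun x => peval p x ^ 2)))
    (by positivity) (preimage_face_subset_closedBall χ hy₀f) (by fun_prop) fun y hy => ?_).trans
    (le_of_eq ?_)
  · rw [le_inv_mul_iff₀ (by positivity)]
    exact (H T hT p hp _ (T.face_subset_carrier i hy)).trans
      (mul_le_mul_of_nonneg_left (T.integral_mul_bubble_le _ _) hC.le)
  · field_simp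
    ring

/-- Extension of a polynomial from a face, constant in the normal direction; both the extension and
the polynomial on the face are controlled by a weighted norm on the face. -/
theorem exists_face_extension (m N K : ℕ) {r : ℝ} (hr : 0 < r) (hr1 : r ≤ 1) :
    ∃ C, 0 < C ∧ ∀ T : ConvexPolytope (m + 1), T.IsFat N r → ∀ p : MvPolynomial (Fin (m + 1)) ℝ,
      p.totalDegree ≤ K → ∀ i, ∃ q : MvPolynomial (Fin (m + 1)) ℝ, q.totalDegree ≤ K ∧
        (∀ x ∈ T.face i, peval q x = peval p x) ∧
        T.integral (fun x => peval q x ^ 2) ≤ C * Metric.diam T.carrier * T.faceIntegral i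
          (fun x => peval p x ^ 2 * peval (T.bubble (Finset.univ.erase i)) x) ∧
        T.faceIntegral i (fun x => peval p x ^ 2) ≤ C * T.faceIntegral i
          (fun x => peval p x ^ 2 * peval (T.bubble (Finset.univ.erase i)) x) := by
  obtain ⟨C, hC, H⟩ := exists_sup_le_integral m K hr
  have hω := volume_ball_pos m
  have hω' := volume_ball_pos (m + 1)
  set A := C * (r ^ N)⁻¹ with hA
  have hA0 : 0 < A := by positivity
  refine ⟨((volume : Measure (E m)).real (Metric.ball 0 1) +
    (volume : Measure (E (m + 1))).real (Metric.ball 0 1)) * A, by positivity,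
    fun T hT p hp i => ?_⟩
  obtain ⟨χ⟩ := T.nonempty_faceChart i
  obtain ⟨y₀, hy₀⟩ := hT.face i χ
  have hh := T.diam_pos
  set h := Metric.diam T.carrier with hhd
  have hy₀f := (hy₀ y₀ (Metric.mem_closedBall_self (by positivity))).1
  obtain ⟨q, hq, hqe⟩ := exists_peval_comp_affine χ.base χ.incl.toLinearMap p
  have hqe' : ∀ y, peval q y = peval p (χ y) := hqe
  set X := T.faceIntegral i (fun x => peval p x ^ 2 * peval (T.bubble (Finset.univ.erase i)) x)
    with hX
  have hX0 : 0 ≤ X := setIntegral_nonneg (T.isClosed_face i).measurableSet fun x hx =>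
    mul_nonneg (sq_nonneg _) (T.bubble_nonneg _ (T.face_subset_carrier i hx))
  have hsup : ∀ y ∈ Metric.closedBall y₀ h, h ^ m * peval q y ^ 2 ≤ A * X := by
    intro y hy
    refine (H q (hq.trans hp) y₀ h hh y hy).trans ?_
    rw [hA, mul_assoc]
    refine mul_le_mul_of_nonneg_left ?_ hC.le
    rw [le_inv_mul_iff₀ (by positivity), ← integral_const_mul, hX, faceIntegral_eq χ]
    have hint : IntegrableOn (fun y => peval p (χ y) ^ 2 *
        peval (T.bubble (Finset.univ.erase i)) (χ y)) (χ ⁻¹' T.face i) volume :=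
      ContinuousOn.integrableOn_compact (isCompact_preimage_face χ) (by fun_prop)
    have hsub : Metric.closedBall y₀ (r * h) ⊆ χ ⁻¹' T.face i := fun z hz => (hy₀ z hz).1
    calc _ ≤ ∫ y in Metric.closedBall y₀ (r * h), peval p (χ y) ^ 2 *
        peval (T.bubble (Finset.univ.erase i)) (χ y) := by
          refine setIntegral_mono_on (ContinuousOn.integrableOn_compact (isCompact_closedBall _ _)
            (by fun_prop)) (hint.mono_set hsub) measurableSet_closedBall fun z hz => ?_
          rw [mul_comm, hqe']
          exact mul_le_mul_of_nonneg_left (T.pow_le_bubble hT.numFaces_le hr hr1 fun j hj =>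
            (hy₀ z hz).2 j (Finset.ne_of_mem_erase hj)) (sq_nonneg _)
      _ ≤ _ := by
          refine setIntegral_mono_set hint ?_ hsub.eventuallyLE
          filter_upwards [ae_restrict_mem (isCompact_preimage_face χ).isClosed.measurableSet]
            with z hz
          exact mul_nonneg (sq_nonneg _) (T.bubble_nonneg _ (T.face_subset_carrier i hz))
  have hsup' : ∀ y ∈ Metric.closedBall y₀ h, peval q y ^ 2 ≤ (h ^ m)⁻¹ * (A * X) := fun y hy => by
    rw [le_inv_mul_iff₀ (by positivity)]; exact hsup y hy
  -- Orthogonal projection onto the hyperplane. It is nonexpansive, so it sends the element into the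
  -- ball of radius `h` about `y₀`, on which the polynomial is already bounded.
  let π := LinearMap.adjoint χ.incl.toLinearMap
  have hπ : ∀ y, π (χ.incl y) = y := fun y => by
    refine ext_inner_right ℝ fun z => ?_
    rw [LinearMap.adjoint_inner_left]
    exact χ.incl.inner_map_map y z
  have hπn : ∀ x, ‖π x‖ ≤ ‖x‖ := fun x => by
    have h1 : ‖π x‖ ^ 2 ≤ ‖x‖ * ‖π x‖ := by
      rw [← real_inner_self_eq_norm_sq, LinearMap.adjoint_inner_left]
      exact (real_inner_le_norm _ _).trans (le_of_eq (by
        rw [LinearIsometry.coe_toLinearMap, χ.incl.norm_map]))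
    by_contra hlt
    push Not at hlt
    nlinarith [norm_nonneg x]
  obtain ⟨p', hp', hpe'⟩ := exists_peval_comp_affine (-π χ.base) π q
  have hpe'' : ∀ x, peval p' x = peval q (π (x - χ.base)) := fun x => by
    rw [hpe', map_sub]; congr 1; abel
  refine ⟨p', hp'.trans (hq.trans hp), fun x hx => ?_, ?_, ?_⟩
  · obtain ⟨y, rfl⟩ := χ.face_subset_range hx
    rw [hpe'', FaceChart.apply_eq, add_sub_cancel_left, hπ, hqe', FaceChart.apply_eq]
  · refine (setIntegral_le_mul_of_subset_closedBall T.isCompact_carrier hh.le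
      (A := (h ^ m)⁻¹ * (A * X)) (by positivity)
      (fun x hx => T.dist_le_diam hx (T.face_subset_carrier i hy₀f)) (by fun_prop)
      fun x hx => ?_).trans ?_
    · rw [hpe'']
      refine hsup' _ ?_
      have h1 : π (x - χ.base) - y₀ = π (x - χ y₀) := by
        rw [FaceChart.apply_eq, sub_add_eq_sub_sub, map_sub π _ (χ.incl y₀), hπ]
      rw [mem_closedBall_iff_norm, h1]
      refine (hπn _).trans ?_
      rw [← dist_eq_norm]
      exact T.dist_le_diam hx (T.face_subset_carrier i hy₀f)
    · have : (volume : Measure (E (m + 1))).real (Metric.ball 0 1) * h ^ (m + 1) *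
          ((h ^ m)⁻¹ * (A * X)) =
          (volume : Measure (E (m + 1))).real (Metric.ball 0 1) * A * h * X := by
        field_simp
        ring
      rw [this]
      gcongr
      linarith
  · rw [faceIntegral_eq χ]
    refine (setIntegral_le_mul_of_subset_closedBall (isCompact_preimage_face χ) hh.le
      (A := (h ^ m)⁻¹ * (A * X)) (by positivity)
      (preimage_face_subset_closedBall χ hy₀f) (by fun_prop) fun y hy => ?_).trans ?_
    · rw [← hqe']
      exact hsup' y (preimage_face_subset_closedBall χ hy₀f hy)
    · have : (volume : Measure (E m)).real (Metric.ball 0 1) * h ^ m * ((h ^ m)⁻¹ * (A * X)) =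
          (volume : Measure (E m)).real (Metric.ball 0 1) * A * X := by
        field_simp
      rw [this]
      gcongr
      linarith

end ConvexPolytope

/-! ### The norm equivalence on one element -/

namespace ConvexPolytope

variable {m : ℕ} (T : ConvexPolytope (m + 1))

theorem integral_add {f g : E (m + 1) → ℝ} (hf : Continuous f) (hg : Continuous g) :
    T.integral (fun x => f x + g x) = T.integral f + T.integral g :=
  MeasureTheory.integral_add (T.integrableOn_carrier hf) (T.integrableOn_carrier hg)

theorem integral_const_mul (a : ℝ) (f : E (m + 1) → ℝ) :
    T.integral (fun x => a * f x) = a * T.integral f :=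
  MeasureTheory.integral_const_mul _ _

theorem integral_sum {ι : Type*} (s : Finset ι) {f : ι → E (m + 1) → ℝ}
    (hf : ∀ i ∈ s, Continuous (f i)) :
    T.integral (fun x => ∑ i ∈ s, f i x) = ∑ i ∈ s, T.integral (f i) :=
  MeasureTheory.integral_finsetSum _ fun i hi => T.integrableOn_carrier (hf i hi)

theorem faceIntegral_add (i : Fin T.numFaces) {f g : E (m + 1) → ℝ} (hf : Continuous f)
    (hg : Continuous g) :
    T.faceIntegral i (fun x => f x + g x) = T.faceIntegral i f + T.faceIntegral i g :=
  MeasureTheory.integral_add (T.continuousOn_integrableOn_face i hf)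
    (T.continuousOn_integrableOn_face i hg)

theorem faceIntegral_const_mul (i : Fin T.numFaces) (a : ℝ) (f : E (m + 1) → ℝ) :
    T.faceIntegral i (fun x => a * f x) = a * T.faceIntegral i f :=
  MeasureTheory.integral_const_mul _ _

theorem faceIntegral_sum (i : Fin T.numFaces) {ι : Type*} (s : Finset ι)
    {f : ι → E (m + 1) → ℝ} (hf : ∀ i ∈ s, Continuous (f i)) :
    T.faceIntegral i (fun x => ∑ j ∈ s, f j x) = ∑ j ∈ s, T.faceIntegral i (f j) :=
  MeasureTheory.integral_finsetSum _ fun j hj => T.continuousOn_integrableOn_face i (hf j hj)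

theorem integral_nonneg {f : E (m + 1) → ℝ} (h : ∀ x ∈ T.carrier, 0 ≤ f x) : 0 ≤ T.integral f :=
  setIntegral_nonneg T.isClosed_carrier.measurableSet h

theorem faceIntegral_nonneg (i : Fin T.numFaces) {f : E (m + 1) → ℝ}
    (h : ∀ x ∈ T.face i, 0 ≤ f x) : 0 ≤ T.faceIntegral i f :=
  setIntegral_nonneg (T.isClosed_face i).measurableSet h

theorem abs_faceIntegral_le (i : Fin T.numFaces) (f : E (m + 1) → ℝ) :
    |T.faceIntegral i f| ≤ T.faceIntegral i (fun x => |f x|) :=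
  MeasureTheory.norm_integral_le_integral_norm
    (μ := (Measure.euclideanHausdorffMeasure m : Measure (E (m + 1))).restrict (T.face i)) f

theorem sum_normal_sq (i : Fin T.numFaces) : ∑ l, T.normal i l ^ 2 = 1 := by
  have h := EuclideanSpace.norm_sq_eq (T.normal i)
  rw [T.norm_normal] at h
  simpa using h.symm

theorem normal_comp_sq_le (i : Fin T.numFaces) (a : Fin (m + 1) → ℝ) :
    (∑ l, a l * T.normal i l) ^ 2 ≤ ∑ l, a l ^ 2 := by
  refine (Finset.sum_mul_sq_le_sq_mul_sq _ _ _).trans ?_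
  rw [T.sum_normal_sq, mul_one]

/-- Young's inequality on each face followed by the trace inequality for `q`. The factor `1 / 4`
lets the last term be absorbed when `q` is the quantity to be bounded. -/
theorem exists_face_coupling_le (m N K : ℕ) {r : ℝ} (hr : 0 < r) (hr1 : r ≤ 1) :
    ∃ C, 0 < C ∧ ∀ T : ConvexPolytope (m + 1), T.IsFat N r →
      ∀ q : Fin (m + 1) → MvPolynomial (Fin (m + 1)) ℝ, (∀ l, (q l).totalDegree ≤ K) →
      ∀ w : Fin T.numFaces → MvPolynomial (Fin (m + 1)) ℝ, ∀ c : Fin T.numFaces → ℝ,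
      (∀ i, |c i| ≤ 1) →
      |∑ i, c i * T.faceIntegral i
          (fun x => peval (w i) x * ∑ l, peval (q l) x * T.normal i l)| ≤
        C * (Metric.diam T.carrier)⁻¹ * ∑ i, T.faceIntegral i (fun x => peval (w i) x ^ 2) +
          1 / 4 * T.integral (fun x => ∑ l, peval (q l) x ^ 2) := by
  obtain ⟨C, hC, H⟩ := exists_trace_inequality m N K hr hr1
  refine ⟨(N + 1) * C, by positivity, fun T hT q hq w c hc => ?_⟩
  have hh := T.diam_pos
  set h := Metric.diam T.carrier with hhd
  -- The Young parameter gives each face at most the share `1 / (4 (N + 1))` of the integral of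
  -- `|q|²`; `N + 1` avoids a division by zero.
  set s := (N + 1) * C * h⁻¹ with hs
  have hs0 : 0 < s := by positivity
  set Q := T.integral (fun x => ∑ l, peval (q l) x ^ 2) with hQ
  have hQ0 : 0 ≤ Q := T.integral_nonneg fun x _ => Finset.sum_nonneg fun l _ => sq_nonneg _
  have htrace : ∀ i, T.faceIntegral i (fun x => ∑ l, peval (q l) x ^ 2) ≤ C * h⁻¹ * Q := by
    intro i
    rw [T.faceIntegral_sum i _ fun l _ => by fun_prop, hQ, T.integral_sum _ fun l _ => by fun_prop,
      Finset.mul_sum]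
    refine Finset.sum_le_sum fun l _ => ?_
    have := H T hT (q l) (hq l) i
    rw [mul_comm C, mul_assoc, le_inv_mul_iff₀ hh]
    exact this
  have hterm : ∀ i, |c i * T.faceIntegral i
      (fun x => peval (w i) x * ∑ l, peval (q l) x * T.normal i l)| ≤
        s * T.faceIntegral i (fun x => peval (w i) x ^ 2) + 1 / (4 * (N + 1)) * Q := by
    intro i
    have h1 : |T.faceIntegral i (fun x => peval (w i) x * ∑ l, peval (q l) x * T.normal i l)| ≤
        T.faceIntegral i (fun x => s * peval (w i) x ^ 2 +
          1 / (4 * s) * ∑ l, peval (q l) x ^ 2) := by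
      refine (T.abs_faceIntegral_le i _).trans ?_
      refine T.faceIntegral_mono i (by fun_prop) (by fun_prop) fun x _ => ?_
      have h2 := T.normal_comp_sq_le i fun l => peval (q l) x
      set a := peval (w i) x
      set t := ∑ l, peval (q l) x * T.normal i l
      have h3 : |a * t| ≤ s * a ^ 2 + 1 / (4 * s) * t ^ 2 := by
        rw [abs_le]
        constructor
        · have : 0 ≤ (2 * s * a + t) ^ 2 / (4 * s) := by positivity
          have e : (2 * s * a + t) ^ 2 / (4 * s) = s * a ^ 2 + 1 / (4 * s) * t ^ 2 + a * t := by
            field_simp; ring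
          linarith
        · have : 0 ≤ (2 * s * a - t) ^ 2 / (4 * s) := by positivity
          have e : (2 * s * a - t) ^ 2 / (4 * s) = s * a ^ 2 + 1 / (4 * s) * t ^ 2 - a * t := by
            field_simp; ring
          linarith
      refine h3.trans ?_
      gcongr
    rw [T.faceIntegral_add i (by fun_prop) (by fun_prop), T.faceIntegral_const_mul,
      T.faceIntegral_const_mul] at h1
    rw [abs_mul]
    refine (mul_le_of_le_one_left (abs_nonneg _) (hc i)).trans (h1.trans ?_)
    have h4 := mul_le_mul_of_nonneg_left (htrace i) (by positivity : 0 ≤ 1 / (4 * s))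
    have h5 : 1 / (4 * s) * (C * h⁻¹ * Q) = 1 / (4 * (N + 1)) * Q := by rw [hs]; field_simp
    linarith
  refine (Finset.abs_sum_le_sum_abs _ _).trans
    ((Finset.sum_le_sum fun i _ => hterm i).trans ?_)
  rw [Finset.sum_add_distrib, ← Finset.mul_sum]
  gcongr
  simp only [Finset.sum_const, Finset.card_univ, Fintype.card_fin, nsmul_eq_mul]
  have hn : (T.numFaces : ℝ) ≤ N := by exact_mod_cast hT.numFaces_le
  have e : (T.numFaces : ℝ) * (1 / (4 * (N + 1)) * Q) = T.numFaces / (N + 1) * (1 / 4 * Q) := by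
    field_simp
  rw [e]
  refine mul_le_of_le_one_left (by positivity) ?_
  rw [div_le_one (by positivity)]
  linarith

/-- Tangential testing: the identity obtained from fields that are a bubble times a normal. -/
theorem test_bubble (i : Fin T.numFaces) {k : ℕ} {v : MvPolynomial (Fin (m + 1)) ℝ}
    {w : Fin T.numFaces → MvPolynomial (Fin (m + 1)) ℝ} {c : Fin T.numFaces → ℝ}
    {g : Fin (m + 1) → MvPolynomial (Fin (m + 1)) ℝ}
    (hg : ∀ q : Fin (m + 1) → MvPolynomial (Fin (m + 1)) ℝ,
      (∀ l, (q l).totalDegree ≤ T.numFaces + k - 1) →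
      T.integral (fun x => ∑ l, peval (g l) x * peval (q l) x) =
        T.integral (fun x => ∑ l, peval (MvPolynomial.pderiv l v) x * peval (q l) x) -
          ∑ i, c i * T.faceIntegral i
            (fun x => peval (w i) x * ∑ l, peval (q l) x * T.normal i l))
    (ψ : MvPolynomial (Fin (m + 1)) ℝ) (hψ : ψ.totalDegree ≤ k) :
    T.integral (fun x => (∑ l, peval (g l) x * T.normal i l) *
        (peval (T.bubble (Finset.univ.erase i)) x * peval ψ x)) =
      T.integral (fun x => (∑ l, peval (MvPolynomial.pderiv l v) x * T.normal i l) *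
        (peval (T.bubble (Finset.univ.erase i)) x * peval ψ x)) -
      c i * T.faceIntegral i (fun x => peval (w i) x *
        (peval (T.bubble (Finset.univ.erase i)) x * peval ψ x)) := by
  set B := T.bubble (Finset.univ.erase i) with hB
  have hcard : (Finset.univ.erase i).card = T.numFaces - 1 := by simp
  have hpos : 0 < T.numFaces := i.pos
  -- The degree count is sharp in form: `n - 1` from the bubble plus `k` from `ψ` is exactly the
  -- degree allowed for weak gradients.
  have h := hg (fun l => MvPolynomial.C (T.normal i l) * (B * ψ)) fun l => by
    refine (MvPolynomial.totalDegree_mul _ _).trans ?_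
    rw [MvPolynomial.totalDegree_C, zero_add]
    refine (MvPolynomial.totalDegree_mul _ _).trans ?_
    have : B.totalDegree ≤ (Finset.univ.erase i).card := T.totalDegree_bubble _
    rw [hcard] at this
    omega
  simp only [peval_mul, peval_C] at h
  have h1 : ∀ (a : Fin (m + 1) → ℝ) (t : ℝ), ∑ l, a l * (T.normal i l * t) =
      (∑ l, a l * T.normal i l) * t := fun a t => by
    rw [Finset.sum_mul]; exact Finset.sum_congr rfl fun l _ => by ring
  simp only [h1] at h
  rw [h]
  congr 1
  rw [Finset.sum_eq_single i]
  · congr 1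
    refine T.faceIntegral_congr i fun x _ => ?_
    have : ∑ l, T.normal i l * (peval B x * peval ψ x) * T.normal i l =
        (∑ l, T.normal i l ^ 2) * (peval B x * peval ψ x) := by
      rw [Finset.sum_mul]; exact Finset.sum_congr rfl fun l _ => by ring
    rw [this, T.sum_normal_sq, one_mul]
  · intro j _ hj
    have : T.faceIntegral j (fun x => peval (w j) x *
        ∑ l, T.normal i l * (peval B x * peval ψ x) * T.normal j l) =
        T.faceIntegral j (fun _ => 0) := by
      refine T.faceIntegral_congr j fun x hx => ?_
      rw [hB, T.bubble_eq_zero (Finset.mem_erase.2 ⟨hj, Finset.mem_univ j⟩) hx]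
      simp
    rw [this]
    simp [faceIntegral]
  · intro hi; exact absurd (Finset.mem_univ i) hi

/-- This is the heart of the lower bound: the weak gradient alone controls the jumps, with no term
in `∇v` on the right. Only the normal component of `∇v` enters the test identity, and one extra
affine factor in the test field isolates it. -/
theorem exists_face_estimate (m N k : ℕ) (hk : 1 ≤ k) {r : ℝ} (hr : 0 < r) (hr1 : r ≤ 1) :
    ∃ C, 0 < C ∧ ∀ T : ConvexPolytope (m + 1), T.IsFat N r →
      ∀ (v : MvPolynomial (Fin (m + 1)) ℝ) (w : Fin T.numFaces → MvPolynomial (Fin (m + 1)) ℝ)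
        (c : Fin T.numFaces → ℝ) (g : Fin (m + 1) → MvPolynomial (Fin (m + 1)) ℝ),
      v.totalDegree ≤ k → (∀ i, (w i).totalDegree ≤ k) → (∀ i, 1 / 2 ≤ c i) →
      (∀ q : Fin (m + 1) → MvPolynomial (Fin (m + 1)) ℝ,
        (∀ l, (q l).totalDegree ≤ T.numFaces + k - 1) →
        T.integral (fun x => ∑ l, peval (g l) x * peval (q l) x) =
          T.integral (fun x => ∑ l, peval (MvPolynomial.pderiv l v) x * peval (q l) x) -
            ∑ i, c i * T.faceIntegral i
              (fun x => peval (w i) x * ∑ l, peval (q l) x * T.normal i l)) →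
      ∀ i, T.faceIntegral i (fun x => peval (w i) x ^ 2) ≤
        C * Metric.diam T.carrier * T.integral (fun x => ∑ l, peval (g l) x ^ 2) := by
  obtain ⟨C₂, hC₂, H₂⟩ := exists_integral_le_integral_bubble m N k hr hr1
  obtain ⟨C₃, hC₃, H₃⟩ := exists_face_extension m N k hr hr1
  refine ⟨C₃ * (8 * C₃ * (C₂ + 1)), by positivity, fun T hT v w c g hv hw hc hg i => ?_⟩
  have hh := T.diam_pos
  set h := Metric.diam T.carrier with hhd
  set B := T.bubble (Finset.univ.erase i) with hB
  set G : MvPolynomial (Fin (m + 1)) ℝ := ∑ l, g l * MvPolynomial.C (T.normal i l) with hG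
  set D : MvPolynomial (Fin (m + 1)) ℝ :=
    ∑ l, MvPolynomial.pderiv l v * MvPolynomial.C (T.normal i l) with hD
  have hGe : ∀ x, ∑ l, peval (g l) x * T.normal i l = peval G x := fun x => by
    simp [hG, peval_sum]
  have hDe : ∀ x, ∑ l, peval (MvPolynomial.pderiv l v) x * T.normal i l = peval D x := fun x => by
    simp [hD, peval_sum]
  have hDdeg : D.totalDegree ≤ k - 1 := by
    refine MvPolynomial.totalDegree_finsetSum_le fun l _ => ?_
    refine (MvPolynomial.totalDegree_mul _ _).trans ?_
    rw [MvPolynomial.totalDegree_C, add_zero]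
    exact (totalDegree_pderiv_le l v).trans (by omega)
  have htest := T.test_bubble i hg
  simp only [hGe, hDe, ← hB] at htest
  set Q := T.integral (fun x => ∑ l, peval (g l) x ^ 2) with hQ
  have hGQ : T.integral (fun x => peval G x ^ 2) ≤ Q :=
    T.integral_mono (by fun_prop) (by fun_prop) fun x _ => by
      rw [← hGe]; exact T.normal_comp_sq_le i fun l => peval (g l) x
  set W := T.bubble Finset.univ with hW
  have hWB : ∀ x, peval W x = T.slack i x / h * peval B x := fun x => by
    rw [hW, hB, ← T.bubble_insert (Finset.notMem_erase i _), Finset.insert_erase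
      (Finset.mem_univ i)]
  -- the normal derivative
  have hDQ : T.integral (fun x => peval D x ^ 2 * peval W x) ≤ Q := by
    set lam := affinePoly (h⁻¹ * T.offset i) (h⁻¹ • T.normal i) with hlam
    have hlame : ∀ x, peval lam x = T.slack i x / h := fun x => by
      rw [hlam, peval_affinePoly, real_inner_smul_left, slack]; ring
    -- The factor `lam` vanishes on face `i`, so no face term is left; its degree is paid for by the
    -- derivative in `D`, using `k ≥ 1`.
    have h1 := htest (lam * D) (by
      refine (MvPolynomial.totalDegree_mul _ _).trans ?_
      have := totalDegree_affinePoly (h⁻¹ * T.offset i) (h⁻¹ • T.normal i)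
      rw [← hlam] at this
      omega)
    have h2 : T.faceIntegral i (fun x => peval (w i) x * (peval B x * peval (lam * D) x)) = 0 := by
      have : T.faceIntegral i (fun x => peval (w i) x * (peval B x * peval (lam * D) x)) =
          T.faceIntegral i (fun _ => 0) := by
        refine T.faceIntegral_congr i fun x hx => ?_
        rw [peval_mul, hlame, (T.mem_face_iff.1 hx).2]; simp
      rw [this]; simp [faceIntegral]
    rw [h2, mul_zero, sub_zero] at h1
    have e : ∀ p : MvPolynomial (Fin (m + 1)) ℝ, ∀ x, peval p x * (peval B x * peval (lam * D) x) =
        peval p x * peval D x * peval W x := fun p x => by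
      rw [peval_mul, hlame, hWB]; ring
    simp only [e] at h1
    have h3 : T.integral (fun x => peval G x * peval D x * peval W x) ≤
        T.integral (fun x => 1 / 2 * peval G x ^ 2 + 1 / 2 * (peval D x ^ 2 * peval W x)) := by
      refine T.integral_mono (by fun_prop) (by fun_prop) fun x hx => ?_
      have hW0 := T.bubble_nonneg Finset.univ hx
      have hW1 := T.bubble_le_one Finset.univ hx
      rw [← hW] at hW0 hW1
      nlinarith [mul_nonneg (sq_nonneg (peval G x - peval D x)) hW0,
        mul_nonneg (sq_nonneg (peval G x)) (sub_nonneg.2 hW1)]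
    rw [T.integral_add (by fun_prop) (by fun_prop), T.integral_const_mul, T.integral_const_mul, h1]
      at h3
    have h4 : (fun x => peval D x * peval D x * peval W x) =
        fun x => peval D x ^ 2 * peval W x := by ext x; ring
    rw [h4] at h3
    linarith
  have hDQ' : T.integral (fun x => peval D x ^ 2) ≤ C₂ * Q :=
    (H₂ T hT D (by omega)).trans (by gcongr)
  obtain ⟨w', hw'deg, hw'e, hw'T, hw'F⟩ := H₃ T hT (w i) (hw i) i
  rw [← hB] at hw'T hw'F
  set X := T.faceIntegral i (fun x => peval (w i) x ^ 2 * peval B x) with hX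
  -- Testing with the extended jump produces `c i * X`, where `X` is the weighted square of the jump
  -- on the face.
  have h1 := htest w' hw'deg
  have h2 : T.faceIntegral i (fun x => peval (w i) x * (peval B x * peval w' x)) = X :=
    T.faceIntegral_congr i fun x hx => by rw [hw'e x hx]; ring
  rw [h2] at h1
  have hX0 : 0 ≤ X := T.faceIntegral_nonneg i fun x hx =>
    mul_nonneg (sq_nonneg _) (T.bubble_nonneg _ (T.face_subset_carrier i hx))
  -- Young's inequality is weighted so that the last term, by the bound of the extension, is at most
  -- `X / 4`, which is absorbed into `c i * X ≥ X / 2`.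
  have h3 : T.integral (fun x => peval D x * (peval B x * peval w' x)) -
      T.integral (fun x => peval G x * (peval B x * peval w' x)) ≤
      T.integral (fun x => (2 * C₃ * h) * peval D x ^ 2 + ((2 * C₃ * h) * peval G x ^ 2 +
        1 / (4 * C₃ * h) * peval w' x ^ 2)) := by
    have : T.integral (fun x => peval D x * (peval B x * peval w' x)) ≤
      T.integral (fun x => peval G x * (peval B x * peval w' x) +
        ((2 * C₃ * h) * peval D x ^ 2 + ((2 * C₃ * h) * peval G x ^ 2 +
        1 / (4 * C₃ * h) * peval w' x ^ 2))) := by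
      refine T.integral_mono (by fun_prop) (by fun_prop) fun x hx => ?_
      have hB0 := T.bubble_nonneg (Finset.univ.erase i) hx
      have hB1 := T.bubble_le_one (Finset.univ.erase i) hx
      rw [← hB] at hB0 hB1
      set b := peval B x
      set a := peval D x - peval G x with ha
      set z := peval w' x
      have hb2 : b ^ 2 ≤ 1 := by nlinarith
      have k1 : a * (b * z) ≤ C₃ * h * a ^ 2 + 1 / (4 * C₃ * h) * z ^ 2 := by
        have p1 : 0 ≤ (2 * C₃ * h * a - b * z) ^ 2 / (4 * C₃ * h) := by positivity
        have p2 : (2 * C₃ * h * a - b * z) ^ 2 / (4 * C₃ * h) =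
            C₃ * h * a ^ 2 - a * (b * z) + 1 / (4 * C₃ * h) * (b ^ 2 * z ^ 2) := by
          field_simp; ring
        have p3 : 1 / (4 * C₃ * h) * (b ^ 2 * z ^ 2) ≤ 1 / (4 * C₃ * h) * z ^ 2 := by
          gcongr
          exact mul_le_of_le_one_left (sq_nonneg z) hb2
        linarith
      have k2 : C₃ * h * a ^ 2 ≤ 2 * C₃ * h * peval D x ^ 2 + 2 * C₃ * h * peval G x ^ 2 := by
        have : a ^ 2 ≤ 2 * peval D x ^ 2 + 2 * peval G x ^ 2 := by
          rw [ha]; nlinarith [sq_nonneg (peval D x + peval G x)]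
        have := mul_le_mul_of_nonneg_left this (mul_pos hC₃ hh).le
        linarith
      have k3 : peval D x * (b * z) = peval G x * (b * z) + a * (b * z) := by rw [ha]; ring
      linarith
    rw [T.integral_add (by fun_prop) (by fun_prop)] at this
    linarith
  rw [T.integral_add (by fun_prop) (by fun_prop), T.integral_add (by fun_prop) (by fun_prop),
    T.integral_const_mul, T.integral_const_mul, T.integral_const_mul] at h3
  have h4 : 1 / (4 * C₃ * h) * T.integral (fun x => peval w' x ^ 2) ≤ 1 / 4 * X := by
    calc _ ≤ 1 / (4 * C₃ * h) * (C₃ * h * X) := by gcongr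
      _ = 1 / 4 * X := by field_simp
  have h5 : 1 / 2 * X ≤ c i * X := mul_le_mul_of_nonneg_right (hc i) hX0
  have h6 : 2 * C₃ * h * T.integral (fun x => peval D x ^ 2) ≤ 2 * C₃ * h * (C₂ * Q) := by gcongr
  have h7 : 2 * C₃ * h * T.integral (fun x => peval G x ^ 2) ≤ 2 * C₃ * h * Q := by gcongr
  have h8 : X ≤ 8 * C₃ * (C₂ + 1) * h * Q := by nlinarith
  calc _ ≤ C₃ * X := hw'F
    _ ≤ C₃ * (8 * C₃ * (C₂ + 1) * h * Q) := by gcongr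
    _ = _ := by ring

/-- The local norm equivalence on one element. -/
theorem exists_local_estimate (m N k : ℕ) (hk : 1 ≤ k) {r : ℝ} (hr : 0 < r) (hr1 : r ≤ 1) :
    ∃ C, 0 < C ∧ ∀ T : ConvexPolytope (m + 1), T.IsFat N r →
      ∀ (v : MvPolynomial (Fin (m + 1)) ℝ) (w : Fin T.numFaces → MvPolynomial (Fin (m + 1)) ℝ)
        (c : Fin T.numFaces → ℝ) (g : Fin (m + 1) → MvPolynomial (Fin (m + 1)) ℝ),
      v.totalDegree ≤ k → (∀ i, (w i).totalDegree ≤ k) → (∀ i, 1 / 2 ≤ c i ∧ c i ≤ 1) →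
      (∀ l, (g l).totalDegree ≤ T.numFaces + k - 1) →
      (∀ q : Fin (m + 1) → MvPolynomial (Fin (m + 1)) ℝ,
        (∀ l, (q l).totalDegree ≤ T.numFaces + k - 1) →
        T.integral (fun x => ∑ l, peval (g l) x * peval (q l) x) =
          T.integral (fun x => ∑ l, peval (MvPolynomial.pderiv l v) x * peval (q l) x) -
            ∑ i, c i * T.faceIntegral i
              (fun x => peval (w i) x * ∑ l, peval (q l) x * T.normal i l)) →
      (∀ i, T.faceIntegral i (fun x => peval (w i) x ^ 2) ≤
        C * Metric.diam T.carrier * T.integral (fun x => ∑ l, peval (g l) x ^ 2)) ∧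
      T.integral (fun x => ∑ l, peval (MvPolynomial.pderiv l v) x ^ 2) ≤
        C * T.integral (fun x => ∑ l, peval (g l) x ^ 2) ∧
      T.integral (fun x => ∑ l, peval (g l) x ^ 2) ≤
        C * (T.integral (fun x => ∑ l, peval (MvPolynomial.pderiv l v) x ^ 2) +
          ∑ i, (Metric.diam T.carrier)⁻¹ * T.faceIntegral i (fun x => peval (w i) x ^ 2)) := by
  obtain ⟨C₁, hC₁, H₁⟩ := exists_face_estimate m N k hk hr hr1
  obtain ⟨C₂, hC₂, H₂⟩ := exists_face_coupling_le m N (N + k) hr hr1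
  refine ⟨C₁ + (2 + 2 * (C₂ * (N * C₁))) + (2 + 2 * C₂), by positivity,
    fun T hT v w c g hv hw hc hgd hg => ?_⟩
  have hh := T.diam_pos
  set h := Metric.diam T.carrier with hhd
  have hn := hT.numFaces_le
  have hface := H₁ T hT v w c g hv hw (fun i => (hc i).1) hg
  set Q := T.integral (fun x => ∑ l, peval (g l) x ^ 2) with hQ
  set V := T.integral (fun x => ∑ l, peval (MvPolynomial.pderiv l v) x ^ 2) with hV
  set S := ∑ i, T.faceIntegral i (fun x => peval (w i) x ^ 2) with hS
  have hQ0 : 0 ≤ Q := T.integral_nonneg fun x _ => Finset.sum_nonneg fun l _ => sq_nonneg _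
  have hV0 : 0 ≤ V := T.integral_nonneg fun x _ => Finset.sum_nonneg fun l _ => sq_nonneg _
  have hS0 : 0 ≤ S := Finset.sum_nonneg fun i _ =>
    T.faceIntegral_nonneg i fun x _ => sq_nonneg _
  have hc' : ∀ i, |c i| ≤ 1 := fun i => abs_le.2 ⟨by linarith [(hc i).1], (hc i).2⟩
  have hmix : T.integral (fun x => ∑ l, peval (g l) x * peval (MvPolynomial.pderiv l v) x) ≤
      Q + 1 / 4 * V := by
    rw [hQ, hV, ← T.integral_const_mul, ← T.integral_add (by fun_prop) (by fun_prop)]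
    refine T.integral_mono (by fun_prop) (by fun_prop) fun x _ => ?_
    rw [Finset.mul_sum, ← Finset.sum_add_distrib]
    exact Finset.sum_le_sum fun l _ => by
      nlinarith [sq_nonneg (2 * peval (g l) x - peval (MvPolynomial.pderiv l v) x)]
  have hmix' : T.integral (fun x => ∑ l, peval (MvPolynomial.pderiv l v) x * peval (g l) x) ≤
      V + 1 / 4 * Q := by
    rw [hQ, hV, ← T.integral_const_mul, ← T.integral_add (by fun_prop) (by fun_prop)]
    refine T.integral_mono (by fun_prop) (by fun_prop) fun x _ => ?_
    rw [Finset.mul_sum, ← Finset.sum_add_distrib]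
    exact Finset.sum_le_sum fun l _ => by
      nlinarith [sq_nonneg (2 * peval (MvPolynomial.pderiv l v) x - peval (g l) x)]
  have hSle : h⁻¹ * S ≤ N * C₁ * Q := by
    rw [inv_mul_le_iff₀ hh]
    calc S ≤ ∑ _i : Fin T.numFaces, C₁ * h * Q := Finset.sum_le_sum fun i _ => hface i
      _ = T.numFaces * (C₁ * h * Q) := by simp
      _ ≤ N * (C₁ * h * Q) := by
        have : (T.numFaces : ℝ) ≤ N := by exact_mod_cast hn
        gcongr
      _ = _ := by ring
  refine ⟨fun i => ?_, ?_, ?_⟩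
  · refine (hface i).trans ?_
    gcongr
    have : 0 ≤ C₂ * (N * C₁) := by positivity
    linarith
  · have hdeg : ∀ l, (MvPolynomial.pderiv l v).totalDegree ≤ T.numFaces + k - 1 := fun l =>
      (totalDegree_pderiv_le l v).trans (by omega)
    -- Testing with `∇v`: the two quarters of `V` are absorbed, and the face sum is replaced by `Q`
    -- through `hSle`.
    have h1 := hg _ hdeg
    have h2 := H₂ T hT (fun l => MvPolynomial.pderiv l v) (fun l => (hdeg l).trans (by omega))
      w c hc'
    rw [abs_le] at h2
    simp only [← sq] at h1
    rw [← hV] at h1 h2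
    have h3 : C₂ * h⁻¹ * S ≤ C₂ * (N * C₁ * Q) := by
      rw [mul_assoc]; gcongr
    have h4 : V ≤ (2 + 2 * (C₂ * (N * C₁))) * Q := by linarith [h2.2]
    refine h4.trans (mul_le_mul_of_nonneg_right ?_ hQ0)
    linarith
  -- Testing with `g` itself, with the two quarters of `Q` absorbed.
  · have h1 := hg g hgd
    have h2 := H₂ T hT g (fun l => (hgd l).trans (by omega)) w c hc'
    rw [abs_le] at h2
    simp only [← sq] at h1
    rw [← hQ] at h1 h2
    have h4 : Q ≤ (2 + 2 * C₂) * (V + h⁻¹ * S) := by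
      have : 0 ≤ h⁻¹ * S := by positivity
      nlinarith [h2.1]
    rw [← Finset.mul_sum]
    have : 0 ≤ C₂ * (N * C₁) := by positivity
    refine h4.trans (mul_le_mul_of_nonneg_right ?_ (by positivity))
    linarith

end ConvexPolytope

/-! ### Integration by parts and well-posedness of the weak gradient -/

namespace ConvexPolytope

variable {m : ℕ} (T : ConvexPolytope (m + 1))

/-- Integration by parts on a polytope, for polynomials. -/
theorem integral_by_parts (v : MvPolynomial (Fin (m + 1)) ℝ)
    (q : Fin (m + 1) → MvPolynomial (Fin (m + 1)) ℝ) :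
    T.integral (fun x => peval v x * ∑ l, peval (MvPolynomial.pderiv l (q l)) x) =
      ∑ i, T.faceIntegral i (fun x => peval v x * ∑ l, peval (q l) x * T.normal i l) -
        T.integral (fun x => ∑ l, peval (MvPolynomial.pderiv l v) x * peval (q l) x) := by
  have h1 : ∀ l, T.integral (fun x => peval v x * peval (MvPolynomial.pderiv l (q l)) x +
      peval (MvPolynomial.pderiv l v) x * peval (q l) x) =
        ∑ i, T.faceIntegral i (fun x => peval v x * (peval (q l) x * T.normal i l)) := by
    intro l
    have h2 := T.integral_pderiv (v * q l) l
    have h3 : peval (MvPolynomial.pderiv l (v * q l)) = fun x =>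
        peval v x * peval (MvPolynomial.pderiv l (q l)) x +
          peval (MvPolynomial.pderiv l v) x * peval (q l) x := by
      ext x
      rw [MvPolynomial.pderiv_mul, peval_add, peval_mul, peval_mul]
      ring
    rw [← h3, h2]
    refine Finset.sum_congr rfl fun i _ => ?_
    rw [← T.faceIntegral_const_mul]
    refine T.faceIntegral_congr i fun x _ => ?_
    rw [peval_mul]; ring
  rw [eq_sub_iff_add_eq, ← T.integral_add (by fun_prop) (by fun_prop)]
  simp only [Finset.mul_sum, ← Finset.sum_add_distrib]
  rw [T.integral_sum _ fun l _ => by fun_prop, Finset.sum_congr rfl fun l _ => h1 l,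
    Finset.sum_comm]
  refine Finset.sum_congr rfl fun i _ => ?_
  rw [T.faceIntegral_sum i _ fun l _ => by fun_prop]

/-- The right-hand side of the equation of the weak gradient, as a linear functional of one
component of the test field. -/
noncomputable def weakFunctional (v : MvPolynomial (Fin (m + 1)) ℝ)
    (a : Fin T.numFaces → MvPolynomial (Fin (m + 1)) ℝ) (l : Fin (m + 1)) :
    MvPolynomial (Fin (m + 1)) ℝ →ₗ[ℝ] ℝ where
  toFun φ := -T.integral (fun x => peval v x * peval (MvPolynomial.pderiv l φ) x) +
    ∑ i, T.faceIntegral i (fun x => peval (a i) x * (peval φ x * T.normal i l))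
  map_add' φ ψ := by
    simp only [map_add, peval_add, mul_add, add_mul]
    rw [T.integral_add (by fun_prop) (by fun_prop), Finset.sum_congr rfl fun i _ =>
      T.faceIntegral_add i (by fun_prop) (by fun_prop), Finset.sum_add_distrib]
    ring
  map_smul' c φ := by
    simp only [Derivation.map_smul, peval_smul, mul_assoc, mul_left_comm _ c, RingHom.id_apply,
      smul_eq_mul, T.integral_const_mul, T.faceIntegral_const_mul, ← Finset.mul_sum]
    ring

theorem sum_weakFunctional (v : MvPolynomial (Fin (m + 1)) ℝ)
    (a : Fin T.numFaces → MvPolynomial (Fin (m + 1)) ℝ)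
    (q : Fin (m + 1) → MvPolynomial (Fin (m + 1)) ℝ) :
    ∑ l, T.weakFunctional v a l (q l) =
      -T.integral (fun x => peval v x * ∑ l, peval (MvPolynomial.pderiv l (q l)) x) +
        ∑ i, T.faceIntegral i (fun x => peval (a i) x * ∑ l, peval (q l) x * T.normal i l) := by
  simp only [weakFunctional, LinearMap.coe_mk, AddHom.coe_mk, Finset.sum_add_distrib,
    Finset.sum_neg_distrib, Finset.mul_sum]
  rw [T.integral_sum _ fun l _ => by fun_prop, Finset.sum_comm]
  congr 1
  exact Finset.sum_congr rfl fun i _ => (T.faceIntegral_sum i _ fun l _ => by fun_prop).symm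

theorem exists_ball_subset_carrier : ∃ (c : E (m + 1)) (r : ℝ), 0 < r ∧
    Metric.ball c r ⊆ T.carrier := by
  obtain ⟨x, hx⟩ := T.nonempty_interior
  obtain ⟨ε, hε, hb⟩ := Metric.isOpen_iff.1 isOpen_interior x hx
  exact ⟨x, ε, hε, fun y hy => interior_subset (hb hy)⟩

/-- Existence and uniqueness of the weak gradient on one element. -/
theorem existsUnique_weakGradient (v : MvPolynomial (Fin (m + 1)) ℝ)
    (a : Fin T.numFaces → MvPolynomial (Fin (m + 1)) ℝ) (J : ℕ) :
    ∃! g : Fin (m + 1) → MvPolynomial (Fin (m + 1)) ℝ, (∀ l, (g l).totalDegree ≤ J) ∧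
      ∀ q : Fin (m + 1) → MvPolynomial (Fin (m + 1)) ℝ, (∀ l, (q l).totalDegree ≤ J) →
        T.integral (fun x => ∑ l, peval (g l) x * peval (q l) x) =
          -T.integral (fun x => peval v x * ∑ l, peval (MvPolynomial.pderiv l (q l)) x) +
            ∑ i, T.faceIntegral i
              (fun x => peval (a i) x * ∑ l, peval (q l) x * T.normal i l) := by
  obtain ⟨c, r, hr, hc⟩ := T.exists_ball_subset_carrier
  have hex : ∀ l, ∃ g : MvPolynomial.restrictTotalDegree (Fin (m + 1)) ℝ J,
      ∀ q, l2Form T.carrier T.isCompact_carrier J g q =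
        (T.weakFunctional v a l).domRestrict _ q := fun l =>
    exists_l2Form_eq T.isCompact_carrier hr hc J _
  choose g hg using hex
  refine ⟨fun l => (g l).1, ⟨fun l => (MvPolynomial.mem_restrictTotalDegree _ _ _).1 (g l).2,
    fun q hq => ?_⟩, fun g' hg' => ?_⟩
  · rw [← T.sum_weakFunctional, T.integral_sum _ fun l _ => by fun_prop]
    exact Finset.sum_congr rfl fun l _ =>
      hg l ⟨q l, (MvPolynomial.mem_restrictTotalDegree _ _ _).2 (hq l)⟩
  · obtain ⟨hd, hg'⟩ := hg'
    have hd0 : ∀ l, (g l).1.totalDegree ≤ J := fun l =>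
      (MvPolynomial.mem_restrictTotalDegree _ _ _).1 (g l).2
    have hde : ∀ l, (g' l - (g l).1).totalDegree ≤ J := fun l =>
      (MvPolynomial.totalDegree_sub _ _).trans (max_le (hd l) (hd0 l))
    -- Uniqueness: testing with the difference of two solutions gives a vanishing sum of squared
    -- norms.
    have h1 := hg' (fun l => g' l - (g l).1) hde
    rw [← T.sum_weakFunctional, T.integral_sum _ fun l _ => by fun_prop] at h1
    have h2 : ∑ l, T.weakFunctional v a l (g' l - (g l).1) =
        ∑ l, T.integral (fun x => peval (g l).1 x * peval (g' l - (g l).1) x) :=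
      Finset.sum_congr rfl fun l _ =>
        (hg l ⟨_, (MvPolynomial.mem_restrictTotalDegree _ _ _).2 (hde l)⟩).symm
    have h3 : ∀ l, T.integral (fun x => peval (g' l) x * peval (g' l - (g l).1) x) =
        T.integral (fun x => peval (g' l - (g l).1) x * peval (g' l - (g l).1) x) +
        T.integral (fun x => peval (g l).1 x * peval (g' l - (g l).1) x) := fun l => by
      rw [← T.integral_add (by fun_prop) (by fun_prop)]
      congr 1
      ext x
      rw [peval_sub]; ring
    rw [h2, Finset.sum_congr rfl fun l _ => h3 l, Finset.sum_add_distrib, add_eq_right,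
      Finset.sum_eq_zero_iff_of_nonneg fun l _ => T.integral_nonneg fun x _ => mul_self_nonneg _]
      at h1
    funext l
    exact sub_eq_zero.1 (eq_zero_of_integral_sq_le_zero T.isCompact_carrier hr hc _
      (h1 l (Finset.mem_univ l)).le)

/-- The equation of the weak gradient after integration by parts. -/
theorem weak_equation_eq (v : MvPolynomial (Fin (m + 1)) ℝ)
    (a w : Fin T.numFaces → MvPolynomial (Fin (m + 1)) ℝ) (c : Fin T.numFaces → ℝ)
    (h : ∀ i, ∀ x ∈ T.face i, peval (a i) x - peval v x = -(c i * peval (w i) x))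
    (q : Fin (m + 1) → MvPolynomial (Fin (m + 1)) ℝ) :
    -T.integral (fun x => peval v x * ∑ l, peval (MvPolynomial.pderiv l (q l)) x) +
      ∑ i, T.faceIntegral i (fun x => peval (a i) x * ∑ l, peval (q l) x * T.normal i l) =
    T.integral (fun x => ∑ l, peval (MvPolynomial.pderiv l v) x * peval (q l) x) -
      ∑ i, c i * T.faceIntegral i
        (fun x => peval (w i) x * ∑ l, peval (q l) x * T.normal i l) := by
  have h1 : ∀ i, T.faceIntegral i
      (fun x => peval v x * ∑ l, peval (q l) x * T.normal i l) =
      T.faceIntegral i (fun x => peval (a i) x * ∑ l, peval (q l) x * T.normal i l) +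
        c i * T.faceIntegral i (fun x => peval (w i) x * ∑ l, peval (q l) x * T.normal i l) := by
    intro i
    rw [← T.faceIntegral_const_mul, ← T.faceIntegral_add i (by fun_prop) (by fun_prop)]
    refine T.faceIntegral_congr i fun x hx => ?_
    linear_combination (-∑ l, peval (q l) x * T.normal i l) * h i x hx
  rw [T.integral_by_parts, Finset.sum_congr rfl fun i _ => h1 i, Finset.sum_add_distrib]
  ring

/-! ### Faces shared by two polytopes -/

section SharedFace

variable {T} {T' : ConvexPolytope (m + 1)} {i : Fin T.numFaces} {i' : Fin T'.numFaces}

theorem face_injective {i j : Fin T.numFaces} (h : T.face i = T.face j) : i = j := by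
  obtain ⟨x, hx, hxj⟩ := T.exists_active i
  have hxf : x ∈ T.face i := T.mem_face_iff.2 ⟨T.mem_carrier_iff.2 fun l => by
    by_cases hl : l = i
    · rw [hl, hx]
    · exact (hxj l hl).le, hx⟩
  rw [h] at hxf
  by_contra hij
  exact (hxj j (Ne.symm hij)).ne' (T.mem_face_iff.1 hxf).2

theorem slack_eq_inner {x : E (m + 1)} (hx : T.slack i x = 0) (z : E (m + 1)) :
    T.slack i z = -⟪T.normal i, z - x⟫ := by
  have := T.slack_add i x (z - x)
  rw [add_sub_cancel, hx] at this
  linarith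

theorem mem_face_of_active {x : E (m + 1)} (hx : T.slack i x = 0)
    (hxj : ∀ j ≠ i, 0 < T.slack j x) : x ∈ T.face i :=
  T.mem_face_iff.2 ⟨T.mem_carrier_iff.2 fun l => by
    by_cases hl : l = i
    · rw [hl, hx]
    · exact (hxj l hl).le, hx⟩

theorem eventually_slack_pos {x : E (m + 1)} (hxj : ∀ j ≠ i, 0 < T.slack j x) :
    ∀ᶠ z in 𝓝 x, ∀ j ≠ i, 0 < T.slack j z := by
  simp only [eventually_all]
  exact fun j hj => ((T.continuous_slack j).tendsto x).eventually (lt_mem_nhds (hxj j hj))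

/-- A common face lies in the same hyperplane for both polytopes, and its relative interior is the
same for both. -/
theorem normal_eq_or_neg_of_face_eq (h : T.face i = T'.face i') {x : E (m + 1)}
    (hx : T.slack i x = 0) (hxj : ∀ j ≠ i, 0 < T.slack j x) :
    (T'.normal i' = T.normal i ∨ T'.normal i' = -T.normal i) ∧ T'.slack i' x = 0 ∧
      ∀ j ≠ i', 0 < T'.slack j x := by
  obtain ⟨χ⟩ := T.nonempty_faceChart i
  obtain ⟨y, rfl⟩ : ∃ y, χ y = x := χ.surj x hx
  have hx' : T'.slack i' (χ y) = 0 := by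
    have := mem_face_of_active hx hxj
    rw [h] at this
    exact (T'.mem_face_iff.1 this).2
  obtain ⟨R, hR, hball⟩ := Metric.eventually_nhds_iff_ball.1
    (χ.continuous.continuousAt.eventually (eventually_slack_pos hxj))
  have hface : ∀ z ∈ Metric.ball y R, χ z ∈ T.face i := fun z hz =>
    mem_face_of_active (χ.slack_self z) (hball z hz)
  set τ := χ.tangent (T'.normal i') with hτ
  -- The second polytope's slack vanishes on a relatively open piece of the hyperplane, so its
  -- normal has no tangential part; both normals being of unit length, they agree up to sign.
  have hτ0 : τ = 0 := by
    by_contra hne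
    have hn : 0 < ‖τ‖ := norm_pos_iff.2 hne
    have h1 := hface (y + (R / 2 / ‖τ‖) • τ) (by
      rw [mem_ball_iff_norm, add_sub_cancel_left, norm_smul, Real.norm_of_nonneg (by positivity),
        div_mul_cancel₀ _ hn.ne']
      linarith)
    rw [h] at h1
    have h2 := (T'.mem_face_iff.1 h1).2
    rw [χ.apply_add, slack_add, hx', χ.inner_incl_eq, ← hτ, inner_smul_right,
      real_inner_self_eq_norm_sq] at h2
    have : 0 < R / 2 / ‖τ‖ * ‖τ‖ ^ 2 := by positivity
    linarith
  have hn : T'.normal i' = ⟪T.normal i, T'.normal i'⟫ • T.normal i := by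
    conv_lhs => rw [χ.eq_add_tangent (T'.normal i'), ← hτ, hτ0, map_zero, add_zero]
  have habs : |⟪T.normal i, T'.normal i'⟫| = 1 := by
    have := congrArg norm hn
    rw [norm_smul, T.norm_normal, T'.norm_normal, mul_one, Real.norm_eq_abs] at this
    exact this.symm
  have hpm : T'.normal i' = T.normal i ∨ T'.normal i' = -T.normal i := by
    rcases eq_or_eq_neg_of_abs_eq habs with h1 | h1
    · left; rw [hn, h1, one_smul]
    · right; rw [hn, h1, neg_smul, one_smul]
  refine ⟨hpm, hx', fun j hj => ?_⟩
  obtain ⟨χ'⟩ := T'.nonempty_faceChart i'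
  obtain ⟨y', hy'⟩ : ∃ y', χ' y' = χ y := χ'.surj _ hx'
  rw [← hy']
  refine χ'.slack_pos_of_ball hR (fun z hz => ?_) hj
  rw [← h]
  have hz0 : T.slack i (χ' z) = 0 := by
    have h1 := slack_eq_inner hx' (χ' z)
    rw [χ'.slack_self] at h1
    rw [slack_eq_inner hx (χ' z)]
    rcases hpm with h2 | h2
    · rw [← h2, ← h1]
    · rw [h2, inner_neg_left, neg_neg] at h1
      rw [← h1, neg_zero]
  obtain ⟨w, hw⟩ : ∃ w, χ w = χ' z := χ.surj _ hz0
  rw [← hw]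
  refine hface w ?_
  rw [Metric.mem_ball, ← χ.isometry.dist_eq, hw, ← hy', χ'.isometry.dist_eq]
  exact hz

theorem mem_interior_of_slack_pos {x : E (m + 1)} (h : ∀ j, 0 < T.slack j x) :
    x ∈ interior T.carrier := by
  rw [mem_interior_iff_mem_nhds]
  have : ∀ᶠ z in 𝓝 x, ∀ j, 0 < T.slack j z := by
    rw [eventually_all]
    exact fun j => ((T.continuous_slack j).tendsto x).eventually (lt_mem_nhds (h j))
  filter_upwards [this] with z hz
  exact T.mem_carrier_iff.2 fun j => (hz j).le

/-- With equal normals, a small step inward from `x` would land in both interiors. -/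
theorem normal_ne_of_disjoint_interior (hdisj : Disjoint (interior T.carrier) (interior T'.carrier))
    {x : E (m + 1)} (hx : T.slack i x = 0) (hxj : ∀ j ≠ i, 0 < T.slack j x)
    (hx' : T'.slack i' x = 0) (hxj' : ∀ j ≠ i', 0 < T'.slack j x) :
    T'.normal i' ≠ T.normal i := by
  intro hn
  have htend : Tendsto (fun t : ℝ => x + t • -T.normal i) (𝓝[>] 0) (𝓝 x) := by
    have : Tendsto (fun t : ℝ => x + t • -T.normal i) (𝓝 0) (𝓝 (x + (0 : ℝ) • -T.normal i)) := by
      apply Continuous.tendsto; fun_prop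
    rw [zero_smul, add_zero] at this
    exact this.mono_left nhdsWithin_le_nhds
  obtain ⟨t, ⟨h1, h2⟩, h3⟩ := ((htend.eventually (eventually_slack_pos hxj)).and
    (htend.eventually (eventually_slack_pos hxj'))|>.and self_mem_nhdsWithin).exists
  have ht : (0 : ℝ) < t := h3
  have hm : x + t • -T.normal i ∈ interior T.carrier := mem_interior_of_slack_pos fun j => by
    by_cases hj : j = i
    · rw [hj, slack_add, hx, inner_smul_right, inner_neg_right, real_inner_self_eq_norm_sq,
        T.norm_normal]
      linarith
    · exact h1 j hj
  have hm' : x + t • -T.normal i ∈ interior T'.carrier := mem_interior_of_slack_pos fun j => by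
    by_cases hj : j = i'
    · rw [hj, slack_add, hx', hn, inner_smul_right, inner_neg_right, real_inner_self_eq_norm_sq,
        T.norm_normal]
      linarith
    · exact h2 j hj
  exact Set.disjoint_left.1 hdisj hm hm'

/-- Near `x` only the two opposite half-space constraints matter, and every nearby point satisfies
at least one of them. -/
theorem mem_interior_union_of_normal_eq_neg (hn : T'.normal i' = -T.normal i)
    {x : E (m + 1)} (hx : T.slack i x = 0) (hxj : ∀ j ≠ i, 0 < T.slack j x)
    (hx' : T'.slack i' x = 0) (hxj' : ∀ j ≠ i', 0 < T'.slack j x) :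
    x ∈ interior (T.carrier ∪ T'.carrier) := by
  rw [mem_interior_iff_mem_nhds]
  filter_upwards [eventually_slack_pos hxj, eventually_slack_pos hxj'] with z h1 h2
  have h3 := slack_eq_inner hx z
  have h4 := slack_eq_inner hx' z
  rw [hn, inner_neg_left] at h4
  rcases le_total 0 (T.slack i z) with h | h
  · left
    refine T.mem_carrier_iff.2 fun j => ?_
    by_cases hj : j = i
    · rw [hj]; exact h
    · exact (h1 j hj).le
  · right
    refine T'.mem_carrier_iff.2 fun j => ?_
    by_cases hj : j = i'
    · rw [hj]; linarith
    · exact (h2 j hj).le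

end SharedFace

end ConvexPolytope

/-! ### Sides, edges and jumps of the mesh -/

namespace PolytopalMesh

variable {m : ℕ} {Ω : Set (E (m + 1))} {M : PolytopalMesh Ω}

theorem fst_ne_of_sideSet_eq {s s' : M.Side} (hne : s ≠ s') (h : M.sideSet s = M.sideSet s') :
    s.1 ≠ s'.1 := by
  obtain ⟨T, i⟩ := s
  obtain ⟨T', i'⟩ := s'
  rintro (rfl : T = T')
  exact hne (congrArg _ (ConvexPolytope.face_injective h))

/-- An edge/face common to two elements has opposite outward normals in them. -/
theorem normal_eq_neg_of_sideSet_eq {s s' : M.Side} (hne : s ≠ s')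
    (h : M.sideSet s = M.sideSet s') {x : E (m + 1)} (hx : (M.elem s.1).slack s.2 x = 0)
    (hxj : ∀ j ≠ s.2, 0 < (M.elem s.1).slack j x) :
    (M.elem s'.1).normal s'.2 = -(M.elem s.1).normal s.2 ∧ (M.elem s'.1).slack s'.2 x = 0 ∧
      ∀ j ≠ s'.2, 0 < (M.elem s'.1).slack j x := by
  obtain ⟨h1, h2, h3⟩ := ConvexPolytope.normal_eq_or_neg_of_face_eq h hx hxj
  exact ⟨h1.resolve_left (ConvexPolytope.normal_ne_of_disjoint_interior
    (M.disjoint_interior _ _ (fst_ne_of_sideSet_eq hne h)) hx hxj h2 h3), h2, h3⟩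

/-- At most two sides have the same edge/face. -/
theorem eq_of_sideSet_eq {s s' s'' : M.Side} (h' : s ≠ s') (h'' : s ≠ s'')
    (hs' : M.sideSet s = M.sideSet s') (hs'' : M.sideSet s = M.sideSet s'') : s' = s'' := by
  by_contra hne
  obtain ⟨x, hx, hxj⟩ := (M.elem s.1).exists_active s.2
  obtain ⟨h1, h2, h3⟩ := normal_eq_neg_of_sideSet_eq h' hs' hx hxj
  obtain ⟨h4, -, -⟩ := normal_eq_neg_of_sideSet_eq h'' hs'' hx hxj
  obtain ⟨h5, -, -⟩ := normal_eq_neg_of_sideSet_eq hne (hs'.symm.trans hs'') h2 h3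
  -- Three distinct sides on one edge would have pairwise opposite unit normals, which is
  -- impossible.
  rw [h4, h1, neg_neg] at h5
  have h6 : (M.elem s.1).normal s.2 = 0 := by
    have h6 : (2 : ℝ) • (M.elem s.1).normal s.2 = 0 := by
      rw [two_smul]
      nth_rewrite 1 [← h5]
      exact neg_add_cancel _
    exact (smul_eq_zero.1 h6).resolve_left two_ne_zero
  have h7 := (M.elem s.1).norm_normal s.2
  rw [h6, norm_zero] at h7
  exact zero_ne_one h7

/-- An edge/face common to two elements does not lie on the boundary. -/
theorem not_onBoundary_of_sideSet_eq (hΩ : IsOpen Ω) (hint : interior (closure Ω) = Ω)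
    {s s' : M.Side} (hne : s ≠ s') (h : M.sideSet s = M.sideSet s') : ¬M.OnBoundary s := by
  intro hb
  obtain ⟨x, hx, hxj⟩ := (M.elem s.1).exists_active s.2
  obtain ⟨h1, h2, h3⟩ := normal_eq_neg_of_sideSet_eq hne h hx hxj
  -- The assumption that `Ω` is the interior of its closure is essential here: it rules out slits,
  -- so a point surrounded by two elements lies in `Ω` itself.
  have h4 := interior_mono (Set.union_subset (Set.subset_iUnion (fun T => (M.elem T).carrier) s.1)
    (Set.subset_iUnion (fun T => (M.elem T).carrier) s'.1))
    (ConvexPolytope.mem_interior_union_of_normal_eq_neg h1 hx hxj h2 h3)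
  rw [M.iUnion_carrier, hint] at h4
  have h5 := hb (ConvexPolytope.mem_face_of_active hx hxj)
  rw [hΩ.frontier_eq] at h5
  exact h5.2 h4

theorem exists_opposite_side {s : M.Side} (hs : ¬M.OnBoundary s) :
    ∃ s' : M.Side, s' ≠ s ∧ M.sideSet s' = M.sideSet s ∧ M.opposite s = s'.1 := by
  have h : ∃ T', T' ≠ s.1 ∧ ∃ i', (M.elem T').face i' = (M.elem s.1).face s.2 :=
    (M.conforming s.1 s.2).resolve_left hs
  obtain ⟨h1, i', h2⟩ := h.choose_spec
  refine ⟨⟨h.choose, i'⟩, fun h3 => h1 (congrArg Sigma.fst h3), h2, ?_⟩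
  rw [opposite, dif_pos h]

/-- As at most two sides carry an edge, the choice made in `opposite` is forced. -/
theorem opposite_eq_of_sideSet_eq (hΩ : IsOpen Ω) (hint : interior (closure Ω) = Ω)
    {s s' : M.Side} (hne : s ≠ s') (h : M.sideSet s = M.sideSet s') : M.opposite s = s'.1 := by
  obtain ⟨s'', h1, h2, h3⟩ := exists_opposite_side (not_onBoundary_of_sideSet_eq hΩ hint hne h)
  rw [h3, eq_of_sideSet_eq hne h1.symm h h2.symm]

/-- The `L²` norm of the jump on an edge/face does not depend on the side. -/
theorem faceIntegral_jump_sq_eq (hΩ : IsOpen Ω) (hint : interior (closure Ω) = Ω) (v : M.Broken)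
    {s s' : M.Side} (h : M.sideSet s = M.sideSet s') :
    (M.elem s.1).faceIntegral s.2 (fun x => peval (M.jump v s) x ^ 2) =
      (M.elem s'.1).faceIntegral s'.2 (fun x => peval (M.jump v s') x ^ 2) := by
  rcases eq_or_ne s s' with rfl | hne
  · rfl
  have hj : ∀ x, peval (M.jump v s) x ^ 2 = peval (M.jump v s') x ^ 2 := fun x => by
    rw [jump, if_neg (not_onBoundary_of_sideSet_eq hΩ hint hne h), jump,
      if_neg (not_onBoundary_of_sideSet_eq hΩ hint hne.symm h.symm),
      opposite_eq_of_sideSet_eq hΩ hint hne h, opposite_eq_of_sideSet_eq hΩ hint hne.symm h.symm,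
      peval_sub, peval_sub]
    ring
  simp only [hj]
  unfold ConvexPolytope.faceIntegral
  rw [show (M.elem s.1).face s.2 = (M.elem s'.1).face s'.2 from h]

/-- The factor by which the jump enters in `{v} - v`. -/
noncomputable def jumpFactor (s : M.Side) : ℝ :=
  open Classical in if M.OnBoundary s then 1 else 1 / 2

theorem average_sub_eq {b : BoundaryTreatment} {k : ℕ} {v : M.Broken} (hv : M.InVh b k v)
    (s : M.Side) {x : E (m + 1)} (hx : x ∈ M.sideSet s) :
    peval (M.average b v s) x - peval (v s.1) x = -(jumpFactor s * peval (M.jump v s) x) := by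
  by_cases hs : M.OnBoundary s
  · unfold average jumpFactor jump
    simp only [if_pos hs]
    cases b with
    | strong => simp only [hv.2 s hs x hx]; simp
    | weak => simp [peval]
  · unfold average jumpFactor jump
    simp only [if_neg hs]
    simp only [peval, map_mul, map_add, map_sub, MvPolynomial.eval_C]
    ring

theorem jumpFactor_mem (s : M.Side) : 1 / 2 ≤ jumpFactor s ∧ jumpFactor s ≤ 1 := by
  unfold jumpFactor
  split_ifs <;> norm_num

theorem totalDegree_jump_le {k : ℕ} {v : M.Broken} (hv : ∀ T, (v T).totalDegree ≤ k)
    (s : M.Side) : (M.jump v s).totalDegree ≤ k := by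
  unfold jump
  split_ifs
  · exact hv _
  · exact (MvPolynomial.totalDegree_sub _ _).trans (max_le (hv _) (hv _))

theorem existsUnique_isWeakGradient (b : BoundaryTreatment) (k : ℕ) (v : M.Broken) :
    ∃! g : M.BrokenField, M.IsWeakGradient b k v g := by
  choose g hg hu using fun T => (M.elem T).existsUnique_weakGradient (v T)
    (fun i => M.average b v ⟨T, i⟩) (M.weakDegree k T)
  exact ⟨g, hg, fun g' hg' => funext fun T => hu T _ (hg' T)⟩

theorem isWeakGradient_weakGradient (b : BoundaryTreatment) (k : ℕ) (v : M.Broken) :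
    M.IsWeakGradient b k v (M.weakGradient b k v) :=
  Classical.epsilon_spec (existsUnique_isWeakGradient b k v).exists

/-- The edge/face of a side, as a member of `𝓔_h`. -/
def toEdge (s : M.Side) : M.Edge := ⟨M.sideSet s, s, rfl⟩

theorem sideSet_side (e : M.Edge) : M.sideSet e.side = e.1 := Classical.choose_spec e.2

theorem side_injective : Function.Injective (Edge.side : M.Edge → M.Side) := fun e e' h =>
  Subtype.ext (by rw [← sideSet_side, ← sideSet_side, h])

theorem sum_edge_le {f : M.Side → ℝ} (hf : ∀ s, 0 ≤ f s) :
    ∑ e : M.Edge, f e.side ≤ ∑ T, ∑ i, f ⟨T, i⟩ := by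
  classical
  rw [← Fintype.sum_sigma (fun s : M.Side => f s),
    ← Finset.sum_image (s := Finset.univ) (g := Edge.side) (f := f) side_injective.injOn]
  exact Finset.sum_le_sum_of_subset_of_nonneg (Finset.subset_univ _) fun s _ _ => hf s

/-- Each fibre of `toEdge` has at most two members, and `f` is constant on it. -/
theorem sum_side_le {f : M.Side → ℝ} (hf : ∀ s, 0 ≤ f s)
    (h : ∀ s s', M.sideSet s = M.sideSet s' → f s = f s') :
    ∑ T, ∑ i, f ⟨T, i⟩ ≤ 2 * ∑ e : M.Edge, f e.side := by
  classical
  rw [← Fintype.sum_sigma (fun s : M.Side => f s), Finset.mul_sum,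
    ← Finset.sum_fiberwise Finset.univ (toEdge (M := M)) f]
  refine Finset.sum_le_sum fun e _ => ?_
  have h1 : ∀ s ∈ Finset.univ.filter (fun s : M.Side => toEdge s = e), M.sideSet s = e.1 :=
    fun s hs => congrArg Subtype.val (Finset.mem_filter.1 hs).2
  rw [Finset.sum_congr rfl fun s hs => h s e.side ((h1 s hs).trans (sideSet_side e).symm),
    Finset.sum_const, nsmul_eq_mul]
  refine mul_le_mul_of_nonneg_right ?_ (hf _)
  norm_cast
  by_contra! h2
  obtain ⟨s, hs, s', hs', s'', hs'', h3, h4, h5⟩ := Finset.two_lt_card.1 h2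
  exact h5 (eq_of_sideSet_eq h3 h4 ((h1 s hs).trans (h1 s' hs').symm)
    ((h1 s hs).trans (h1 s'' hs'').symm))

theorem diam_face_le (T : ConvexPolytope (m + 1)) (i : Fin T.numFaces) :
    Metric.diam (T.face i) ≤ Metric.diam T.carrier :=
  Metric.diam_mono (T.face_subset_carrier i) T.isCompact_carrier.isBounded

/-! ### From elements to the whole mesh -/

/-- The two norms on one element. -/
theorem exists_element_estimate (m k : ℕ) (hk : 1 ≤ k) {ρv ρe κ α₀ : ℝ} (hρv : 0 < ρv)
    (hρe : 0 < ρe) (hκ : 0 < κ) (hα₀ : 0 < α₀) :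
    ∃ C, 0 < C ∧ ∀ (Ω : Set (E (m + 1 + 1))) (M : PolytopalMesh Ω),
      (∀ T, (M.elem T).ShapeRegular ρv ρe κ α₀) →
      ∀ (b : BoundaryTreatment) (v : M.Broken), M.InVh b k v → ∀ T,
      (M.elem T).integral (fun x => ∑ l, peval (MvPolynomial.pderiv l (v T)) x ^ 2) +
        ∑ i, (Metric.diam (M.sideSet ⟨T, i⟩))⁻¹ *
          (M.elem T).faceIntegral i (fun x => peval (M.jump v ⟨T, i⟩) x ^ 2) ≤
        C * (M.elem T).integral (fun x => ∑ l, peval (M.weakGradient b k v T l) x ^ 2) ∧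
      (M.elem T).integral (fun x => ∑ l, peval (M.weakGradient b k v T l) x ^ 2) ≤
        C * ((M.elem T).integral (fun x => ∑ l, peval (MvPolynomial.pderiv l (v T)) x ^ 2) +
          ∑ i, (Metric.diam (M.sideSet ⟨T, i⟩))⁻¹ *
            (M.elem T).faceIntegral i (fun x => peval (M.jump v ⟨T, i⟩) x ^ 2)) := by
  obtain ⟨N, r, hr, hfat⟩ := ConvexPolytope.exists_isFat m hρv hρe hκ hα₀
  obtain ⟨C, hC, H⟩ := ConvexPolytope.exists_local_estimate (m + 1) N k hk
    -- The fatness radius is lowered to at most `1`, as the bubble bounds require.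
    (lt_min hr one_pos) (min_le_right r 1)
  refine ⟨C + N * (κ⁻¹ * C), by positivity, fun Ω M hM b v hv T => ?_⟩
  have hT := (hfat _ (hM T)).mono (min_le_left r 1)
  have hg := isWeakGradient_weakGradient b k v T
  have hh := (M.elem T).diam_pos
  have hκh : ∀ i, κ * Metric.diam (M.elem T).carrier ≤ Metric.diam (M.sideSet ⟨T, i⟩) :=
    (hM T).diam_face_ge
  have hpos : ∀ i, 0 < Metric.diam (M.sideSet ⟨T, i⟩) := fun i =>
    (mul_pos hκ hh).trans_le (hκh i)
  have hJ : ∀ i, 0 ≤ (M.elem T).faceIntegral i (fun x => peval (M.jump v ⟨T, i⟩) x ^ 2) :=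
    fun i => (M.elem T).faceIntegral_nonneg i fun x _ => sq_nonneg _
  have hG : 0 ≤ (M.elem T).integral (fun x => ∑ l, peval (M.weakGradient b k v T l) x ^ 2) :=
    (M.elem T).integral_nonneg fun x _ => Finset.sum_nonneg fun l _ => sq_nonneg _
  have hV : 0 ≤ (M.elem T).integral (fun x => ∑ l, peval (MvPolynomial.pderiv l (v T)) x ^ 2) :=
    (M.elem T).integral_nonneg fun x _ => Finset.sum_nonneg fun l _ => sq_nonneg _
  obtain ⟨h1, h2, h3⟩ := H (M.elem T) hT (v T) (fun i => M.jump v ⟨T, i⟩)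
    (fun i => jumpFactor ⟨T, i⟩) (M.weakGradient b k v T) (hv.1 T)
    (fun i => totalDegree_jump_le hv.1 _) (fun i => jumpFactor_mem _) hg.1 fun q hq => by
      rw [hg.2 q hq]
      exact (M.elem T).weak_equation_eq _ _ _ _ (fun i x hx => average_sub_eq hv ⟨T, i⟩ hx) q
  set G := (M.elem T).integral (fun x => ∑ l, peval (M.weakGradient b k v T l) x ^ 2)
  set V := (M.elem T).integral (fun x => ∑ l, peval (MvPolynomial.pderiv l (v T)) x ^ 2)
  constructor
  · have h4 : ∀ i ∈ Finset.univ, (Metric.diam (M.sideSet ⟨T, i⟩))⁻¹ *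
        (M.elem T).faceIntegral i (fun x => peval (M.jump v ⟨T, i⟩) x ^ 2) ≤ κ⁻¹ * C * G := by
      intro i _
      -- The local estimates are scaled by `h_T`, the norm by `h_e`; here `κ h_T ≤ h_e` is used, and
      -- in the other direction `h_e ≤ h_T`.
      calc _ ≤ (κ * Metric.diam (M.elem T).carrier)⁻¹ * (C * Metric.diam (M.elem T).carrier * G) :=
            mul_le_mul (inv_anti₀ (by positivity) (hκh i)) (h1 i) (hJ i) (by positivity)
        _ = κ⁻¹ * C * G := by field_simp
    have h5 := Finset.sum_le_sum h4
    rw [Finset.sum_const, Finset.card_univ, Fintype.card_fin, nsmul_eq_mul] at h5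
    have h6 : ((M.elem T).numFaces : ℝ) * (κ⁻¹ * C * G) ≤ N * (κ⁻¹ * C * G) :=
      mul_le_mul_of_nonneg_right (by exact_mod_cast hT.numFaces_le) (by positivity)
    linarith
  · refine h3.trans (mul_le_mul ?_ ?_ ?_ (by positivity))
    · have : 0 ≤ N * (κ⁻¹ * C) := by positivity
      linarith
    · gcongr with i
      · exact hJ i
      · exact hpos i
      · exact diam_face_le _ i
    · exact add_nonneg hV (Finset.sum_nonneg fun i _ => mul_nonneg (by positivity) (hJ i))

end PolytopalMesh

end ConformingDG

theorem lemma3p2 (d k : ℕ) (hd : 2 ≤ d) (hk : 1 ≤ k) (ρv ρe κ α₀ : ℝ)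
    (hρv : 0 < ρv) (hρe : 0 < ρe) (hκ : 0 < κ) (hα₀ : 0 < α₀) :
    ∃ C₁ C₂ : ℝ, 0 < C₁ ∧ 0 < C₂ ∧
      ∀ (Ω : Set (ConformingDG.E d)), IsOpen Ω → interior (closure Ω) = Ω →
      ∀ (M : ConformingDG.PolytopalMesh Ω),
        (∀ T, (M.elem T).ShapeRegular ρv ρe κ α₀) →
      ∀ (b : ConformingDG.BoundaryTreatment) (v : M.Broken), M.InVh b k v →
        (∃! g : M.BrokenField, M.IsWeakGradient b k v g) ∧
        C₁ * M.norm1h v ≤ M.tripleNorm b k v ∧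
        M.tripleNorm b k v ≤ C₂ * M.norm1h v := by
  obtain ⟨m, rfl⟩ := Nat.exists_eq_add_of_le' hd
  obtain ⟨C, hC, H⟩ := ConformingDG.PolytopalMesh.exists_element_estimate m k hk hρv hρe hκ hα₀
  -- The element estimates concern squares, hence the roots; the factor `2` in the upper constant
  -- comes from interior edges being shared by two sides.
  refine ⟨(√C)⁻¹, √(2 * C), by positivity, by positivity, fun Ω hΩ hint M hM b v hv =>
    ⟨ConformingDG.PolytopalMesh.existsUnique_isWeakGradient b k v, ?_, ?_⟩⟩
  all_goals
    have hJ : ∀ s : M.Side, 0 ≤ (Metric.diam (M.sideSet s))⁻¹ *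
        (M.elem s.1).faceIntegral s.2 (fun x => ConformingDG.peval (M.jump v s) x ^ 2) := fun s =>
      mul_nonneg (inv_nonneg.2 Metric.diam_nonneg)
        ((M.elem s.1).faceIntegral_nonneg _ fun x _ => sq_nonneg _)
  · rw [inv_mul_le_iff₀ (by positivity), ConformingDG.PolytopalMesh.norm1h,
      ConformingDG.PolytopalMesh.tripleNorm, ← Real.sqrt_mul hC.le]
    refine Real.sqrt_le_sqrt ?_
    rw [Finset.mul_sum]
    refine (add_le_add_right (ConformingDG.PolytopalMesh.sum_edge_le hJ) _).trans ?_
    rw [← Finset.sum_add_distrib]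
    exact Finset.sum_le_sum fun T _ => (H Ω M hM b v hv T).1
  · rw [ConformingDG.PolytopalMesh.norm1h,
      ConformingDG.PolytopalMesh.tripleNorm, ← Real.sqrt_mul (by positivity)]
    refine Real.sqrt_le_sqrt ?_
    have h1 := Finset.sum_le_sum fun T (_ : T ∈ Finset.univ) => (H Ω M hM b v hv T).2
    rw [← Finset.mul_sum, Finset.sum_add_distrib] at h1
    have h2 := ConformingDG.PolytopalMesh.sum_side_le hJ fun s s' h => by
      rw [h, ConformingDG.PolytopalMesh.faceIntegral_jump_sq_eq hΩ hint v h]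
    have hV : 0 ≤ ∑ T, (M.elem T).integral (fun x => ∑ l,
        ConformingDG.peval (MvPolynomial.pderiv l (v T)) x ^ 2) :=
      Finset.sum_nonneg fun T _ => (M.elem T).integral_nonneg fun x _ =>
        Finset.sum_nonneg fun l _ => sq_nonneg _
    refine h1.trans ?_
    rw [mul_comm 2 C, mul_assoc]
    refine mul_le_mul_of_nonneg_left ?_ hC.le
    linarith
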